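/- **Setting.** Let $n\ge 1$, let $M$ be a (Hausdorff) smooth manifold of dimension $2n+1$ with a contact form $\theta$ (a smooth 1-form, nowhere zero, with $d\theta$ nondegenerate on the hyperplanes $\mathcal C_m=\ker\theta_m$), and put $\omega=d\theta|_{\mathcal C}$. Let $\mathcal D\subset\mathcal C$ be a smooth $n$-dimensional subdistribution and $\mathcal D^\perp\subset\mathcal C$ its $\omega$-orthogonal complement. Let $$\mathcal E_{\mathcal D}=\{(m,L)\;:\; L\subset\mathcal C_m \text{ a Lagrangian plane of }(\mathcal C_m,\omega_m),\ L\cap\mathcal D_m\neq 0\}.$$ A solution of $\mathcal E_{\mathcal D}$ is an $n$-dimensional embedded submanifold $\Sigma\subset M$ with $T\Sigma\subset\mathcal C$ and $(m,T_m\Sigma)\in\mathcal E_{\mathcal D}$ for all $m\in\Sigma$. A Cauchy datum is an $(n-1)$-dimensional embedded submanifold $N\subset M$ with $TN\subset \mathcal C$. For a smooth function $f$ the Hamiltonian field $Y_f$ is the section of $\mathcal C$ with $\omega(Y_f,\cdot)=df|_{\mathcal C}$. A function $f$ is an intermediate integral of $\mathcal E_{\mathcal D}$ on an open set $W$ if for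 every $c\in\mathbb R$ every $n$-dimensional integral submanifold of $\mathcal C$ contained in $W\cap\{f=c\}$ is a solution of $\mathcal E_{\mathcal D}$. A first integral of a distribution is a smooth function whose differential vanishes on it. **Hypotheses.** $f_1,\dots,f_n:M\to\mathbb R$ are first integrals of $\mathcal D$, or are first integrals of $\mathcal D^\perp$, and they are independent: at every point $\theta,df_1,\dots,df_n$ are linearly independent (equivalently, $Y_{f_1},\dots,Y_{f_n}$ are). $N$ is any Cauchy datum. **Terminology.** $N$ is non-characteristic at $x\in N$ if there are $c_1,\dots,c_n\in\mathbb R$ such that $\sum c_i\,df_i$ vanishes on $T_xN$ and $\sum c_iY_{f_i}(x)\notin T_xN$. A point $m\in N$ is regular if the rank of $(f_1|_N,\dots,f_n|_N)$ is constant near $m$ in $N$, and $N$ is either non-characteristic at $m$ or not non-characteristic at any point of $N$ close to $m$. **Theorem.** 1. The regular points are dense in $N$. 2. Near every regular point $m$ the datum extends to a solution: there are an open neighbourhood $W$ of $m$ in $M$ and a smooth $\psi:\mathbb R^n\to\mathbb R$ such that $f=\psi(f_1,\dots,f_n)$ is an intermediate integral of $\mathcal E_{\mathcal D}$ on $W$,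 $Y_f$ has no zero in $W$, $f$ vanishes on $N\cap W$, and there is a solution $\Sigma\subset W$ of $\mathcal E_{\mathcal D}$ with $N\cap W\subset\Sigma$ and $f|_\Sigma=0$. 3. If $N$ is moreover non-characteristic at the regular point $m$, the solution is obtained by flowing the datum: there are an open neighbourhood $W$ of $m$ and a smooth $\psi$ such that $f=\psi(f_1,\dots,f_n)$ is an intermediate integral of $\mathcal E_{\mathcal D}$ on $W$, $Y_f$ has no zero in $W$, $f$ vanishes on $N\cap W$, $Y_f(m)\notin T_mN$, and, for some open neighbourhood $V\subset W$ of $m$ and some $\varepsilon>0$, the set $$\Sigma=\bigcup_{|t|<\varepsilon}\varphi_t(N\cap V),\qquad \varphi_t=\text{ local flow of } Y_f,$$ contains $N\cap V$, is contained in $W$ and is a solution of $\mathcal E_{\mathcal D}$. -/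

import Mathlib

open Set Filter Topology Manifold
open scoped ContDiff

noncomputable section

namespace MongeAmpere

/-! ### Embedded submanifolds of a smooth manifold, given as subsets -/

/-- `S` is an embedded smooth `k`-dimensional submanifold of the `d`-dimensional manifold `M`:
near each of its points there is a chart of the smooth atlas in which `S` is the slice
`x_k = x_{k+1} = ⋯ = x_{d-1} = 0`. -/
def IsSubmanifold (d k : ℕ) {M : Type*} [TopologicalSpace M]
    [ChartedSpace (EuclideanSpace ℝ (Fin d)) M] (S : Set M) : Prop :=
  ∀ m ∈ S, ∃ e ∈ IsManifold.maximalAtlas (𝓡 d) ∞ M, m ∈ e.source ∧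
    ∀ x ∈ e.source, x ∈ S ↔ ∀ i : Fin d, k ≤ (i : ℕ) → (e x).ofLp i = 0

/-- The tangent space at `m` of a subset `S`: the span of the velocities at `m` of the smooth
curves through `m` that stay in `S`.  If `S` is an embedded submanifold, the velocities already
form a linear subspace, the usual `T_m S ⊆ T_m M`. -/
def tangentPlane (d : ℕ) {M : Type*} [TopologicalSpace M]
    [ChartedSpace (EuclideanSpace ℝ (Fin d)) M] (S : Set M) (m : M) :
    Submodule ℝ (TangentSpace (𝓡 d) m) :=
  Submodule.span ℝ {v | ∃ (γ : ℝ → M) (ε : ℝ), 0 < ε ∧ γ 0 = m ∧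
    ContMDiffOn 𝓘(ℝ, ℝ) (𝓡 d) ∞ γ (Ioo (-ε) ε) ∧ (∀ t ∈ Ioo (-ε) ε, γ t ∈ S) ∧
    v = mfderiv 𝓘(ℝ, ℝ) (𝓡 d) γ 0 (1 : ℝ)}

/-! ### Exterior derivative of a 1-form -/

/-- The local expression of a 1-form `θ` in the preferred chart at `m`. -/
def localForm {d : ℕ} {M : Type*} [TopologicalSpace M]
    [ChartedSpace (EuclideanSpace ℝ (Fin d)) M]
    (θ : ∀ m : M, TangentSpace (𝓡 d) m →L[ℝ] ℝ) (m : M) (y : EuclideanSpace ℝ (Fin d)) :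
    EuclideanSpace ℝ (Fin d) →L[ℝ] ℝ :=
  (θ ((extChartAt (𝓡 d) m).symm y)).comp
    (mfderiv 𝓘(ℝ, EuclideanSpace ℝ (Fin d)) (𝓡 d) (extChartAt (𝓡 d) m).symm y)

/-- The exterior derivative `dθ` of a 1-form at `m`: in the chart at `m`,
`dθ(u, v) = D_u θ(v) - D_v θ(u)`. -/
def extDerivForm {d : ℕ} {M : Type*} [TopologicalSpace M]
    [ChartedSpace (EuclideanSpace ℝ (Fin d)) M]
    (θ : ∀ m : M, TangentSpace (𝓡 d) m →L[ℝ] ℝ) (m : M) :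
    TangentSpace (𝓡 d) m →ₗ[ℝ] TangentSpace (𝓡 d) m →ₗ[ℝ] ℝ :=
  let A : EuclideanSpace ℝ (Fin d) →L[ℝ] EuclideanSpace ℝ (Fin d) →L[ℝ] ℝ :=
    fderiv ℝ (localForm θ m) (extChartAt (𝓡 d) m m)
  let B : EuclideanSpace ℝ (Fin d) →ₗ[ℝ] EuclideanSpace ℝ (Fin d) →ₗ[ℝ] ℝ :=
    (A - A.flip).toLinearMap₁₂
  let J : TangentSpace (𝓡 d) m →ₗ[ℝ] EuclideanSpace ℝ (Fin d) :=
    (mvfderiv (𝓡 d) (extChartAt (𝓡 d) m) m).toLinearMap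
  B.compl₁₂ J J

/-! ### Contact manifolds -/

/-- A contact form on a `(2n+1)`-dimensional smooth manifold: a nowhere vanishing smooth 1-form
`θ` such that `dθ` is nondegenerate on the hyperplane `ker θ` at every point (equivalently
`θ ∧ (dθ)ⁿ` vanishes nowhere). -/
structure ContactForm (n : ℕ) (M : Type*) [TopologicalSpace M]
    [ChartedSpace (EuclideanSpace ℝ (Fin (2 * n + 1))) M]
    [IsManifold (𝓡 (2 * n + 1)) ∞ M] where
  /-- the underlying 1-form -/
  form : ∀ m : M, TangentSpace (𝓡 (2 * n + 1)) m →L[ℝ] ℝ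
  smooth : ContMDiff (𝓡 (2 * n + 1))
    ((𝓡 (2 * n + 1)).prod 𝓘(ℝ, EuclideanSpace ℝ (Fin (2 * n + 1)) →L[ℝ] ℝ)) ∞
    (fun m => (⟨m, form m⟩ : Bundle.TotalSpace (EuclideanSpace ℝ (Fin (2 * n + 1)) →L[ℝ] ℝ)
      (fun m : M => TangentSpace (𝓡 (2 * n + 1)) m →L[ℝ] ℝ)))
  ne_zero : ∀ m, form m ≠ 0
  nondegenerate : ∀ m,
    ((extDerivForm form m).domRestrict₁₂ (form m).ker (form m).ker).Nondegenerate

section Contact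

variable {n : ℕ} {M : Type*} [TopologicalSpace M]
  [ChartedSpace (EuclideanSpace ℝ (Fin (2 * n + 1))) M] [IsManifold (𝓡 (2 * n + 1)) ∞ M]

namespace ContactForm

/-- The contact hyperplane `C_m = ker θ_m`. -/
def plane (θ : ContactForm n M) (m : M) : Submodule ℝ (TangentSpace (𝓡 (2 * n + 1)) m) :=
  (θ.form m).ker

/-- The symplectic form `ω_m = dθ_m` restricted to `C_m`. -/
def omega (θ : ContactForm n M) (m : M) : LinearMap.BilinForm ℝ (θ.plane m) :=
  (extDerivForm θ.form m).domRestrict₁₂ (θ.plane m) (θ.plane m)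

/-- The `ω`-orthogonal complement in `C_m` of a subspace `U` of `C_m`. -/
def orth (θ : ContactForm n M) (m : M) (U : Submodule ℝ (TangentSpace (𝓡 (2 * n + 1)) m)) :
    Submodule ℝ (TangentSpace (𝓡 (2 * n + 1)) m) where
  carrier := {v | v ∈ θ.plane m ∧ ∀ w ∈ U, extDerivForm θ.form m v w = 0}
  add_mem' := by
    rintro a b ⟨ha, ha'⟩ ⟨hb, hb'⟩
    exact ⟨add_mem ha hb, fun w hw => by
      rw [map_add, LinearMap.add_apply, ha' w hw, hb' w hw, add_zero]⟩
  zero_mem' := ⟨zero_mem _, fun w _ => by rw [map_zero, LinearMap.zero_apply]⟩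
  smul_mem' := by
    rintro c a ⟨ha, ha'⟩
    exact ⟨Submodule.smul_mem _ c ha, fun w hw => by
      rw [map_smul, LinearMap.smul_apply, ha' w hw, smul_zero]⟩

instance (m : M) : FiniteDimensional ℝ (TangentSpace (𝓡 (2 * n + 1)) m) :=
  inferInstanceAs (FiniteDimensional ℝ (EuclideanSpace ℝ (Fin (2 * n + 1))))

/-- The Hamiltonian vector field `Y_f` of a function `f`: the section of `C` with
`ω(Y_f, ·) = df` on `C`. -/
def hamiltonian (θ : ContactForm n M) (f : M → ℝ) (m : M) : TangentSpace (𝓡 (2 * n + 1)) m :=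
  (((θ.omega m).toDual (θ.nondegenerate m)).symm
    ((mvfderiv (𝓡 (2 * n + 1)) f m).toLinearMap.domRestrict (θ.plane m)) : θ.plane m)

theorem hamiltonian_mem (θ : ContactForm n M) (f : M → ℝ) (m : M) :
    θ.hamiltonian f m ∈ θ.plane m :=
  Subtype.property _

theorem omega_hamiltonian (θ : ContactForm n M) (f : M → ℝ) (m : M)
    (v : TangentSpace (𝓡 (2 * n + 1)) m) (hv : v ∈ θ.plane m) :
    extDerivForm θ.form m (θ.hamiltonian f m) v = mvfderiv (𝓡 (2 * n + 1)) f m v :=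
  LinearMap.BilinForm.apply_toDual_symm_apply (hB := θ.nondegenerate m)
    (f := (mvfderiv (𝓡 (2 * n + 1)) f m).toLinearMap.domRestrict (θ.plane m)) ⟨v, hv⟩

end ContactForm

/-- A (smooth) `n`-dimensional subdistribution `D` of the contact distribution `C`. -/
structure Subdistribution (θ : ContactForm n M) where
  /-- the `n`-plane `D_m` -/
  plane : ∀ m : M, Submodule ℝ (TangentSpace (𝓡 (2 * n + 1)) m)
  le_contact : ∀ m, plane m ≤ θ.plane m
  finrank_eq : ∀ m, Module.finrank ℝ (plane m) = n
  smooth : ∀ m : M, ∃ U : Set M, IsOpen U ∧ m ∈ U ∧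
    ∃ X : Fin n → ∀ x : M, TangentSpace (𝓡 (2 * n + 1)) x,
      (∀ i, ContMDiffOn (𝓡 (2 * n + 1)) (𝓡 (2 * n + 1)).tangent ∞
        (fun x => (⟨x, X i x⟩ : TangentBundle (𝓡 (2 * n + 1)) M)) U) ∧
      ∀ x ∈ U, plane x = Submodule.span ℝ (range fun i => X i x)

/-- `f` is a first integral of the distribution `P`: a smooth function annihilated by all
vectors of `P`. -/
def IsFirstIntegral (P : ∀ m : M, Submodule ℝ (TangentSpace (𝓡 (2 * n + 1)) m)) (f : M → ℝ) :
    Prop :=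
  ContMDiff (𝓡 (2 * n + 1)) 𝓘(ℝ, ℝ) ∞ f ∧ ∀ m, ∀ v ∈ P m, mvfderiv (𝓡 (2 * n + 1)) f m v = 0

/-- Independence of functions on a contact manifold: at every point the differentials
`df_1, …, df_k` are linearly independent modulo the contact form, that is `θ, df_1, …, df_k` are
linearly independent; equivalently `Y_{f_1}, …, Y_{f_k}` are linearly independent. -/
def IndependentFunctions (θ : ContactForm n M) {k : ℕ} (f : Fin k → M → ℝ) : Prop :=
  ∀ m, LinearIndependent ℝ
    (Fin.cons (θ.form m) (fun i => mvfderiv (𝓡 (2 * n + 1)) (f i) m) :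
      Fin (k + 1) → (TangentSpace (𝓡 (2 * n + 1)) m →L[ℝ] ℝ))

/-! ### Monge–Ampère equations of Goursat type -/

/-- The prolongation `M⁽¹⁾`: all pairs `(m, L)` with `L` a Lagrangian plane of `(C_m, ω_m)`. -/
def prolongation (θ : ContactForm n M) :
    Set (Σ m : M, Submodule ℝ (TangentSpace (𝓡 (2 * n + 1)) m)) :=
  {p | p.2 ≤ θ.plane p.1 ∧ Module.finrank ℝ p.2 = n ∧
    ∀ v ∈ p.2, ∀ w ∈ p.2, extDerivForm θ.form p.1 v w = 0}

/-- The equation `E_D ⊆ M⁽¹⁾`: the Lagrangian planes meeting `D` non-trivially. -/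
def goursatEquation (θ : ContactForm n M) (D : Subdistribution θ) :
    Set (Σ m : M, Submodule ℝ (TangentSpace (𝓡 (2 * n + 1)) m)) :=
  {p | p ∈ prolongation θ ∧ p.2 ⊓ D.plane p.1 ≠ ⊥}

/-- `S` is a `k`-dimensional (embedded) integral submanifold of the contact distribution. -/
def IsIntegralSubmanifold (θ : ContactForm n M) (k : ℕ) (S : Set M) : Prop :=
  IsSubmanifold (2 * n + 1) k S ∧ ∀ m ∈ S, tangentPlane (2 * n + 1) S m ≤ θ.plane m

/-- A solution of a second order equation `E ⊆ M⁽¹⁾`: an `n`-dimensional integral submanifold of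
`C` all of whose tangent planes belong to `E`. -/
def IsSolution (θ : ContactForm n M)
    (E : Set (Σ m : M, Submodule ℝ (TangentSpace (𝓡 (2 * n + 1)) m))) (S : Set M) : Prop :=
  IsIntegralSubmanifold θ n S ∧
    ∀ m ∈ S, (⟨m, tangentPlane (2 * n + 1) S m⟩ :
      Σ m : M, Submodule ℝ (TangentSpace (𝓡 (2 * n + 1)) m)) ∈ E

/-- `f` is an intermediate integral of `E` on the open set `W`: every (Lagrangian) solution in `W`
of one of the first order equations `f = c`, `c ∈ ℝ`, is a solution of `E`. -/
def IsIntermediateIntegralOn (θ : ContactForm n M)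
    (E : Set (Σ m : M, Submodule ℝ (TangentSpace (𝓡 (2 * n + 1)) m))) (f : M → ℝ) (W : Set M) :
    Prop :=
  ∀ (c : ℝ) (S : Set M), S ⊆ W → IsIntegralSubmanifold θ n S → (∀ x ∈ S, f x = c) →
    IsSolution θ E S

/-- `⋃_{|t| < ε} φ_t(S)`, where `φ_t` is the local flow of the vector field `Y`. -/
def flowOut (Y : ∀ x : M, TangentSpace (𝓡 (2 * n + 1)) x) (S : Set M) (ε : ℝ) : Set M :=
  {x | ∃ γ : ℝ → M, IsMIntegralCurveOn γ Y (Ioo (-ε) ε) ∧ γ 0 ∈ S ∧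
    ∃ t ∈ Ioo (-ε) ε, γ t = x}

/-- The rank of the restrictions to `N` of the functions `f_1, …, f_k`, at the point `x`. -/
def restrictedRank {k : ℕ} (f : Fin k → M → ℝ) (N : Set M) (x : M) : ℕ :=
  Module.finrank ℝ ((tangentPlane (2 * n + 1) N x).map
    (LinearMap.pi fun i => (mvfderiv (𝓡 (2 * n + 1)) (f i) x).toLinearMap))

/-- `N` is non-characteristic at `x` with respect to `f_1, …, f_k`: some linear combination
`∑ c_i df_i` vanishes on `T_x N` while the vector `∑ c_i Y_{f_i}` is not tangent to `N`. -/
def NonCharacteristicAt (θ : ContactForm n M) {k : ℕ} (f : Fin k → M → ℝ) (N : Set M) (x : M) :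
    Prop :=
  ∃ c : Fin k → ℝ,
    (∀ v ∈ tangentPlane (2 * n + 1) N x, ∑ i, c i * mvfderiv (𝓡 (2 * n + 1)) (f i) x v = 0) ∧
    ∑ i, c i • θ.hamiltonian (f i) x ∉ tangentPlane (2 * n + 1) N x

/-- `m ∈ N` is a regular point of `N` with respect to `f_1, …, f_k`: near `m` the restrictions of
the `f_i` to `N` have constant rank, and `N` is either non-characteristic at `m` or characteristic
at all of its points near `m`. -/
def IsRegularPoint (θ : ContactForm n M) {k : ℕ} (f : Fin k → M → ℝ) (N : Set M) (m : M) : Prop :=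
  (∃ r : ℕ, ∀ᶠ x in 𝓝[N] m, restrictedRank (n := n) f N x = r) ∧
  (NonCharacteristicAt θ f N m ∨ ∀ᶠ x in 𝓝[N] m, ¬ NonCharacteristicAt θ f N x)

end Contact

end MongeAmpere

end

noncomputable section

set_option linter.unusedSectionVars false

namespace MongeAmpere

/-! ### Inverse function theorem and smooth dependence of flows -/

section Flow

universe u

/-! Write `h = ψ(f_1, …, f_n)`, so that `Y_h = ∑ ∂_i ψ · Y_{f_i}`, and let `L` be the tangent plane
of an `n`-dimensional integral submanifold of `C` on which `h` is constant. Then `L` is Lagrangian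
and `ω(Y_h, L) = dh(L) = 0`, hence `Y_h ∈ L`. If the `f_i` are first integrals of `D^⊥`, then `Y_h ∈
(D^⊥)^⊥ = D`. If they are first integrals of `D`, then `Y_h ∈ L` is orthogonal to `D`, and `L ∩ D =
0` would give `L ⊕ D = C` by dimension, forcing `Y_h = 0`. So `h` is an intermediate integral
wherever `Y_h ≠ 0` (`isIntermediateIntegralOn_comp`). It remains to find such an `h` vanishing on
`N`, and to extend `N` to an `n`-dimensional integral submanifold inside `{h = 0}`.

The function. A linear relation `∑ c_i df_i = 0` on `T_m N` is the differential at `m` of a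
functional relation `ψ(f_1, …, f_n) = 0` on `N`, because the rank of the restrictions is constant
near `m` (`exists_relation`). A nonzero `c` always exists since `dim N = n - 1`, and independence
then gives `Y_h(m) ≠ 0`. At a non-characteristic point `c` can be chosen with `Y_h(m)` transverse to
`N`.

The extension. If `g` vanishes on `N` and `Y_g` is transverse to `N`, flowing `N` along `Y_g` gives
an integral submanifold of one dimension more. In straightened coordinates, `θ(v)` for a constant
vector `v` with `dg(v) = 0` satisfies a homogeneous linear equation along the flow lines
(`isotropic_transport`). If moreover `Y_g h = 0`, then `h` still vanishes on the result. At a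
non-characteristic point take `g = h`. At a regular characteristic point `Y_h` is tangent to `N`
near `m`. Straighten `Y_h` in a chart flattening `N`, choose `Z` outside `T_m N` but `ω`-orthogonal
to it, which exists because `dim N < n`, and let `g` be the linear function of the coordinates with
`dg = ω(Z, ·)` on `C_m` (`exists_transverse_involution`).

Density of regular points follows from lower semicontinuity of the rank: it is locally constant
around a point where it is maximal in a given open set, and non-characteristic points either
accumulate there or are absent nearby.

The analytic input is a smooth local flow, obtained from the inverse function theorem in a space of
curves, and from it the flow box theorem (`exists_flowBox`). -/

theorem exists_localDiffeo {E F : Type*} [NormedAddCommGroup E] [NormedSpace ℝ E]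
    [CompleteSpace E] [NormedAddCommGroup F] [NormedSpace ℝ F] {f : E → F} {a : E}
    {f' : E ≃L[ℝ] F} {U : Set E} (hU : IsOpen U) (ha : a ∈ U) (hf : ContDiffOn ℝ ∞ f U)
    (hf' : HasFDerivAt f (f' : E →L[ℝ] F) a) :
    ∃ e : OpenPartialHomeomorph E F, a ∈ e.source ∧ e.source ⊆ U ∧ ⇑e = f ∧
      ContDiffOn ℝ ∞ e.symm e.target := by
  have hfa : ContDiffAt ℝ ∞ f a := hf.contDiffAt (hU.mem_nhds ha)
  let e0 := hfa.toOpenPartialHomeomorph f hf' (by simp)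
  have he0 : ⇑e0 = f := rfl
  -- Invertible operators form an open set. Shrinking the source to where the derivative stays
  -- invertible makes the inverse smooth on the whole target, not only near `f a`.
  have hcont : ContinuousOn (fderiv ℝ f) U :=
    hf.continuousOn_fderiv_of_isOpen hU (by simp)
  have hnear : ∀ᶠ y in 𝓝 a, y ∈ U ∧ fderiv ℝ f y ∈
      Set.range (ContinuousLinearEquiv.toContinuousLinearMap : (E ≃L[ℝ] F) → E →L[ℝ] F) := by
    refine Filter.Eventually.and (hU.eventually_mem ha) ?_
    have := hcont.continuousAt (hU.mem_nhds ha)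
    exact this (by rw [hf'.fderiv]; exact f'.nhds)
  obtain ⟨V, hV, hVo, haV⟩ := eventually_nhds_iff.1 hnear
  refine ⟨e0.restrOpen V hVo, ⟨hfa.mem_toOpenPartialHomeomorph_source hf' (by simp), haV⟩,
    fun y hy => (hV y hy.2).1, he0, ?_⟩
  intro z hz
  have hy := (e0.restrOpen V hVo).map_target hz
  obtain ⟨hyU, L, hL⟩ := hV _ hy.2
  refine (OpenPartialHomeomorph.contDiffAt_symm (f₀' := L) _ hz ?_ ?_).contDiffWithinAt
  · rw [hL]
    exact ((hf.differentiableOn (by simp)).differentiableAt (hU.mem_nhds hyU)).hasFDerivAt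
  · exact hf.contDiffAt (hU.mem_nhds hyU)

section Compact

variable {K : Type*} [TopologicalSpace K] [CompactSpace K]
variable {E : Type u} [NormedAddCommGroup E] [NormedSpace ℝ E]

/-- Pointwise application of a continuous family of operators to a continuous family of
vectors. -/
def pointwiseApply (K : Type*) [TopologicalSpace K] [CompactSpace K] (E G : Type*)
    [NormedAddCommGroup E] [NormedSpace ℝ E] [NormedAddCommGroup G] [NormedSpace ℝ G] :
    C(K, E →L[ℝ] G) →L[ℝ] C(K, E) →L[ℝ] C(K, G) :=
  LinearMap.mkContinuous₂
    (LinearMap.mk₂ ℝ (fun (A : C(K, E →L[ℝ] G)) (η : C(K, E)) =>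
      (⟨fun t => A t (η t), A.continuous.clm_apply η.continuous⟩ : C(K, G)))
      (fun _ _ _ => by ext; simp) (fun _ _ _ => by ext; simp) (fun _ _ _ => by ext; simp)
      (fun _ _ _ => by ext; simp)) 1 (fun A η => by
        rw [ContinuousMap.norm_le _ (by positivity)]
        intro t
        rw [one_mul]
        exact (ContinuousLinearMap.le_opNorm _ _).trans
          (mul_le_mul (A.norm_coe_le_norm t) (η.norm_coe_le_norm t) (norm_nonneg _)
            (norm_nonneg A)))

/-- The mean value inequality on the segments from `γ t` to `γ t + η t` gives the estimate at each
`t`. It is uniform in `t` because composition with `F'` is continuous for the sup norm. -/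
theorem hasFDerivAt_postcomp {G : Type*} [NormedAddCommGroup G] [NormedSpace ℝ G]
    (F : C(E, G)) (F' : C(E, E →L[ℝ] G)) (hF : ∀ x, HasFDerivAt F (F' x) x) (γ : C(K, E)) :
    HasFDerivAt (fun γ : C(K, E) => F.comp γ) (pointwiseApply K E G (F'.comp γ)) γ := by
  rw [hasFDerivAt_iff_isLittleO_nhds_zero, Asymptotics.isLittleO_iff]
  intro ε hε
  have hc : Continuous fun γ : C(K, E) => F'.comp γ := F'.continuous_postcomp
  obtain ⟨δ, hδ, h⟩ := (Metric.continuousAt_iff (f := fun γ : C(K, E) => F'.comp γ) (a := γ)).1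
    hc.continuousAt ε hε
  filter_upwards [Metric.ball_mem_nhds (0 : C(K, E)) hδ] with η hη
  rw [mem_ball_zero_iff] at hη
  rw [ContinuousMap.norm_le _ (by positivity)]
  intro t
  have key := Convex.norm_image_sub_le_of_norm_fderiv_le' (𝕜 := ℝ) (f := F) (C := ε)
    (s := segment ℝ (γ t) (γ t + η t)) (x := γ t) (y := γ t + η t) (φ := F' (γ t))
    (fun x _ => (hF x).differentiableAt) ?_ (convex_segment _ _) (left_mem_segment _ _ _)
    (right_mem_segment _ _ _)
  · rw [add_sub_cancel_left] at key
    exact key.trans (mul_le_mul_of_nonneg_left (η.norm_coe_le_norm t) hε.le)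
  · intro x hx
    rw [segment_eq_image'] at hx
    obtain ⟨s, hs, rfl⟩ := hx
    rw [(hF _).fderiv, add_sub_cancel_left]
    have h1 : dist (γ + s • η) γ < δ := by
      rw [dist_eq_norm, add_sub_cancel_left, norm_smul, Real.norm_of_nonneg hs.1]
      exact (mul_le_of_le_one_left (norm_nonneg _) hs.2).trans_lt hη
    have h2 := (ContinuousMap.dist_apply_le_dist (f := F'.comp (γ + s • η)) (g := F'.comp γ) t).trans (h h1).le
    rwa [dist_eq_norm] at h2

/-- The derivative is again a postcomposition, with `fderiv ℝ F`, followed by a bounded linear map,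
so one inducts on the order. The induction replaces `G` by `E →L[ℝ] G`, which is why both spaces
live in one universe. -/
theorem contDiff_postcomp {G : Type u} [NormedAddCommGroup G] [NormedSpace ℝ G]
    (F : C(E, G)) (hF : ContDiff ℝ ∞ F) :
    ContDiff ℝ ∞ (fun γ : C(K, E) => F.comp γ) := by
  rw [contDiff_infty]
  intro k
  induction k generalizing G with
  | zero =>
    rw [Nat.cast_zero, contDiff_zero]
    exact F.continuous_postcomp
  | succ k ih =>
    rw [Nat.cast_succ, contDiff_succ_iff_hasFDerivAt]
    have h1 : ContDiff ℝ ∞ (fderiv ℝ F) := hF.fderiv_right (by simp)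
    exact ⟨fun γ => pointwiseApply K E G (ContinuousMap.comp ⟨_, h1.continuous⟩ γ),
      (pointwiseApply K E G).contDiff.fun_comp (ih ⟨_, h1.continuous⟩ h1), fun γ =>
      hasFDerivAt_postcomp F ⟨_, h1.continuous⟩
        (fun x => (hF.differentiable (by simp) x).hasFDerivAt) γ⟩

end Compact

end Flow

/-! ### Smooth local flows from the inverse function theorem in the space of curves -/

section SmoothFlow

universe u

variable {E : Type u} [NormedAddCommGroup E] [NormedSpace ℝ E]

/-- The inclusion of the constant curves. -/
def constCurve (E : Type*) [NormedAddCommGroup E] [NormedSpace ℝ E] :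
    E →L[ℝ] C(Icc (-1 : ℝ) 1, E) :=
  LinearMap.mkContinuous
    { toFun := fun x => ContinuousMap.const _ x
      map_add' := fun _ _ => rfl
      map_smul' := fun _ _ => rfl } 1 (fun x => by
        rw [ContinuousMap.norm_le _ (by positivity), one_mul]
        exact fun _ => le_rfl)

@[simp] theorem constCurve_apply (x : E) (t : Icc (-1 : ℝ) 1) : constCurve E x t = x := rfl

theorem continuous_extend {F : Type*} [NormedAddCommGroup F] (γ : C(Icc (-1 : ℝ) 1, F)) :
    Continuous (IccExtend (show (-1 : ℝ) ≤ 1 by norm_num) γ) :=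
  γ.continuous.Icc_extend'

/-- The primitive vanishing at `0` of a curve on `[-1, 1]`. -/
def curveIntegral (E : Type*) [NormedAddCommGroup E] [NormedSpace ℝ E] :
    C(Icc (-1 : ℝ) 1, E) →L[ℝ] C(Icc (-1 : ℝ) 1, E) :=
  LinearMap.mkContinuous
    { toFun := fun γ => ⟨fun t => ∫ τ in (0 : ℝ)..t,
          IccExtend (show (-1 : ℝ) ≤ 1 by norm_num) γ τ,
        (intervalIntegral.continuous_primitive
          (fun _ _ => (continuous_extend γ).intervalIntegrable _ _) 0).comp
          continuous_subtype_val⟩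
      map_add' := fun γ η => by
        ext t
        exact intervalIntegral.integral_add ((continuous_extend γ).intervalIntegrable _ _)
          ((continuous_extend η).intervalIntegrable _ _)
      map_smul' := fun c γ => by
        ext t
        exact intervalIntegral.integral_smul c _ } 1 (fun γ => by
    rw [ContinuousMap.norm_le _ (by positivity), one_mul]
    intro t
    refine (intervalIntegral.norm_integral_le_of_norm_le_const (C := ‖γ‖)
      (fun τ _ => γ.norm_coe_le_norm _)).trans ?_
    refine mul_le_of_le_one_right (norm_nonneg γ) ?_
    rw [sub_zero, abs_le]
    exact t.2)

theorem curveIntegral_apply (γ : C(Icc (-1 : ℝ) 1, E)) (t : Icc (-1 : ℝ) 1) :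
    curveIntegral E γ t = ∫ τ in (0 : ℝ)..t, IccExtend (show (-1 : ℝ) ≤ 1 by norm_num) γ τ :=
  rfl

/-- The curve `t ↦ γ (σ t)`. -/
def rescaleCurve (σ : Icc (-1 : ℝ) 1) (γ : C(Icc (-1 : ℝ) 1, E)) : C(Icc (-1 : ℝ) 1, E) :=
  γ.comp ⟨fun t => ⟨σ * t, by
    rw [mem_Icc, ← abs_le, abs_mul]
    exact mul_le_one₀ (abs_le.2 σ.2) (abs_nonneg _) (abs_le.2 t.2)⟩, by fun_prop⟩

/-- Substitution in the integral, valid also for `σ = 0`. It shows that a rescaled solution of the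
integral equation solves it for the rescaled time parameter. -/
theorem curveIntegral_rescaleCurve (σ : Icc (-1 : ℝ) 1) (γ : C(Icc (-1 : ℝ) 1, E)) :
    rescaleCurve σ (curveIntegral E γ) = (σ : ℝ) • curveIntegral E (rescaleCurve σ γ) := by
  ext t
  have h1 : (rescaleCurve σ (curveIntegral E γ)) t =
      ∫ τ in (0 : ℝ)..(σ * t), IccExtend (show (-1 : ℝ) ≤ 1 by norm_num) γ τ := rfl
  rw [h1, ContinuousMap.smul_apply, curveIntegral_apply]
  have h2 := intervalIntegral.smul_integral_comp_mul_left
    (f := IccExtend (show (-1 : ℝ) ≤ 1 by norm_num) γ) (a := 0) (b := t) (σ : ℝ)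
  rw [mul_zero] at h2
  rw [← h2]
  congr 1
  refine intervalIntegral.integral_congr fun τ hτ => ?_
  have hτ' : τ ∈ Icc (-1 : ℝ) 1 := by
    rw [mem_uIcc] at hτ
    have := t.2.1; have := t.2.2
    constructor <;> rcases hτ with h | h <;> linarith [h.1, h.2]
  have hs : (σ : ℝ) * τ ∈ Icc (-1 : ℝ) 1 := by
    rw [mem_Icc, ← abs_le, abs_mul]
    exact mul_le_one₀ (abs_le.2 σ.2) (abs_nonneg _) (abs_le.2 hτ')
  rw [IccExtend_of_mem _ _ hs, IccExtend_of_mem _ _ hτ']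
  rfl

variable [CompleteSpace E]

/-- The curve `Γ (s, x)` is `t ↦ φ_{st}(x)`. Putting the time `s` in the equation as a parameter
makes the problem trivial at `s = 0`, where the inverse function theorem applies. The last clause is
the local uniqueness contained in that theorem. -/
theorem exists_smooth_solution {Y : E → E} (hY : ContDiff ℝ ∞ Y) (p : E) :
    ∃ Γ : ℝ × E → C(Icc (-1 : ℝ) 1, E), ∃ r > 0,
      ContDiffOn ℝ ∞ Γ (Metric.ball 0 r ×ˢ Metric.ball p r) ∧
      (∀ s ∈ Metric.ball (0 : ℝ) r, ∀ x ∈ Metric.ball p r,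
        Γ (s, x) = constCurve E x + s • curveIntegral E (ContinuousMap.comp ⟨Y, hY.continuous⟩ (Γ (s, x)))) ∧
      ∀ s ∈ Metric.ball (0 : ℝ) r, ∀ x ∈ Metric.ball p r, ∀ σ : Icc (-1 : ℝ) 1,
        Γ (σ * s, x) = rescaleCurve σ (Γ (s, x)) := by
  let X := C(Icc (-1 : ℝ) 1, E)
  let Z := ℝ × E × X
  let Yc : C(E, E) := ⟨Y, hY.continuous⟩
  have hYc : ContDiff ℝ ∞ fun γ : X => Yc.comp γ := contDiff_postcomp Yc hY
  let g : Z → X := fun z => curveIntegral E (Yc.comp z.2.2)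
  have hg : ContDiff ℝ ∞ g :=
    (curveIntegral E).contDiff.fun_comp (hYc.fun_comp (contDiff_snd.fun_comp contDiff_snd))
  let Ψ : Z → Z := fun z => (z.1, z.2.1, z.2.2 - constCurve E z.2.1 - z.1 • g z)
  have hΨ : ContDiff ℝ ∞ Ψ := by
    refine contDiff_fst.prodMk ((contDiff_fst.fun_comp contDiff_snd).prodMk ?_)
    exact ((contDiff_snd.fun_comp contDiff_snd).sub ((constCurve E).contDiff.fun_comp
      (contDiff_fst.fun_comp contDiff_snd))).sub (contDiff_fst.smul hg)
  let z0 : Z := (0, p, constCurve E p)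
  let v : X := g z0
  let πs : Z →L[ℝ] ℝ := ContinuousLinearMap.fst ℝ ℝ (E × X)
  let πx : Z →L[ℝ] E := (ContinuousLinearMap.fst ℝ E X).comp (ContinuousLinearMap.snd ℝ ℝ (E × X))
  let πγ : Z →L[ℝ] X := (ContinuousLinearMap.snd ℝ E X).comp (ContinuousLinearMap.snd ℝ ℝ (E × X))
  -- At `s = 0` the derivative of `g` is multiplied by zero, so the derivative of `Ψ` is a unipotent
  -- triangular operator whose inverse `B` is explicit.
  let A : Z →L[ℝ] Z := πs.prod (πx.prod (πγ - (constCurve E).comp πx - πs.smulRight v))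
  let B : Z →L[ℝ] Z := πs.prod (πx.prod (πγ + (constCurve E).comp πx + πs.smulRight v))
  let L : Z ≃L[ℝ] Z := ContinuousLinearEquiv.equivOfInverse A B
    (fun z => by
      refine Prod.ext rfl (Prod.ext rfl ?_)
      change (z.2.2 - constCurve E z.2.1 - z.1 • v) + constCurve E z.2.1 + z.1 • v = z.2.2
      abel)
    (fun z => by
      refine Prod.ext rfl (Prod.ext rfl ?_)
      change (z.2.2 + constCurve E z.2.1 + z.1 • v) - constCurve E z.2.1 - z.1 • v = z.2.2
      abel)
  have hL : HasFDerivAt Ψ (L : Z →L[ℝ] Z) z0 := by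
    have h1 : HasFDerivAt (fun z : Z => z.1 • g z) (πs.smulRight v) z0 := by
      have := (πs.hasFDerivAt (x := z0)).smul
        ((hg.differentiable (by simp) z0).hasFDerivAt)
      have h0 : πs z0 = 0 := rfl
      rw [h0, zero_smul, zero_add] at this
      exact this
    exact πs.hasFDerivAt.prodMk (πx.hasFDerivAt.prodMk
      ((πγ.hasFDerivAt.sub ((constCurve E).hasFDerivAt.comp z0 πx.hasFDerivAt)).sub h1))
  obtain ⟨e, hz0, -, he, hsymm⟩ :=
    exists_localDiffeo isOpen_univ (mem_univ z0) hΨ.contDiffOn hL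
  obtain ⟨ρ, hρ, hball⟩ := Metric.isOpen_iff.1 e.open_source z0 hz0
  have hew0 : e z0 = (0, p, 0) := by
    rw [he]
    refine Prod.ext rfl (Prod.ext rfl ?_)
    change constCurve E p - constCurve E p - (0 : ℝ) • v = 0
    simp
  let j : ℝ × E → Z := fun q => (q.1, q.2, 0)
  have hj : ContDiff ℝ ∞ j := contDiff_fst.prodMk (contDiff_snd.prodMk contDiff_const)
  have hj0 : j (0, p) ∈ e.target := by
    have := e.map_source hz0
    rwa [hew0] at this
  let Γ : ℝ × E → X := fun q => (e.symm (j q)).2.2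
  have hΓsm : ContDiffOn ℝ ∞ Γ (j ⁻¹' e.target) :=
    (contDiff_snd.fun_comp contDiff_snd).comp_contDiffOn
      (hsymm.comp hj.contDiffOn (fun _ h => h))
  have hΓ0 : Γ (0, p) = constCurve E p := by
    have : e.symm (j (0, p)) = z0 := by
      have := e.left_inv hz0
      rwa [hew0] at this
    change (e.symm (j (0, p))).2.2 = _
    rw [this]
  have hopen : IsOpen (j ⁻¹' e.target) := e.open_target.preimage hj.continuous
  have hcont : ContinuousAt Γ (0, p) := hΓsm.continuousOn.continuousAt (hopen.mem_nhds hj0)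
  have hnear : ∀ᶠ q in 𝓝 ((0 : ℝ), p), j q ∈ e.target ∧ dist (Γ q) (constCurve E p) < ρ := by
    refine Filter.Eventually.and (hopen.eventually_mem hj0) ?_
    have := hcont.eventually (Metric.ball_mem_nhds _ hρ)
    rwa [hΓ0] at this
  obtain ⟨r, hr, hrb⟩ := Metric.eventually_nhds_iff_ball.1 hnear
  rw [← ball_prod_same] at hrb
  have hmem : ∀ s ∈ Metric.ball (0 : ℝ) (min r ρ), ∀ x ∈ Metric.ball p (min r ρ),
      ((s, x) : ℝ × E) ∈ Metric.ball (0 : ℝ) r ×ˢ Metric.ball p r := fun s hs x hx =>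
    ⟨Metric.ball_subset_ball (min_le_left _ _) hs, Metric.ball_subset_ball (min_le_left _ _) hx⟩
  have hsol : ∀ s ∈ Metric.ball (0 : ℝ) (min r ρ), ∀ x ∈ Metric.ball p (min r ρ),
      Γ (s, x) = constCurve E x + s • curveIntegral E (Yc.comp (Γ (s, x))) := by
    intro s hs x hx
    have h1 := e.right_inv (hrb _ (hmem s hs x hx)).1
    rw [he] at h1
    have hs1 : (e.symm (j (s, x))).1 = s := congrArg (fun z : Z => z.1) h1
    have hx1 : (e.symm (j (s, x))).2.1 = x := congrArg (fun z : Z => z.2.1) h1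
    have h2 : (e.symm (j (s, x))).2.2 - constCurve E (e.symm (j (s, x))).2.1 -
      (e.symm (j (s, x))).1 • curveIntegral E (Yc.comp (e.symm (j (s, x))).2.2) = 0 :=
      congrArg (fun z : Z => z.2.2) h1
    rw [hs1, hx1, sub_sub, sub_eq_zero] at h2
    exact h2
  refine ⟨Γ, min r ρ, lt_min hr hρ, hΓsm.mono fun q hq => (hrb _ (hmem _ hq.1 _ hq.2)).1,
    hsol, ?_⟩
  intro s hs x hx σ
  have hσs : (σ : ℝ) * s ∈ Metric.ball (0 : ℝ) (min r ρ) := by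
    rw [mem_ball_zero_iff, norm_mul] at *
    exact (mul_le_of_le_one_left (norm_nonneg _) (abs_le.2 σ.2)).trans_lt hs
  -- `e` is injective only on its source. Rescaling does not increase the distance to a constant
  -- curve, so the rescaled curve stays in the ball of radius `ρ`.
  have hsrc : (((σ : ℝ) * s, x, rescaleCurve σ (Γ (s, x))) : Z) ∈ e.source := by
    apply hball
    rw [← ball_prod_same, ← ball_prod_same]
    refine ⟨Metric.ball_subset_ball (min_le_right _ _) hσs,
      Metric.ball_subset_ball (min_le_right _ _) hx, ?_⟩
    refine lt_of_le_of_lt ?_ (hrb _ (hmem s hs x hx)).2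
    exact (ContinuousMap.dist_le dist_nonneg).2 fun t =>
      ContinuousMap.dist_apply_le_dist (f := Γ (s, x)) (g := constCurve E p) _
  have hval : e ((σ : ℝ) * s, x, rescaleCurve σ (Γ (s, x))) = j (σ * s, x) := by
    rw [he]
    refine Prod.ext rfl (Prod.ext rfl ?_)
    change rescaleCurve σ (Γ (s, x)) - constCurve E x -
      ((σ : ℝ) * s) • curveIntegral E (Yc.comp (rescaleCurve σ (Γ (s, x)))) = 0
    have h3 : rescaleCurve σ (Γ (s, x)) = constCurve E x +
        s • rescaleCurve σ (curveIntegral E (Yc.comp (Γ (s, x)))) := by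
      conv_lhs => rw [hsol s hs x hx]
      rfl
    have h4 : Yc.comp (rescaleCurve σ (Γ (s, x))) = rescaleCurve σ (Yc.comp (Γ (s, x))) := rfl
    rw [h4, h3, curveIntegral_rescaleCurve, smul_smul, mul_comm s]
    abel
  change (e.symm (j (σ * s, x))).2.2 = _
  rw [← hval, e.left_inv hsrc]

/-- The flow is the endpoint `Γ (s, x) 1`. By the scaling property, nearby times are read off from
one fixed curve, which is differentiated by the fundamental theorem of calculus. -/
theorem exists_smooth_flow {Y : E → E} (hY : ContDiff ℝ ∞ Y) (p : E) :
    ∃ φ : ℝ × E → E, ∃ r > 0,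
      ContDiffOn ℝ ∞ φ (Metric.ball 0 r ×ˢ Metric.ball p r) ∧
      (∀ x ∈ Metric.ball p r, φ (0, x) = x) ∧
      ∀ s ∈ Metric.ball (0 : ℝ) r, ∀ x ∈ Metric.ball p r,
        HasDerivAt (fun τ => φ (τ, x)) (Y (φ (s, x))) s := by
  obtain ⟨Γ, r, hr, hsm, hsol, hresc⟩ := exists_smooth_solution hY p
  have hI : (-1 : ℝ) ≤ 1 := by norm_num
  let one : Icc (-1 : ℝ) 1 := ⟨1, by norm_num⟩
  have hscale : ∀ s ∈ Metric.ball (0 : ℝ) r, ∀ x ∈ Metric.ball p r, ∀ σ : Icc (-1 : ℝ) 1,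
      Γ (σ * s, x) one = Γ (s, x) σ := by
    intro s hs x hx σ
    rw [hresc s hs x hx σ]
    change Γ (s, x) ⟨(σ : ℝ) * 1, _⟩ = _
    congr 1
    exact Subtype.ext (mul_one _)
  refine ⟨fun q => Γ q one, r, hr, (ContinuousMap.evalCLM ℝ one).contDiff.fun_comp_contDiffOn hsm,
    fun x hx => ?_, fun s hs x hx => ?_⟩
  · change Γ (0, x) one = x
    rw [hsol 0 (Metric.mem_ball_self hr) x hx, zero_smul, add_zero]
    rfl
  · rw [mem_ball_zero_iff, Real.norm_eq_abs] at hs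
    -- A time strictly between `|s|` and `r`: then `τ / s0` lies in `[-1, 1]` for all `τ` near `s`,
    -- so a two-sided derivative is available.
    set s0 : ℝ := (|s| + r) / 2 with hs0
    have hs0pos : 0 < s0 := by positivity
    have hs0r : s0 ∈ Metric.ball (0 : ℝ) r := by
      rw [mem_ball_zero_iff, Real.norm_of_nonneg hs0pos.le]; linarith
    have hss0 : |s| < s0 := by linarith
    have hdiv : ∀ τ, |τ| ≤ s0 → τ / s0 ∈ Icc (-1 : ℝ) 1 := fun τ hτ => by
      rw [mem_Icc, ← abs_le, abs_div, abs_of_pos hs0pos]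
      exact div_le_one_of_le₀ hτ hs0pos.le
    let c : ℝ → E := IccExtend hI (ContinuousMap.comp ⟨Y, hY.continuous⟩ (Γ (s0, x)))
    have hc : Continuous c := continuous_extend _
    have hφ : ∀ τ (hτ : |τ| ≤ s0), Γ (τ, x) one = Γ (s0, x) ⟨τ / s0, hdiv τ hτ⟩ := by
      intro τ hτ
      rw [← hscale s0 hs0r x hx ⟨τ / s0, hdiv τ hτ⟩]
      simp only
      rw [div_mul_cancel₀ _ hs0pos.ne']
    have hev : (fun τ => Γ (τ, x) one) =ᶠ[𝓝 s]
        fun τ => x + s0 • ∫ u in (0 : ℝ)..(τ / s0), c u := by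
      have : ∀ᶠ τ in 𝓝 s, |τ| < s0 := continuous_abs.continuousAt.eventually_lt
        continuousAt_const hss0
      filter_upwards [this] with τ hτ
      rw [hφ τ hτ.le, hsol s0 hs0r x hx]
      rfl
    refine HasDerivAt.congr_of_eventuallyEq ?_ hev
    have h1 : HasDerivAt (fun t => ∫ u in (0 : ℝ)..t, c u) (c (s / s0)) (s / s0) :=
      intervalIntegral.integral_hasDerivAt_right (hc.intervalIntegrable _ _)
        hc.stronglyMeasurable.stronglyMeasurableAtFilter hc.continuousAt
    have h2 : HasDerivAt (fun τ : ℝ => τ / s0) (1 / s0) s := (hasDerivAt_id s).div_const s0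
    have h3 := ((h1.scomp s h2).const_smul s0).const_add x
    have h4 : s0 • (1 / s0) • c (s / s0) = Y (Γ (s, x) one) := by
      rw [smul_smul, mul_one_div_cancel hs0pos.ne', one_smul, hφ s hss0.le]
      change IccExtend hI _ _ = _
      rw [IccExtend_of_mem _ _ (hdiv s hss0.le)]
      rfl
    rw [← h4]
    exact h3

end SmoothFlow

/-! ### Cut-off and the flow box theorem -/

section Local

variable {E F : Type*} [NormedAddCommGroup E] [NormedSpace ℝ E] [FiniteDimensional ℝ E]
  [NormedAddCommGroup F] [NormedSpace ℝ F]

/-- Multiplication by a bump function. It lets results about globally defined maps be applied to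
locally defined ones. -/
theorem exists_contDiff_eventuallyEq {f : E → F} {U : Set E} (hU : IsOpen U) {p : E} (hp : p ∈ U)
    (hf : ContDiffOn ℝ ∞ f U) : ∃ g : E → F, ContDiff ℝ ∞ g ∧ g =ᶠ[𝓝 p] f := by
  obtain ⟨r, hr, hball⟩ := Metric.isOpen_iff.1 hU p hp
  let b : ContDiffBump p := ⟨r / 4, r / 2, by positivity, by linarith⟩
  refine ⟨fun x => b x • f x, contDiff_iff_contDiffAt.2 fun x => ?_, ?_⟩
  · by_cases hx : x ∈ U
    · exact b.contDiffAt.smul (hf.contDiffAt (hU.mem_nhds hx))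
    · have hx' : x ∈ (Metric.closedBall p (r / 2))ᶜ := fun h =>
        hx (hball ((Metric.closedBall_subset_ball (by linarith)) h))
      have : (fun x => b x • f x) =ᶠ[𝓝 x] fun _ => 0 := by
        filter_upwards [Metric.isClosed_closedBall.isOpen_compl.mem_nhds hx'] with y hy
        have hy' : b.rOut ≤ dist y p := by
          have : ¬ dist y p ≤ r / 2 := hy
          exact (not_le.1 this).le
        rw [b.zero_of_le_dist hy', zero_smul]
      exact contDiffAt_const.congr_of_eventuallyEq this
  · filter_upwards [b.eventuallyEq_one] with x hx
    rw [hx]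
    exact one_smul _ _

/-- The flow box theorem. -/
theorem exists_flowBox {Y : E → E} {U : Set E} (hU : IsOpen U) {p : E} (hp : p ∈ U)
    (hY : ContDiffOn ℝ ∞ Y U) (Λ : E ≃L[ℝ] E) (ℓ : E →L[ℝ] ℝ) {e : E} (hℓ : ℓ e = 1)
    (hΛ : Λ e = Y p) :
    ∃ Φ : OpenPartialHomeomorph E E, p ∈ Φ.source ∧ Φ p = p ∧ Φ.target ⊆ U ∧
      ContDiffOn ℝ ∞ Φ Φ.source ∧ ContDiffOn ℝ ∞ Φ.symm Φ.target ∧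
      HasFDerivAt Φ (Λ : E →L[ℝ] E) p ∧
      (∀ y ∈ Φ.source, fderiv ℝ Φ y e = Y (Φ y)) ∧
      ∀ y ∈ Φ.source, ℓ y = ℓ p → Φ y = p + Λ (y - p) := by
  have : CompleteSpace E := FiniteDimensional.complete ℝ E
  obtain ⟨Y', hY', hYY'⟩ := exists_contDiff_eventuallyEq hU hp hY
  obtain ⟨U', hU'sub, hU'o, hpU'⟩ := eventually_nhds_iff.1
    (Filter.Eventually.and (hU.eventually_mem hp) hYY')
  obtain ⟨φ, r, hr, hφsm, hφ0, hφ⟩ := exists_smooth_flow hY' p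
  -- A point is read as a time `ℓ (y - p)` and a starting point, the image under `Λ` of its
  -- projection to `ker ℓ` along `e`. The flow box follows the flow from that point for that time.
  let q : E → ℝ × E := fun y => (ℓ (y - p), p + Λ ((y - p) - ℓ (y - p) • e))
  have hq : ContDiff ℝ ∞ q := by
    refine ContDiff.prodMk (by fun_prop) ?_
    exact contDiff_const.add (Λ.contDiff.fun_comp (by fun_prop))
  have hqp : q p = (0, p) := by simp [q]
  let D : Set (ℝ × E) := Metric.ball 0 r ×ˢ Metric.ball p r
  have hD : IsOpen D := Metric.isOpen_ball.prod Metric.isOpen_ball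
  have hDp : ((0 : ℝ), p) ∈ D := ⟨Metric.mem_ball_self hr, Metric.mem_ball_self hr⟩
  let Φ0 : E → E := fun y => φ (q y)
  have hΦ0sm : ContDiffOn ℝ ∞ Φ0 (q ⁻¹' D) := hφsm.comp hq.contDiffOn fun _ h => h
  have hqD : IsOpen (q ⁻¹' D) := hD.preimage hq.continuous
  have hΦ0p : Φ0 p = p := by
    change φ (q p) = p
    rw [hqp]
    exact hφ0 p (Metric.mem_ball_self hr)
  let V : Set E := (q ⁻¹' D) ∩ Φ0 ⁻¹' U'
  have hV : IsOpen V := hΦ0sm.continuousOn.isOpen_inter_preimage hqD hU'o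
  have hpD : p ∈ q ⁻¹' D := by rw [mem_preimage, hqp]; exact hDp
  have hpV : p ∈ V := ⟨hpD, by rw [mem_preimage, hΦ0p]; exact hpU'⟩
  have hderiv : HasFDerivAt Φ0 (Λ : E →L[ℝ] E) p := by
    have h1 : HasFDerivAt φ (fderiv ℝ φ (0, p)) (0, p) :=
      ((hφsm.differentiableOn (by simp)).differentiableAt (hD.mem_nhds hDp)).hasFDerivAt
    have h2 : fderiv ℝ φ (0, p) (1, 0) = Y p := by
      have h3 : HasDerivAt (fun τ : ℝ => ((τ, p) : ℝ × E)) (1, 0) 0 :=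
        (hasDerivAt_id _).prodMk (hasDerivAt_const _ _)
      have h4 := HasFDerivAt.comp_hasDerivAt (0 : ℝ) h1 h3
      have h5 := h4.unique (hφ 0 (Metric.mem_ball_self hr) p (Metric.mem_ball_self hr))
      rw [h5, hφ0 p (Metric.mem_ball_self hr)]
      exact hYY'.self_of_nhds
    have h6 : ∀ v : E, fderiv ℝ φ (0, p) (0, v) = v := by
      have h3 : HasFDerivAt (fun x : E => ((0, x) : ℝ × E)) (ContinuousLinearMap.inr ℝ ℝ E) p :=
        (hasFDerivAt_const _ _).prodMk (hasFDerivAt_id _)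
      have h4 := h1.comp p h3
      have h5 : (φ ∘ fun x : E => ((0, x) : ℝ × E)) =ᶠ[𝓝 p] id := by
        filter_upwards [Metric.ball_mem_nhds p hr] with x hx using hφ0 x hx
      have h6 := h4.unique ((hasFDerivAt_id p).congr_of_eventuallyEq h5)
      exact fun v => congrArg (fun A : E →L[ℝ] E => A v) h6
    have h7 : HasFDerivAt q (ℓ.prod ((Λ : E →L[ℝ] E).comp
        (ContinuousLinearMap.id ℝ E - ℓ.smulRight e))) p := by
      have h8 : HasFDerivAt (fun y : E => ℓ (y - p)) ℓ p :=
        (ℓ.hasFDerivAt.comp p ((hasFDerivAt_id (𝕜 := ℝ) p).sub_const p)).congr_fderiv ℓ.comp_id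
      refine h8.prodMk (HasFDerivAt.const_add p ?_)
      refine (Λ : E →L[ℝ] E).hasFDerivAt.comp p ?_
      exact ((hasFDerivAt_id (𝕜 := ℝ) p).sub_const p).sub (h8.smul_const e)
    rw [← hqp] at h1
    have h9 := h1.comp p h7
    refine h9.congr_fderiv ?_
    ext v
    rw [hqp]
    change fderiv ℝ φ (0, p) (ℓ v, Λ (v - ℓ v • e)) = Λ v
    have h10 : ((ℓ v, Λ (v - ℓ v • e)) : ℝ × E) = ℓ v • ((1 : ℝ), (0 : E)) + (0, Λ (v - ℓ v • e)) := by
      simp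
    rw [h10, map_add, map_smul, h2, h6, map_sub, map_smul, hΛ]
    abel
  obtain ⟨Φ, hpΦ, hΦV, hΦ, hsymm⟩ := exists_localDiffeo hV hpV
    (hΦ0sm.mono inter_subset_left) hderiv
  have hΦsm : ContDiffOn ℝ ∞ Φ Φ.source := by
    rw [hΦ]
    exact (hΦ0sm.mono inter_subset_left).mono hΦV
  refine ⟨Φ, hpΦ, by rw [hΦ, hΦ0p], ?_, hΦsm, hsymm, by rw [hΦ]; exact hderiv, ?_, ?_⟩
  · intro z hz
    have := (hΦV (Φ.map_target hz)).2
    rw [mem_preimage, ← hΦ, Φ.right_inv hz] at this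
    exact (hU'sub _ this).1
  · intro y hy
    have hy1 := hΦV hy
    have h1 : HasFDerivAt Φ (fderiv ℝ Φ y) y :=
      ((hΦsm.differentiableOn (by simp)).differentiableAt
        (Φ.open_source.mem_nhds hy)).hasFDerivAt
    have h2 : HasDerivAt (fun t : ℝ => y + t • e) e 0 := by
      simpa using ((hasDerivAt_id (0 : ℝ)).smul_const e).const_add y
    have h3 : HasDerivAt (fun t : ℝ => Φ (y + t • e)) (fderiv ℝ Φ y e) 0 := by
      refine HasFDerivAt.comp_hasDerivAt (0 : ℝ) (l := Φ) ?_ h2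
      rwa [zero_smul, add_zero]
    -- Moving in the direction `e` changes the time and leaves the starting point fixed.
    have h4 : (fun t : ℝ => Φ (y + t • e)) = fun t : ℝ => φ (ℓ (y - p) + t, (q y).2) := by
      ext t
      rw [hΦ]
      change φ (ℓ (y + t • e - p), p + Λ ((y + t • e - p) - ℓ (y + t • e - p) • e)) =
        φ (ℓ (y - p) + t, p + Λ ((y - p) - ℓ (y - p) • e))
      have h5 : ℓ (y + t • e - p) = ℓ (y - p) + t := by
        rw [add_sub_right_comm, map_add, map_smul, hℓ, smul_eq_mul, mul_one]
      have h6 : (y + t • e - p) - (ℓ (y - p) + t) • e = (y - p) - ℓ (y - p) • e := by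
        rw [add_smul]; abel
      rw [h5, h6]
    have h5 : HasDerivAt (fun t : ℝ => φ (ℓ (y - p) + t, (q y).2)) (Y' (φ (q y))) 0 := by
      have h6 := hφ (q y).1 hy1.1.1 (q y).2 hy1.1.2
      have h7 : (q y).1 = ℓ (y - p) + 0 := (add_zero _).symm
      rw [h7] at h6
      have h8 := HasDerivAt.scomp (0 : ℝ) h6 ((hasDerivAt_id (0 : ℝ)).const_add (ℓ (y - p)))
      rw [one_smul, ← h7] at h8
      exact h8
    rw [h4] at h3
    rw [h3.unique h5, hΦ]
    exact (hU'sub _ hy1.2).2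
  · intro y hy hy'
    have hy1 := (hΦV hy).1
    rw [hΦ]
    have h1 : ℓ (y - p) = 0 := by rw [map_sub, hy', sub_self]
    have h2 : q y = (0, p + Λ (y - p)) := by
      change (ℓ (y - p), p + Λ ((y - p) - ℓ (y - p) • e)) = _
      rw [h1, zero_smul, sub_zero]
    have h3 := hy1.2
    rw [h2] at h3
    change φ (q y) = _
    rw [h2]
    exact hφ0 _ h3

end Local

/-! ### Exterior calculus, transport along flow lines and Hamiltonian fields in a normed space -/

section Local

variable {E F : Type*} [NormedAddCommGroup E] [NormedSpace ℝ E]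
  [NormedAddCommGroup F] [NormedSpace ℝ F]

theorem two_le_infty : (2 : WithTop ℕ∞) ≤ ∞ := by
  exact WithTop.coe_le_coe.2 (le_top : (2 : ℕ∞) ≤ ⊤)

/-- The exterior derivative of a 1-form on a normed space. -/
def dform (α : E → E →L[ℝ] ℝ) (y u v : E) : ℝ := fderiv ℝ α y u v - fderiv ℝ α y v u

theorem dform_add_left (α : E → E →L[ℝ] ℝ) (y u u' v : E) :
    dform α y (u + u') v = dform α y u v + dform α y u' v := by
  simp only [dform, map_add, add_apply]; ring

theorem dform_smul_left (α : E → E →L[ℝ] ℝ) (y : E) (c : ℝ) (u v : E) :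
    dform α y (c • u) v = c * dform α y u v := by
  simp only [dform, map_smul, smul_apply, smul_eq_mul]; ring

theorem dform_self (α : E → E →L[ℝ] ℝ) (y u : E) : dform α y u u = 0 := sub_self _

theorem dform_congr {α β : E → E →L[ℝ] ℝ} {y : E} (h : α =ᶠ[𝓝 y] β) (u v : E) :
    dform α y u v = dform β y u v := by
  rw [dform, dform, h.fderiv_eq]

/-- The terms containing the second derivative of `τ` cancel by its symmetry. -/
theorem dform_pullback {α : F → F →L[ℝ] ℝ} {τ : E → F} {y : E} (hτ : ContDiffAt ℝ ∞ τ y)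
    (hα : DifferentiableAt ℝ α (τ y)) (u v : E) :
    dform (fun z => (α (τ z)).comp (fderiv ℝ τ z)) y u v =
      dform α (τ y) (fderiv ℝ τ y u) (fderiv ℝ τ y v) := by
  have h1 : HasFDerivAt τ (fderiv ℝ τ y) y := (hτ.differentiableAt (by simp)).hasFDerivAt
  have h2 : HasFDerivAt (fderiv ℝ τ) (fderiv ℝ (fderiv ℝ τ) y) y :=
    ((hτ.fderiv_right (m := ∞) (by simp)).differentiableAt (by simp)).hasFDerivAt
  have h3 := (hα.hasFDerivAt.comp y h1).clm_comp h2
  have hs : IsSymmSndFDerivAt ℝ τ y := hτ.isSymmSndFDerivAt (by simpa using two_le_infty)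
  have h4 := h3.fderiv
  simp only [Function.comp_apply] at h4
  rw [dform, h4, dform]
  simp [hs.eq u v]

theorem eq_zero_of_linear_ode {a a' : ℝ → E} {K : ℝ}
    (ha : ∀ t ∈ Icc (0 : ℝ) 1, HasDerivAt a (a' t) t) (h0 : a 0 = 0)
    (hK : ∀ t ∈ Icc (0 : ℝ) 1, ‖a' t‖ ≤ K * ‖a t‖) : a 1 = 0 :=
  eq_zero_of_abs_deriv_le_mul_abs_self_of_eq_zero_right
    (fun t ht => (ha t ht).continuousAt.continuousWithinAt)
    (fun t ht => (ha t (Ico_subset_Icc_self ht)).hasDerivWithinAt) h0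
    (fun t ht => hK t (Ico_subset_Icc_self ht)) 1 (right_mem_Icc.2 zero_le_one)

theorem hasDerivAt_comp_line {u : E → F} {B : Set E} (hB : IsOpen B) (hu : ContDiffOn ℝ ∞ u B)
    {y e : E} {t : ℝ} (ht : y + t • e ∈ B) :
    HasDerivAt (fun s : ℝ => u (y + s • e)) (fderiv ℝ u (y + t • e) e) t := by
  have h2 : HasDerivAt (fun s : ℝ => y + s • e) e t := by
    simpa using ((hasDerivAt_id t).smul_const e).const_add y
  exact HasFDerivAt.comp_hasDerivAt t (l := u)
    ((hu.differentiableOn (by simp)).differentiableAt (hB.mem_nhds ht)).hasFDerivAt h2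

theorem eq_of_fderiv_apply_eq_zero {u : E → F} {B : Set E} (hB : IsOpen B)
    (hu : ContDiffOn ℝ ∞ u B) {y e : E} (hseg : ∀ t ∈ Icc (0 : ℝ) 1, y + t • e ∈ B)
    (h : ∀ z ∈ B, fderiv ℝ u z e = 0) : u (y + e) = u y := by
  have h1 := constant_of_has_deriv_right_zero (f := fun s : ℝ => u (y + s • e)) (a := 0) (b := 1)
    (fun t ht => (hasDerivAt_comp_line hB hu (hseg t ht)).continuousAt.continuousWithinAt)
    (fun t ht => by
      have := hasDerivAt_comp_line hB hu (hseg t (Ico_subset_Icc_self ht))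
      rw [h _ (hseg t (Ico_subset_Icc_self ht))] at this
      exact this.hasDerivWithinAt) 1 (right_mem_Icc.2 zero_le_one)
  simpa using h1

/-- If a constant field `e` satisfies `α(e) = 0` and `i_e dα = dh` on `ker α`, then the vectors
annihilated by `α` and `dh` stay so along the flow lines of `e`. -/
theorem isotropic_transport {α : E → E →L[ℝ] ℝ} {h : E → ℝ} {B : Set E} (hB : IsOpen B)
    (hα : ContDiffOn ℝ ∞ α B) (hh : ContDiffOn ℝ ∞ h B) {e R : E} (hαe : ∀ z ∈ B, α z e = 0)
    (hham : ∀ z ∈ B, ∀ v, α z v = 0 → dform α z e v = fderiv ℝ h z v)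
    (hR : ∀ z ∈ B, α z R ≠ 0) {y v : E} (hseg : ∀ t ∈ Icc (0 : ℝ) 1, y + t • e ∈ B)
    (hv : α y v = 0) (hhv : fderiv ℝ h y v = 0) : α (y + e) v = 0 := by
  have hdα : ContDiffOn ℝ ∞ (fderiv ℝ α) B := hα.fderiv_of_isOpen hB (by simp)
  have hdh : ContDiffOn ℝ ∞ (fderiv ℝ h) B := hh.fderiv_of_isOpen hB (by simp)
  -- Differentiating `α(e) = 0`. Consequently `dα(e, w)` is simply the derivative of `α(w)` along
  -- `e`.
  have hswap : ∀ z ∈ B, ∀ w, fderiv ℝ α z w e = 0 := by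
    intro z hz w
    have h1 : HasFDerivAt (fun x => α x e) ((fderiv ℝ α z).flip e) z := by
      have := ((hα.differentiableOn (by simp)).differentiableAt (hB.mem_nhds hz)).hasFDerivAt
      exact (this.clm_apply (hasFDerivAt_const e z)).congr_fderiv (by ext; simp)
    have h2 : (fun x => α x e) =ᶠ[𝓝 z] fun _ => 0 := by
      filter_upwards [hB.mem_nhds hz] with x hx using hαe x hx
    have h3 := h1.unique ((hasFDerivAt_const (0 : ℝ) z).congr_of_eventuallyEq h2)
    exact congrArg (fun A : E →L[ℝ] ℝ => A w) h3
  have hdhe : ∀ z ∈ B, fderiv ℝ h z e = 0 := fun z hz => by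
    rw [← hham z hz e (hαe z hz), dform_self]
  -- Differentiating `dh(e) = 0` and using symmetry of the second derivative: `dh(v)` is constant
  -- along the lines in direction `e`.
  have hsymm : ∀ z ∈ B, fderiv ℝ (fderiv ℝ h) z e v = 0 := by
    intro z hz
    have hs : IsSymmSndFDerivAt ℝ h z :=
      (hh.contDiffAt (hB.mem_nhds hz)).isSymmSndFDerivAt (by simpa using two_le_infty)
    rw [hs.eq e v]
    have h1 : HasFDerivAt (fun x => fderiv ℝ h x e) ((fderiv ℝ (fderiv ℝ h) z).flip e) z := by
      have := ((hdh.differentiableOn (by simp)).differentiableAt (hB.mem_nhds hz)).hasFDerivAt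
      exact (this.clm_apply (hasFDerivAt_const e z)).congr_fderiv (by ext; simp)
    have h2 : (fun x => fderiv ℝ h x e) =ᶠ[𝓝 z] fun _ => 0 := by
      filter_upwards [hB.mem_nhds hz] with x hx using hdhe x hx
    have h3 := h1.unique ((hasFDerivAt_const (0 : ℝ) z).congr_of_eventuallyEq h2)
    exact congrArg (fun A : E →L[ℝ] ℝ => A v) h3
  have hdhv : ∀ t ∈ Icc (0 : ℝ) 1, fderiv ℝ h (y + t • e) v = 0 := by
    intro t ht
    have h1 := eq_of_fderiv_apply_eq_zero hB (hdh.clm_apply (contDiffOn_const (c := v)))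
      (y := y) (e := t • e) (fun s hs => by
        rw [smul_smul]
        exact hseg _ ⟨mul_nonneg hs.1 ht.1, mul_le_one₀ hs.2 ht.1 ht.2⟩) (fun z hz => by
        rw [map_smul, fderiv_clm_apply
          ((hdh.differentiableOn (by simp)).differentiableAt (hB.mem_nhds hz))
          (differentiableAt_const v)]
        simp [hsymm z hz])
    exact h1.trans hhv
  -- The factor in `L_e α = dh + lam · α`: the two forms `L_e α` and `dh` agree on `ker α`, and `R`
  -- measures their difference. On vectors with `dh(v) = 0` this is a homogeneous linear equation
  -- for `α(v)`.
  let lam : E → ℝ := fun z => (dform α z e R - fderiv ℝ h z R) / α z R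
  have hlam : ContinuousOn lam B := by
    refine ContinuousOn.div ?_ (hα.continuousOn.clm_apply continuousOn_const) hR
    refine ContinuousOn.sub (ContinuousOn.sub ?_ ?_) (hdh.continuousOn.clm_apply continuousOn_const)
    · exact (hdα.continuousOn.clm_apply continuousOn_const).clm_apply continuousOn_const
    · exact (hdα.continuousOn.clm_apply continuousOn_const).clm_apply continuousOn_const
  have hkey : ∀ z ∈ B, fderiv ℝ h z v = 0 → fderiv ℝ α z e v = lam z * α z v := by
    intro z hz hzv
    have h1 : α z (v - (α z v / α z R) • R) = 0 := by
      rw [map_sub, map_smul, smul_eq_mul, div_mul_cancel₀ _ (hR z hz), sub_self]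
    have h2 := hham z hz _ h1
    have h3 := hswap z hz (v - (α z v / α z R) • R)
    have h4 := hswap z hz R
    rw [dform, h3, sub_zero] at h2
    simp only [map_sub, map_smul, smul_eq_mul, hzv] at h2
    simp only [lam, dform, h4]
    have := hR z hz
    field_simp
    field_simp at h2
    linarith
  obtain ⟨K, hK⟩ := isCompact_Icc.exists_bound_of_continuousOn (f := fun t : ℝ => lam (y + t • e))
    (s := Icc 0 1) (hlam.comp (by fun_prop) hseg)
  have h5 := eq_zero_of_linear_ode (a := fun t : ℝ => α (y + t • e) v)
    (a' := fun t => fderiv ℝ α (y + t • e) e v) (K := K)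
    (fun t ht => by
      exact ((hasDerivAt_comp_line hB hα (hseg t ht)).clm_apply (hasDerivAt_const t v)).congr_deriv
        (by simp))
    (by simpa using hv) (fun t ht => by
      rw [hkey _ (hseg t ht) (hdhv t ht), norm_mul]
      exact mul_le_mul_of_nonneg_right (hK t ht) (norm_nonneg _))
  simpa using h5

/-- Integral curves of a vector field tangent to the kernel of a projection stay in it. -/
theorem integralCurve_stays {Y : E → E} {K : NNReal} {T : Set E} (hY : LipschitzOnWith K Y T)
    (π : E →L[ℝ] F) (ι : F →L[ℝ] E) (hι : ∀ w, π (ι w) = w)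
    (htan : ∀ z ∈ T, π z = 0 → π (Y z) = 0) {c : ℝ → E} {s : ℝ}
    (hc : ∀ t ∈ Icc (0 : ℝ) 1, HasDerivAt c (s • Y (c t)) t)
    (hcT : ∀ t ∈ Icc (0 : ℝ) 1, c t ∈ T ∧ c t - ι (π (c t)) ∈ T) (h0 : π (c 0) = 0) :
    π (c 1) = 0 := by
  refine eq_zero_of_linear_ode (a := fun t => π (c t)) (a' := fun t => π (s • Y (c t)))
    (K := |s| * (‖π‖ * (K * ‖ι‖)))
    (fun t ht => HasFDerivAt.comp_hasDerivAt t π.hasFDerivAt (hc t ht)) h0 ?_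
  intro t ht
  obtain ⟨h1, h2⟩ := hcT t ht
  -- `Y` is tangent to `ker π` at the projection of `c t`, so the Lipschitz bound between `c t` and
  -- its projection controls the derivative of `π (c t)` by `‖π (c t)‖`, and Grönwall's inequality
  -- applies.
  have h3 : π (Y (c t - ι (π (c t)))) = 0 := htan _ h2 (by rw [map_sub, hι, sub_self])
  have h4 := hY.norm_sub_le h1 h2
  rw [sub_sub_cancel] at h4
  have h5 : π (Y (c t)) = π (Y (c t) - Y (c t - ι (π (c t)))) := by rw [map_sub, h3, sub_zero]
  rw [map_smul, norm_smul, Real.norm_eq_abs, h5, mul_assoc]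
  refine mul_le_mul_of_nonneg_left ?_ (abs_nonneg s)
  calc ‖π (Y (c t) - Y (c t - ι (π (c t))))‖
      ≤ ‖π‖ * ‖Y (c t) - Y (c t - ι (π (c t)))‖ := π.le_opNorm _
    _ ≤ ‖π‖ * (K * (‖ι‖ * ‖π (c t)‖)) := by
        refine mul_le_mul_of_nonneg_left (h4.trans ?_) (norm_nonneg _)
        exact mul_le_mul_of_nonneg_left (ι.le_opNorm _) K.2
    _ = ‖π‖ * (K * ‖ι‖) * ‖π (c t)‖ := by ring

/-- The pullback of `α` to `S` vanishes near `y`, hence so does its exterior derivative: `α(v)` is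
constantly zero along lines in `S`. -/
theorem dform_eq_zero_of_isotropic {α : E → E →L[ℝ] ℝ} {y : E} (hα : DifferentiableAt ℝ α y)
    {S : Submodule ℝ E} (hyS : y ∈ S) (h : ∀ᶠ z in 𝓝 y, z ∈ S → ∀ v ∈ S, α z v = 0) {u v : E}
    (hu : u ∈ S) (hv : v ∈ S) : dform α y u v = 0 := by
  have key : ∀ u ∈ S, ∀ v ∈ S, fderiv ℝ α y u v = 0 := by
    intro u hu v hv
    have h2 : HasDerivAt (fun s : ℝ => y + s • u) u 0 := by
      simpa using ((hasDerivAt_id (0 : ℝ)).smul_const u).const_add y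
    have h3 : HasDerivAt (fun s : ℝ => α (y + s • u) v) (fderiv ℝ α y u v) 0 := by
      have h1 : HasFDerivAt α (fderiv ℝ α y) (y + (0 : ℝ) • u) := by
        rw [zero_smul, add_zero]; exact hα.hasFDerivAt
      have h6 : HasDerivAt (fun s : ℝ => α (y + s • u)) (fderiv ℝ α y u) 0 :=
        HasFDerivAt.comp_hasDerivAt (0 : ℝ) (l := α) h1 h2
      exact (h6.clm_apply (hasDerivAt_const (0 : ℝ) v)).congr_deriv (by simp)
    have h4 : Tendsto (fun s : ℝ => y + s • u) (𝓝 0) (𝓝 y) := by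
      have := h2.continuousAt.tendsto
      rwa [zero_smul, add_zero] at this
    have h5 : (fun s : ℝ => α (y + s • u) v) =ᶠ[𝓝 0] fun _ => 0 := by
      filter_upwards [h4.eventually h] with s hs
      exact hs (S.add_mem hyS (S.smul_mem s hu)) v hv
    exact h3.unique ((hasDerivAt_const (0 : ℝ) (0 : ℝ)).congr_of_eventuallyEq h5)
  rw [dform, key u hu v hv, key v hv u hu, sub_self]

/-- The operator `u ↦ i_u dα + α(u) α`, invertible for contact forms. -/
def contactOperator (α : E → E →L[ℝ] ℝ) (y : E) : E →L[ℝ] E →L[ℝ] ℝ :=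
  fderiv ℝ α y - (fderiv ℝ α y).flip + (α y).smulRight (α y)

theorem contactOperator_apply (α : E → E →L[ℝ] ℝ) (y u v : E) :
    contactOperator α y u v = dform α y u v + α y u * α y v := by
  simp [contactOperator, dform]

theorem contDiffOn_contactOperator {α : E → E →L[ℝ] ℝ} {U : Set E} (hU : IsOpen U)
    (hα : ContDiffOn ℝ ∞ α U) : ContDiffOn ℝ ∞ (contactOperator α) U := by
  have hdα : ContDiffOn ℝ ∞ (fderiv ℝ α) U := hα.fderiv_of_isOpen hU (by simp)
  let Fl : (E →L[ℝ] E →L[ℝ] ℝ) →L[ℝ] E →L[ℝ] E →L[ℝ] ℝ :=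
    (ContinuousLinearMap.flipₗᵢ ℝ E E ℝ).toContinuousLinearEquiv
  have h0 : ContDiff ℝ ∞ Fl := by fun_prop
  have h1 : ContDiffOn ℝ ∞ (fun y => (fderiv ℝ α y).flip) U := h0.comp_contDiffOn hdα
  exact (hdα.sub h1).add (hα.smulRight hα)

/-- Pairing a kernel vector `u` with itself gives `α(u)² = 0`, and then `u` is `dα`-orthogonal to
`ker α`. -/
theorem contactOperator_injective {α : E → E →L[ℝ] ℝ} {y : E}
    (hnd : ∀ u, α y u = 0 → (∀ v, α y v = 0 → dform α y u v = 0) → u = 0) :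
    Function.Injective (contactOperator α y) := by
  rw [injective_iff_map_eq_zero]
  intro u hu
  have hu' : ∀ v, dform α y u v + α y u * α y v = 0 := fun v => by
    rw [← contactOperator_apply, hu]; rfl
  have h1 : α y u = 0 := by
    have := hu' u
    rw [dform_self, zero_add] at this
    exact mul_self_eq_zero.1 this
  exact hnd u h1 fun v hv => by
    have := hu' v
    rwa [h1, zero_mul, add_zero] at this

variable [FiniteDimensional ℝ E]

theorem exists_equiv_of_injective (A : E →L[ℝ] E →L[ℝ] ℝ) (hA : Function.Injective A) :
    ∃ L : E ≃L[ℝ] (E →L[ℝ] ℝ), (L : E →L[ℝ] E →L[ℝ] ℝ) = A := by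
  have hfr : Module.finrank ℝ E = Module.finrank ℝ (E →L[ℝ] ℝ) := by
    rw [← (LinearMap.toContinuousLinearMap (𝕜 := ℝ) (E := E) (F' := ℝ)).finrank_eq]
    exact Subspace.dual_finrank_eq.symm
  let L0 := LinearMap.linearEquivOfInjective (A : E →ₗ[ℝ] E →L[ℝ] ℝ) hA hfr
  let L : E ≃L[ℝ] (E →L[ℝ] ℝ) := L0.toContinuousLinearEquiv
  exact ⟨L, ContinuousLinearMap.ext fun u => rfl⟩

/-- The Hamiltonian vector field of a smooth function in a contact domain of a normed space. -/
theorem exists_hamiltonian_field {α : E → E →L[ℝ] ℝ} {U : Set E} (hU : IsOpen U)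
    (hα : ContDiffOn ℝ ∞ α U) (h0 : ∀ y ∈ U, α y ≠ 0)
    (hnd : ∀ y ∈ U, ∀ u, α y u = 0 → (∀ v, α y v = 0 → dform α y u v = 0) → u = 0)
    {h : E → ℝ} (hh : ContDiffOn ℝ ∞ h U) :
    ∃ Y : E → E, ContDiffOn ℝ ∞ Y U ∧ ∀ y ∈ U, α y (Y y) = 0 ∧
      ∀ v, α y v = 0 → dform α y (Y y) v = fderiv ℝ h y v := by
  have : CompleteSpace E := FiniteDimensional.complete ℝ E
  let A : E → E →L[ℝ] E →L[ℝ] ℝ := contactOperator α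
  have hAap : ∀ y u v, A y u v = dform α y u v + α y u * α y v := contactOperator_apply α
  have hA : ContDiffOn ℝ ∞ A U := contDiffOn_contactOperator hU hα
  have hdh : ContDiffOn ℝ ∞ (fderiv ℝ h) U := hh.fderiv_of_isOpen hU (by simp)
  have hinj : ∀ y ∈ U, Function.Injective (A y) := fun y hy => contactOperator_injective (hnd y hy)
  have hequiv : ∀ y ∈ U, ∃ L : E ≃L[ℝ] (E →L[ℝ] ℝ), (L : E →L[ℝ] E →L[ℝ] ℝ) = A y :=
    fun y hy => exists_equiv_of_injective (A y) (hinj y hy)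
  let Ai : E → (E →L[ℝ] ℝ) →L[ℝ] E := fun y => (A y).inverse
  have hAi : ContDiffOn ℝ ∞ Ai U := by
    intro y hy
    obtain ⟨L, hL⟩ := hequiv y hy
    have h1 : ContDiffAt ℝ ∞ ContinuousLinearMap.inverse (A y) := by
      rw [← hL]; exact contDiffAt_map_inverse L
    exact (h1.comp y (hA.contDiffAt (hU.mem_nhds hy))).contDiffWithinAt
  have hAAi : ∀ y ∈ U, ∀ β, A y (Ai y β) = β := by
    intro y hy β
    obtain ⟨L, hL⟩ := hequiv y hy
    simp only [Ai, ← hL, ContinuousLinearMap.inverse_equiv]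
    exact L.apply_symm_apply β
  -- `Z` is the Reeb field: `α(Z) = 1` and `i_Z dα = 0`. The solution `u` of `A u = dh` is corrected
  -- by a multiple of `Z`, which brings it into `ker α` without changing `dα(u, ·)`.
  let Z : E → E := fun y => Ai y (α y)
  let u : E → E := fun y => Ai y (fderiv ℝ h y)
  have hZsm : ContDiffOn ℝ ∞ Z U := hAi.clm_apply hα
  have husm : ContDiffOn ℝ ∞ u U := hAi.clm_apply hdh
  have hYsm : ContDiffOn ℝ ∞ (fun y => u y - α y (u y) • Z y) U :=
    husm.sub ((hα.clm_apply husm).smul hZsm)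
  refine ⟨fun y => u y - α y (u y) • Z y, hYsm, ?_⟩
  intro y hy
  have hZ : ∀ v, dform α y (Z y) v + α y (Z y) * α y v = α y v := fun v => by
    rw [← hAap, hAAi y hy]
  have hu : ∀ v, dform α y (u y) v + α y (u y) * α y v = fderiv ℝ h y v := fun v => by
    rw [← hAap, hAAi y hy]
  have hZ1 : α y (Z y) = 1 := by
    have h1 := hZ (Z y)
    rw [dform_self, zero_add] at h1
    by_contra hne
    have h2 : α y (Z y) = 0 := by
      by_contra h3
      exact hne (mul_right_cancel₀ h3 (by rw [h1, one_mul]))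
    have h3 : Z y = 0 := hnd y hy _ h2 fun v hv => by
      have := hZ v
      rwa [h2, zero_mul, add_zero, hv] at this
    refine h0 y hy ?_
    ext v
    have := hAAi y hy (α y)
    rw [← this]
    change A y (Z y) v = 0
    rw [h3, map_zero]; rfl
  have hZ2 : ∀ v, dform α y (Z y) v = 0 := fun v => by
    have := hZ v
    rw [hZ1, one_mul] at this
    linarith
  refine ⟨by simp only [map_sub, map_smul, hZ1, smul_eq_mul, mul_one, sub_self], fun v hv => ?_⟩
  have h1 : u y - α y (u y) • Z y = u y + (-α y (u y)) • Z y := by rw [neg_smul, sub_eq_add_neg]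
  have h2 := hu v
  rw [hv, mul_zero, add_zero] at h2
  simp only [h1, dform_add_left, dform_smul_left, hZ2, mul_zero, add_zero, h2]

end Local

/-! ### Functional relations from constant rank -/

section ConstantRank

variable {E F : Type*} [NormedAddCommGroup E] [NormedSpace ℝ E] [FiniteDimensional ℝ E]
  [NormedAddCommGroup F] [NormedSpace ℝ F] [FiniteDimensional ℝ F]

/-- If `P ∘ T` maps onto a space of dimension at least the rank of `T`, then `P ∘ T` has the same
kernel as `T`. -/
theorem apply_eq_zero_of_rank_le {E F R : Type*} [AddCommGroup E] [Module ℝ E]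
    [FiniteDimensional ℝ E] [AddCommGroup F] [Module ℝ F] [AddCommGroup R] [Module ℝ R]
    (T : E →ₗ[ℝ] F) (P : F →ₗ[ℝ] R)
    (hrank : Module.finrank ℝ (LinearMap.range T) ≤ Module.finrank ℝ R)
    (hsurj : Function.Surjective (P ∘ₗ T)) {v : E} (hv : P (T v) = 0) : T v = 0 := by
  have h1 := LinearMap.finrank_range_add_finrank_ker T
  have h2 := LinearMap.finrank_range_add_finrank_ker (P ∘ₗ T)
  rw [LinearMap.range_eq_top.2 hsurj, finrank_top] at h2
  have h3 : LinearMap.ker T = LinearMap.ker (P ∘ₗ T) :=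
    Submodule.eq_of_le_of_finrank_le (LinearMap.ker_le_ker_comp T P) (by omega)
  have h4 : v ∈ LinearMap.ker (P ∘ₗ T) := hv
  rw [← h3] at h4
  exact h4

/-- A map of constant rank satisfies near each point a smooth equation with any prescribed
differential annihilating the image of the tangent space. -/
theorem exists_equation_of_constant_rank {G : E → F} {U : Set E} (hU : IsOpen U) {q : E}
    (hq : q ∈ U) (hG : ContDiffOn ℝ ∞ G U) {r : ℕ}
    (hr : ∀ y ∈ U, Module.finrank ℝ (LinearMap.range (fderiv ℝ G y : E →ₗ[ℝ] F)) = r)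
    (c : F →L[ℝ] ℝ) (hc : ∀ v, c (fderiv ℝ G q v) = 0) :
    ∃ ψ : F → ℝ, ContDiff ℝ ∞ ψ ∧ (∀ᶠ y in 𝓝 q, ψ (G y) = 0) ∧ fderiv ℝ ψ (G q) = c := by
  have : CompleteSpace E := FiniteDimensional.complete ℝ E
  have : CompleteSpace F := FiniteDimensional.complete ℝ F
  have hGd : ∀ y ∈ U, HasFDerivAt G (fderiv ℝ G y) y := fun y hy =>
    ((hG.differentiableOn (by simp)).differentiableAt (hU.mem_nhds hy)).hasFDerivAt
  let R : Submodule ℝ F := LinearMap.range (fderiv ℝ G q : E →ₗ[ℝ] F)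
  let N : Submodule ℝ E := LinearMap.ker (fderiv ℝ G q : E →ₗ[ℝ] F)
  obtain ⟨P, hP⟩ := Submodule.ClosedComplemented.of_finiteDimensional R
  obtain ⟨Q, hQ⟩ := Submodule.ClosedComplemented.of_finiteDimensional N
  have hPG : ∀ v, (P (fderiv ℝ G q v) : F) = fderiv ℝ G q v := fun v => by
    have := hP ⟨fderiv ℝ G q v, v, rfl⟩
    exact congrArg Subtype.val this
  let T : E →L[ℝ] R × N := (P.comp (fderiv ℝ G q)).prod Q
  have hTinj : Function.Injective T := by
    rw [injective_iff_map_eq_zero]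
    intro v hv
    have h1 : P (fderiv ℝ G q v) = 0 := congrArg Prod.fst hv
    have h2 : Q v = 0 := congrArg Prod.snd hv
    have h3 : fderiv ℝ G q v = 0 := by rw [← hPG, h1]; rfl
    have h4 := hQ ⟨v, h3⟩
    change Q v = _ at h4
    rw [h2] at h4
    exact (congrArg Subtype.val h4).symm
  have hfr : Module.finrank ℝ E = Module.finrank ℝ (R × N) := by
    rw [Module.finrank_prod]
    exact (LinearMap.finrank_range_add_finrank_ker (fderiv ℝ G q : E →ₗ[ℝ] F)).symm
  let L0 := LinearMap.linearEquivOfInjective (T : E →ₗ[ℝ] R × N) hTinj hfr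
  let L : E ≃L[ℝ] R × N := L0.toContinuousLinearEquiv
  have hL : (L : E →L[ℝ] R × N) = T := ContinuousLinearMap.ext fun _ => rfl
  -- Coordinates adapted to `G` at `q`: the component of `G` in the range `R` of `dG_q`, completed
  -- by a projection to its kernel `N`.
  let Θ : E → R × N := fun y => (P (G y), Q y)
  have hΘ : ContDiffOn ℝ ∞ Θ U :=
    (P.contDiff.fun_comp_contDiffOn hG).prodMk Q.contDiff.contDiffOn
  have hΘd : ∀ y ∈ U, HasFDerivAt Θ ((P.comp (fderiv ℝ G y)).prod Q) y := fun y hy =>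
    (P.hasFDerivAt.comp y (hGd y hy)).prodMk Q.hasFDerivAt
  obtain ⟨e, hqe, heU, he, hesymm⟩ := exists_localDiffeo hU hq hΘ (f' := L) (by
    rw [hL]; exact hΘd q hq)
  obtain ⟨δ, hδ, hball⟩ := Metric.isOpen_iff.1 e.open_target (e q) (e.map_source hqe)
  -- The function `c ∘ G` in the adapted coordinates. Constant rank will make it independent of the
  -- kernel variables, so that `c ∘ G` is a function of `P ∘ G` alone.
  let H : R × N → ℝ := fun z => c (G (e.symm z))
  have hHsm : ContDiffOn ℝ ∞ H e.target :=
    c.contDiff.fun_comp_contDiffOn (hG.comp hesymm fun z hz => heU (e.map_target hz))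
  have hHd : ∀ z ∈ e.target, ∀ w, fderiv ℝ H z w =
      c (fderiv ℝ G (e.symm z) (fderiv ℝ e.symm z w)) := by
    intro z hz w
    have h1 : HasFDerivAt e.symm (fderiv ℝ e.symm z) z :=
      ((hesymm.differentiableOn (by simp)).differentiableAt
        (e.open_target.mem_nhds hz)).hasFDerivAt
    have h2 := c.hasFDerivAt.comp z ((hGd _ (heU (e.map_target hz))).comp z h1)
    have h3 : HasFDerivAt H _ z := h2
    rw [h3.fderiv]; rfl
  have hsplit : ∀ z ∈ e.target, ∀ w : R × N,
      P (fderiv ℝ G (e.symm z) (fderiv ℝ e.symm z w)) = w.1 := by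
    intro z hz w
    have h1 : HasFDerivAt e.symm (fderiv ℝ e.symm z) z :=
      ((hesymm.differentiableOn (by simp)).differentiableAt
        (e.open_target.mem_nhds hz)).hasFDerivAt
    have h2 := (hΘd _ (heU (e.map_target hz))).comp z h1
    have h3 : (Θ ∘ e.symm) =ᶠ[𝓝 z] id := by
      filter_upwards [e.open_target.mem_nhds hz] with x hx
      have := e.right_inv hx
      rwa [he] at this
    have h4 := h2.unique ((hasFDerivAt_id z).congr_of_eventuallyEq h3)
    exact congrArg (fun A : R × N →L[ℝ] R × N => (A w).1) h4
  have hrq : Module.finrank ℝ R = r := hr q hq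
  -- In these coordinates `P ∘ G` is the first projection, so `P ∘ dG` kills the kernel directions.
  -- As `dG` has no more rank than `R` has dimension, `dG` kills them too.
  have hker : ∀ z ∈ e.target, ∀ w : N, fderiv ℝ H z (0, w) = 0 := by
    intro z hz w
    have h1 := apply_eq_zero_of_rank_le (fderiv ℝ G (e.symm z) : E →ₗ[ℝ] F) (P : F →ₗ[ℝ] R)
      (by rw [hr _ (heU (e.map_target hz)), hrq])
      (fun a => ⟨fderiv ℝ e.symm z (a, 0), hsplit z hz (a, 0)⟩)
      (v := fderiv ℝ e.symm z (0, w)) (hsplit z hz (0, w))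
    rw [hHd z hz]
    exact (congrArg c h1).trans (map_zero c)
  have hH0 : fderiv ℝ H (e q) = 0 := by
    refine ContinuousLinearMap.ext fun w => ?_
    have h1 := hHd _ (e.map_source hqe) w
    rw [e.left_inv hqe, hc] at h1
    exact h1
  have heq : e q = (P (G q), Q q) := by rw [he]
  have hB : Metric.ball (P (G q)) δ ×ˢ Metric.ball (Q q) δ ⊆ e.target := by
    rwa [ball_prod_same, ← heq]
  have hconst : ∀ a ∈ Metric.ball (P (G q)) δ, ∀ b ∈ Metric.ball (Q q) δ,
      H (a, b) = H (a, Q q) := by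
    intro a ha b hb
    have h1 : ∀ t ∈ Icc (0 : ℝ) 1, ((a, Q q) : R × N) + t • (0, b - Q q) ∈ e.target := by
      intro t ht
      apply hB
      have : ((a, Q q) : R × N) + t • (0, b - Q q) = (a, Q q + t • (b - Q q)) := by
        ext <;> simp
      rw [this]
      refine ⟨ha, ?_⟩
      rw [mem_ball_iff_norm, add_sub_cancel_left, norm_smul, Real.norm_of_nonneg ht.1]
      exact (mul_le_of_le_one_left (norm_nonneg _) ht.2).trans_lt (mem_ball_iff_norm.1 hb)
    have h2 := eq_of_fderiv_apply_eq_zero e.open_target hHsm h1 (fun z hz => hker z hz _)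
    have h3 : ((a, Q q) : R × N) + (0, b - Q q) = (a, b) := by ext <;> simp
    rwa [h3] at h2
  have husm : ContDiffOn ℝ ∞ (fun a : R => H (a, Q q)) (Metric.ball (P (G q)) δ) :=
    hHsm.comp (contDiff_id.prodMk contDiff_const).contDiffOn fun a ha =>
      hB ⟨ha, Metric.mem_ball_self hδ⟩
  obtain ⟨u, hu, huH⟩ := exists_contDiff_eventuallyEq Metric.isOpen_ball
    (Metric.mem_ball_self hδ) husm
  -- Near `q` one has `c ∘ G = u ∘ P ∘ G`. The differential of `u` vanishes at `P (G q)` because `c`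
  -- annihilates the range of `dG_q`, so `ψ` has differential `c`.
  refine ⟨fun z => c z - u (P z), c.contDiff.sub (hu.fun_comp P.contDiff), ?_, ?_⟩
  · have hPc : Tendsto (fun y => P (G y)) (𝓝 q) (𝓝 (P (G q))) :=
      (P.continuous.continuousAt.comp (hGd q hq).continuousAt).tendsto
    filter_upwards [e.open_source.mem_nhds hqe, hPc.eventually huH,
      hPc.eventually (Metric.ball_mem_nhds _ hδ),
      Q.continuous.continuousAt.eventually (Metric.ball_mem_nhds _ hδ)] with y h1 h2 h3 h4
    have h5 : H (e y) = c (G y) := by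
      change c (G (e.symm (e y))) = _
      rw [e.left_inv h1]
    have h6 : e y = (P (G y), Q y) := by rw [he]
    rw [h2, ← hconst _ h3 _ h4, ← h6, h5, sub_self]
  · have h1 : HasFDerivAt (fun a : R => H (a, Q q)) (0 : R →L[ℝ] ℝ) (P (G q)) := by
      have h2 : HasFDerivAt H (0 : R × N →L[ℝ] ℝ) (P (G q), Q q) := by
        have := ((hHsm.differentiableOn (by simp)).differentiableAt
          (e.open_target.mem_nhds (e.map_source hqe))).hasFDerivAt
        rwa [hH0, heq] at this
      have h3 : HasFDerivAt (fun a : R => (a, Q q)) (ContinuousLinearMap.inl ℝ R N) (P (G q)) :=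
        (hasFDerivAt_id _).prodMk (hasFDerivAt_const _ _)
      exact (h2.comp (f := fun a : R => (a, Q q)) (P (G q)) h3).congr_fderiv (ContinuousLinearMap.zero_comp _)
    have h2 : HasFDerivAt (fun z => u (P z)) ((0 : R →L[ℝ] ℝ).comp P) (G q) :=
      (h1.congr_of_eventuallyEq huH).comp (G q) P.hasFDerivAt
    have h3 : HasFDerivAt (fun z => c z - u (P z)) (c - (0 : R →L[ℝ] ℝ).comp P) (G q) :=
      c.hasFDerivAt.sub h2
    rw [ContinuousLinearMap.zero_comp, sub_zero] at h3
    exact h3.fderiv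

end ConstantRank

/-! ### Charts of the maximal atlas -/

section Charts

/-- The Euclidean space `ℝ^d`. -/
abbrev Euc (d : ℕ) : Type := EuclideanSpace ℝ (Fin d)

/-- The coordinate subspace `x_k = ⋯ = x_{d-1} = 0`. -/
def sliceSpace (d k : ℕ) : Submodule ℝ (Euc d) where
  carrier := {v | ∀ i : Fin d, k ≤ (i : ℕ) → v.ofLp i = 0}
  add_mem' := fun {a b} ha hb i hi => by
    change a.ofLp i + b.ofLp i = 0
    rw [ha i hi, hb i hi, add_zero]
  zero_mem' := fun _ _ => rfl
  smul_mem' := fun c a ha i hi => by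
    change c * a.ofLp i = 0
    rw [ha i hi, mul_zero]

variable {d : ℕ} {M : Type*} [TopologicalSpace M]
  [ChartedSpace (EuclideanSpace ℝ (Fin d)) M]

/-- The derivative of a chart. -/
def chartDeriv (e : OpenPartialHomeomorph M (Euc d)) (x : M) :
    TangentSpace (𝓡 d) x →L[ℝ] Euc d :=
  mfderiv (𝓡 d) (𝓡 d) e x

/-- The tangent vector at `x` with given coordinates in a chart. -/
def chartVec (e : OpenPartialHomeomorph M (Euc d)) (x : M) :
    Euc d →L[ℝ] TangentSpace (𝓡 d) x :=
  mfderiv (𝓡 d) (𝓡 d) e.symm (e x)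

variable {e : OpenPartialHomeomorph M (Euc d)}

theorem mdifferentiable_chart (he : e ∈ IsManifold.maximalAtlas (𝓡 d) ∞ M) :
    e.MDifferentiable (𝓡 d) (𝓡 d) :=
  ⟨(contMDiffOn_of_mem_maximalAtlas he).mdifferentiableOn (by simp),
    (contMDiffOn_symm_of_mem_maximalAtlas he).mdifferentiableOn (by simp)⟩

theorem chartDeriv_chartVec (he : e ∈ IsManifold.maximalAtlas (𝓡 d) ∞ M) {x : M}
    (hx : x ∈ e.source) (w : Euc d) : chartDeriv e x (chartVec e x w) = w := by
  have h := (mdifferentiable_chart he).comp_symm_deriv (e.map_source hx)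
  rw [e.left_inv hx] at h
  exact congrArg (fun A : Euc d →L[ℝ] Euc d => A w) h

theorem chartVec_chartDeriv (he : e ∈ IsManifold.maximalAtlas (𝓡 d) ∞ M) {x : M}
    (hx : x ∈ e.source) (v : TangentSpace (𝓡 d) x) : chartVec e x (chartDeriv e x v) = v := by
  have h := (mdifferentiable_chart he).symm_comp_deriv hx
  exact congrArg (fun A : TangentSpace (𝓡 d) x →L[ℝ] TangentSpace (𝓡 d) x => A v) h

/-- The derivative of a chart as a linear equivalence. -/
def chartEquiv (he : e ∈ IsManifold.maximalAtlas (𝓡 d) ∞ M) {x : M} (hx : x ∈ e.source) :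
    TangentSpace (𝓡 d) x ≃ₗ[ℝ] Euc d where
  toLinearMap := (chartDeriv e x).toLinearMap
  invFun := chartVec e x
  left_inv := chartVec_chartDeriv he hx
  right_inv := chartDeriv_chartVec he hx

theorem hasMFDerivAt_chart (he : e ∈ IsManifold.maximalAtlas (𝓡 d) ∞ M) {x : M}
    (hx : x ∈ e.source) : HasMFDerivAt (𝓡 d) (𝓡 d) e x (chartDeriv e x) :=
  ((mdifferentiable_chart he).mdifferentiableAt hx).hasMFDerivAt

theorem hasMFDerivAt_chart_symm (he : e ∈ IsManifold.maximalAtlas (𝓡 d) ∞ M) {y : Euc d}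
    (hy : y ∈ e.target) :
    HasMFDerivAt (𝓡 d) (𝓡 d) e.symm y (mfderiv (𝓡 d) (𝓡 d) e.symm y) :=
  ((mdifferentiable_chart he).mdifferentiableAt_symm hy).hasMFDerivAt

theorem hasDerivAt_chart_comp (he : e ∈ IsManifold.maximalAtlas (𝓡 d) ∞ M) {γ : ℝ → M} {t : ℝ}
    {γ' : ℝ →L[ℝ] TangentSpace (𝓡 d) (γ t)} (hγ : HasMFDerivAt 𝓘(ℝ, ℝ) (𝓡 d) γ t γ')
    (ht : γ t ∈ e.source) : HasDerivAt (e ∘ γ) (chartDeriv e (γ t) (γ' 1)) t := by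
  have h := (hasMFDerivAt_chart he ht).comp t hγ
  have h' : HasFDerivAt (e ∘ γ) ((chartDeriv e (γ t)).comp γ' : ℝ →L[ℝ] Euc d) t :=
    hasMFDerivAt_iff_hasFDerivAt.1 h
  exact h'.hasDerivAt

theorem hasMFDerivAt_chart_symm_comp (he : e ∈ IsManifold.maximalAtlas (𝓡 d) ∞ M) {c : ℝ → Euc d}
    {c' : Euc d} {t : ℝ} (hc : HasDerivAt c c' t) (ht : c t ∈ e.target) :
    HasMFDerivAt 𝓘(ℝ, ℝ) (𝓡 d) (e.symm ∘ c) t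
      (ContinuousLinearMap.smulRight (1 : ℝ →L[ℝ] ℝ) (chartVec e (e.symm (c t)) c')) := by
  have h1 : HasMFDerivAt 𝓘(ℝ, ℝ) (𝓡 d) c t (ContinuousLinearMap.smulRight (1 : ℝ →L[ℝ] ℝ) c') :=
    hasMFDerivAt_iff_hasFDerivAt.2 hc.hasFDerivAt
  have h := (hasMFDerivAt_chart_symm he ht).comp t h1
  have h2 : chartVec e (e.symm (c t)) = mfderiv (𝓡 d) (𝓡 d) e.symm (c t) := by
    rw [chartVec, e.right_inv ht]
  rw [h2]
  refine h.congr_mfderiv ?_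
  refine ContinuousLinearMap.ext fun (s : ℝ) => ?_
  exact map_smul (mfderiv (𝓡 d) (𝓡 d) e.symm (c t) : Euc d →L[ℝ] _) s c'

theorem mvfderiv_eq_fderiv_chart (he : e ∈ IsManifold.maximalAtlas (𝓡 d) ∞ M) {f : M → ℝ} {x : M}
    (hf : MDifferentiableAt (𝓡 d) 𝓘(ℝ, ℝ) f x) (hx : x ∈ e.source)
    (v : TangentSpace (𝓡 d) x) :
    mvfderiv (𝓡 d) f x v = fderiv ℝ (f ∘ e.symm) (e x) (chartDeriv e x v) := by
  have h1 := hasMFDerivAt_chart_symm he (e.map_source hx)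
  have hf' : HasMFDerivAt (𝓡 d) 𝓘(ℝ, ℝ) f (e.symm (e x)) (mfderiv (𝓡 d) 𝓘(ℝ, ℝ) f x) := by
    rw [e.left_inv hx]; exact hf.hasMFDerivAt
  have h2 := hf'.comp (e x) h1
  have h4 : HasFDerivAt (f ∘ e.symm)
      ((mvfderiv (𝓡 d) f x).comp (chartVec e x)) (e x) :=
    hasMFDerivAt_iff_hasFDerivAt.1 h2
  rw [h4.fderiv]
  have h3 := chartVec_chartDeriv he hx v
  conv_lhs => rw [← h3]
  rfl

theorem contDiffOn_comp_chart_symm (he : e ∈ IsManifold.maximalAtlas (𝓡 d) ∞ M) {f : M → ℝ}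
    (hf : ContMDiff (𝓡 d) 𝓘(ℝ, ℝ) ∞ f) : ContDiffOn ℝ ∞ (f ∘ e.symm) e.target :=
  contMDiffOn_iff_contDiffOn.1 (hf.comp_contMDiffOn (contMDiffOn_symm_of_mem_maximalAtlas he))

/-- The expression of a 1-form in a chart. -/
def formInChart (θ : ∀ m : M, TangentSpace (𝓡 d) m →L[ℝ] ℝ)
    (e : OpenPartialHomeomorph M (Euc d)) (y : Euc d) : Euc d →L[ℝ] ℝ :=
  (θ (e.symm y)).comp (mfderiv (𝓡 d) (𝓡 d) e.symm y)

theorem formInChart_apply (θ : ∀ m : M, TangentSpace (𝓡 d) m →L[ℝ] ℝ)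
    (he : e ∈ IsManifold.maximalAtlas (𝓡 d) ∞ M) {x : M} (hx : x ∈ e.source)
    (v : TangentSpace (𝓡 d) x) : formInChart θ e (e x) (chartDeriv e x v) = θ x v := by
  have h1 := chartVec_chartDeriv he hx v
  conv_rhs => rw [← h1]
  change θ (e.symm (e x)) _ = _
  rw [chartVec]
  -- The points `e.symm (e x)` and `x` are only propositionally equal. Quantifying over the base
  -- point lets the equality be substituted in the dependent type.
  have : ∀ z (hz : z = x) (w : Euc d), θ z (w : TangentSpace (𝓡 d) z) = θ x w := by
    rintro z rfl w; rfl
  exact this _ (e.left_inv hx) _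

variable [IsManifold (𝓡 d) ∞ M]

theorem contMDiffOn_chartVec_section (he : e ∈ IsManifold.maximalAtlas (𝓡 d) ∞ M)
    {Y : Euc d → Euc d} {U : Set (Euc d)} (hUe : U ⊆ e.target)
    (hY : ContDiffOn ℝ ∞ Y U) :
    ContMDiffOn (𝓡 d) (𝓡 d).tangent ∞
      (fun y => (⟨e.symm y, mfderiv (𝓡 d) (𝓡 d) e.symm y (Y y)⟩ : TangentBundle (𝓡 d) M)) U := by
  have h1 : ContMDiffOn 𝓘(ℝ, Euc d) 𝓘(ℝ, Euc d).tangent ∞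
      (fun y => (⟨y, Y y⟩ : TangentBundle 𝓘(ℝ, Euc d) (Euc d))) U :=
    contMDiffOn_vectorSpace_iff_contDiffOn.2 hY
  have h2 := (contMDiffOn_symm_of_mem_maximalAtlas he).contMDiffOn_tangentMapWithin
    (m := ∞) (by simp) e.open_target.uniqueMDiffOn
  refine (h2.comp h1 fun y hy => hUe hy).congr fun y hy => ?_
  simp only [Function.comp_apply, tangentMapWithin]
  rw [mfderivWithin_of_isOpen e.open_target (hUe hy)]

theorem contMDiff_section_of_charts {X : ∀ x : M, TangentSpace (𝓡 d) x}
    (h : ∀ x : M, ∃ e ∈ IsManifold.maximalAtlas (𝓡 d) ∞ M, x ∈ e.source ∧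
      ∃ Y : Euc d → Euc d, ContDiffOn ℝ ∞ Y e.target ∧
        ∀ z ∈ e.source, chartDeriv e z (X z) = Y (e z)) :
    ContMDiff (𝓡 d) (𝓡 d).tangent ∞ (fun x => (⟨x, X x⟩ : TangentBundle (𝓡 d) M)) := by
  intro x
  obtain ⟨e, he, hx, Y, hY, hYX⟩ := h x
  have h1 := (contMDiffOn_chartVec_section he Subset.rfl hY).comp
    (contMDiffOn_of_mem_maximalAtlas he) fun z hz => e.map_source hz
  refine ContMDiffOn.contMDiffAt (h1.congr fun z hz => ?_) (e.open_source.mem_nhds hx)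
  have h2 := chartVec_chartDeriv he hz (X z)
  rw [hYX z hz] at h2
  refine Bundle.TotalSpace.ext (e.left_inv hz).symm ?_
  rw [← h2]
  rfl

theorem contDiffOn_formInChart {θ : ∀ m : M, TangentSpace (𝓡 d) m →L[ℝ] ℝ}
    (hθ : ContMDiff (𝓡 d) ((𝓡 d).prod 𝓘(ℝ, EuclideanSpace ℝ (Fin d) →L[ℝ] ℝ)) ∞
      (fun m => (⟨m, θ m⟩ : Bundle.TotalSpace (EuclideanSpace ℝ (Fin d) →L[ℝ] ℝ)
        (fun m : M => TangentSpace (𝓡 d) m →L[ℝ] ℝ))))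
    (he : e ∈ IsManifold.maximalAtlas (𝓡 d) ∞ M) :
    ContDiffOn ℝ ∞ (formInChart θ e) e.target := by
  rw [contDiffOn_clm_apply]
  intro w
  have h1 := contMDiffOn_chartVec_section he Subset.rfl
    (contDiffOn_const (c := w))
  have h2 := hθ.comp_contMDiffOn (contMDiffOn_symm_of_mem_maximalAtlas he)
  have h3 := ContMDiffOn.clm_bundle_apply (b := e.symm) (F₁ := Euc d) (F₂ := ℝ)
    (E₁ := fun m : M => TangentSpace (𝓡 d) m) (E₂ := Bundle.Trivial M ℝ)
    (ϕ := fun y => θ (e.symm y)) (v := fun y => mfderiv (𝓡 d) (𝓡 d) e.symm y w) h2 h1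
  have h4 : ContMDiffOn (𝓡 d) 𝓘(ℝ, ℝ) ∞ (fun y => formInChart θ e y w) e.target := by
    intro y hy
    exact (Bundle.contMDiffWithinAt_totalSpace.1 (h3 y hy)).2
  exact contMDiffOn_iff_contDiffOn.1 h4

theorem hasFDerivAt_transition {c : OpenPartialHomeomorph M (Euc d)}
    (hc : c ∈ IsManifold.maximalAtlas (𝓡 d) ∞ M) (he : e ∈ IsManifold.maximalAtlas (𝓡 d) ∞ M)
    {z : Euc d} (hz : z ∈ c.target) (hz' : c.symm z ∈ e.source) :
    HasFDerivAt (e ∘ c.symm)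
      ((chartDeriv e (c.symm z)).comp (mfderiv (𝓡 d) (𝓡 d) c.symm z) : Euc d →L[ℝ] Euc d) z :=
  hasMFDerivAt_iff_hasFDerivAt.1
    ((hasMFDerivAt_chart he hz').comp z (hasMFDerivAt_chart_symm hc hz))

theorem fderiv_transition_apply {c : OpenPartialHomeomorph M (Euc d)}
    (hc : c ∈ IsManifold.maximalAtlas (𝓡 d) ∞ M) (he : e ∈ IsManifold.maximalAtlas (𝓡 d) ∞ M)
    {x : M} (hx : x ∈ c.source) (hx' : x ∈ e.source) (u : TangentSpace (𝓡 d) x) :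
    fderiv ℝ (e ∘ c.symm) (c x) (chartDeriv c x u) = chartDeriv e x u := by
  rw [(hasFDerivAt_transition hc he (c.map_source hx) (by rwa [c.left_inv hx])).fderiv]
  have h1 := chartVec_chartDeriv hc hx u
  conv_rhs => rw [← h1]
  have : ∀ z (hz : z = x) (w : Euc d), chartDeriv e z (w : TangentSpace (𝓡 d) z) =
      chartDeriv e x w := by
    rintro z rfl w; rfl
  exact this _ (c.left_inv hx) _

/-- `extDerivForm` is defined through the preferred chart at `x`. Naturality of `d` under the
transition map allows any chart of the maximal atlas, in particular slice charts and straightened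
ones. -/
theorem extDerivForm_eq_dform {θ : ∀ m : M, TangentSpace (𝓡 d) m →L[ℝ] ℝ}
    (hθ : ContMDiff (𝓡 d) ((𝓡 d).prod 𝓘(ℝ, EuclideanSpace ℝ (Fin d) →L[ℝ] ℝ)) ∞
      (fun m => (⟨m, θ m⟩ : Bundle.TotalSpace (EuclideanSpace ℝ (Fin d) →L[ℝ] ℝ)
        (fun m : M => TangentSpace (𝓡 d) m →L[ℝ] ℝ))))
    (he : e ∈ IsManifold.maximalAtlas (𝓡 d) ∞ M) {x : M} (hx : x ∈ e.source)
    (u v : TangentSpace (𝓡 d) x) :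
    extDerivForm θ x u v =
      dform (formInChart θ e) (e x) (chartDeriv e x u) (chartDeriv e x v) := by
  let c := chartAt (Euc d) x
  have hc : c ∈ IsManifold.maximalAtlas (𝓡 d) ∞ M := IsManifold.chart_mem_maximalAtlas x
  have hxc : x ∈ c.source := mem_chart_source _ x
  have h1 : extDerivForm θ x u v =
      dform (formInChart θ c) (c x) (chartDeriv c x u) (chartDeriv c x v) := rfl
  have hopen : IsOpen (c.target ∩ c.symm ⁻¹' e.source) :=
    c.symm.isOpen_inter_preimage e.open_source
  have hmem : c x ∈ c.target ∩ c.symm ⁻¹' e.source :=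
    ⟨c.map_source hxc, by rw [mem_preimage, c.left_inv hxc]; exact hx⟩
  have h2 : formInChart θ c =ᶠ[𝓝 (c x)] fun z =>
      (formInChart θ e ((e ∘ c.symm) z)).comp (fderiv ℝ (e ∘ c.symm) z) := by
    filter_upwards [hopen.mem_nhds hmem] with z hz
    refine ContinuousLinearMap.ext fun w => ?_
    rw [(hasFDerivAt_transition hc he hz.1 hz.2).fderiv]
    exact (formInChart_apply θ he hz.2 _).symm
  have hτ : ContDiffAt ℝ ∞ (e ∘ c.symm) (c x) := by
    have h3 : ContMDiffOn (𝓡 d) (𝓡 d) ∞ (e ∘ c.symm) (c.target ∩ c.symm ⁻¹' e.source) :=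
      (contMDiffOn_of_mem_maximalAtlas he).comp
        ((contMDiffOn_symm_of_mem_maximalAtlas hc).mono inter_subset_left) fun z hz => hz.2
    exact (contMDiffOn_iff_contDiffOn.1 h3).contDiffAt (hopen.mem_nhds hmem)
  have hex : (e ∘ c.symm) (c x) = e x := congrArg e (c.left_inv hxc)
  have hα : DifferentiableAt ℝ (formInChart θ e) ((e ∘ c.symm) (c x)) := by
    rw [hex]
    exact ((contDiffOn_formInChart hθ he).differentiableOn (by simp)).differentiableAt
      (e.open_target.mem_nhds (e.map_source hx))
  rw [h1, dform_congr h2, dform_pullback hτ hα, fderiv_transition_apply hc he hxc hx,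
    fderiv_transition_apply hc he hxc hx, hex]

/-- Change of coordinates by a local diffeomorphism. -/
theorem trans_mem_maximalAtlas (he : e ∈ IsManifold.maximalAtlas (𝓡 d) ∞ M)
    {Φ : OpenPartialHomeomorph (Euc d) (Euc d)} (hΦ : ContDiffOn ℝ ∞ Φ Φ.source)
    (hΦ' : ContDiffOn ℝ ∞ Φ.symm Φ.target) :
    e.trans Φ ∈ IsManifold.maximalAtlas (𝓡 d) ∞ M := by
  refine OpenPartialHomeomorph.mem_maximalAtlas_of_contMDiffOn _ ?_ ?_
  · exact (contMDiffOn_iff_contDiffOn.2 hΦ).comp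
      ((contMDiffOn_of_mem_maximalAtlas he).mono fun z hz => hz.1) fun z hz => hz.2
  · exact (contMDiffOn_symm_of_mem_maximalAtlas he).comp
      ((contMDiffOn_iff_contDiffOn.2 hΦ').mono fun z hz => hz.1) fun z hz => hz.2

theorem chartDeriv_trans (he : e ∈ IsManifold.maximalAtlas (𝓡 d) ∞ M)
    {Φ : OpenPartialHomeomorph (Euc d) (Euc d)} (hΦ : ContDiffOn ℝ ∞ Φ Φ.source) {x : M}
    (hx : x ∈ (e.trans Φ).source) (v : TangentSpace (𝓡 d) x) :
    chartDeriv (e.trans Φ) x v = fderiv ℝ Φ (e x) (chartDeriv e x v) := by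
  have h1 : HasMFDerivAt (𝓡 d) (𝓡 d) Φ (e x) (fderiv ℝ Φ (e x)) :=
    hasMFDerivAt_iff_hasFDerivAt.2 ((hΦ.differentiableOn (by simp)).differentiableAt
      (Φ.open_source.mem_nhds hx.2)).hasFDerivAt
  have h2 := h1.comp x (hasMFDerivAt_chart he hx.1)
  have h3 : chartDeriv (e.trans Φ) x = (fderiv ℝ Φ (e x)).comp (chartDeriv e x) := h2.mfderiv
  rw [h3]; rfl

/-- `e` is a chart flattening `S` to a coordinate subspace of dimension `k`. -/
structure IsSliceChart (k : ℕ) (S : Set M) (e : OpenPartialHomeomorph M (Euc d)) : Prop where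
  mem_atlas : e ∈ IsManifold.maximalAtlas (𝓡 d) ∞ M
  mem_iff : ∀ x ∈ e.source, x ∈ S ↔ e x ∈ sliceSpace d k

theorem IsSubmanifold.exists_sliceChart {k : ℕ} {S : Set M} (hS : IsSubmanifold d k S) {m : M}
    (hm : m ∈ S) : ∃ e : OpenPartialHomeomorph M (Euc d), IsSliceChart k S e ∧ m ∈ e.source := by
  obtain ⟨e, he, hme, h⟩ := hS m hm
  exact ⟨e, ⟨he, h⟩, hme⟩

/-- Along a curve in `S` the normal coordinates vanish identically, and so do their derivatives.
Conversely a vector of the slice is the velocity of a straight line of the chart, which stays in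
`S`. -/
theorem mem_tangentPlane_iff {k : ℕ} {S : Set M} (he : IsSliceChart k S e) {x : M}
    (hx : x ∈ e.source) (hxS : x ∈ S) (v : TangentSpace (𝓡 d) x) :
    v ∈ tangentPlane d S x ↔ chartDeriv e x v ∈ sliceSpace d k := by
  constructor
  · intro hv
    have hle : tangentPlane d S x ≤ (sliceSpace d k).comap (chartDeriv e x).toLinearMap := by
      refine Submodule.span_le.2 ?_
      rintro _ ⟨γ, ε, hε, hγ0, hγ, hγS, rfl⟩
      subst hγ0
      have h0 : (0 : ℝ) ∈ Ioo (-ε) ε := ⟨by linarith, hε⟩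
      have h1 : ContMDiffAt 𝓘(ℝ, ℝ) (𝓡 d) ∞ γ 0 := hγ.contMDiffAt (isOpen_Ioo.mem_nhds h0)
      have h2 := (h1.mdifferentiableAt (by simp)).hasMFDerivAt
      have h3 := hasDerivAt_chart_comp he.mem_atlas h2 hx
      change chartDeriv e (γ 0) _ ∈ sliceSpace d k
      intro i hi
      have h4 : HasDerivAt (fun t => (e (γ t)).ofLp i)
          ((chartDeriv e (γ 0) (mfderiv 𝓘(ℝ, ℝ) (𝓡 d) γ 0 (1 : ℝ))).ofLp i) 0 :=
        HasFDerivAt.comp_hasDerivAt (0 : ℝ) (l := fun v : Euc d => v.ofLp i)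
          (EuclideanSpace.proj (𝕜 := ℝ) i).hasFDerivAt h3
      have h5 : (fun t => (e (γ t)).ofLp i) =ᶠ[𝓝 0] fun _ => 0 := by
        filter_upwards [isOpen_Ioo.mem_nhds h0,
          h1.continuousAt.preimage_mem_nhds (e.open_source.mem_nhds hx)] with t ht ht'
        exact (he.mem_iff _ ht').1 (hγS t ht) i hi
      exact h4.unique ((hasDerivAt_const (0 : ℝ) (0 : ℝ)).congr_of_eventuallyEq h5)
    exact hle hv
  · intro hv
    set w := chartDeriv e x v with hw
    have hcd : HasDerivAt (fun t : ℝ => e x + t • w) w 0 := by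
      simpa using ((hasDerivAt_id (0 : ℝ)).smul_const w).const_add (e x)
    have hcs : ContDiff ℝ ∞ (fun t : ℝ => e x + t • w) :=
      contDiff_const.add (contDiff_id.smul contDiff_const)
    have hopen : IsOpen ((fun t : ℝ => e x + t • w) ⁻¹' e.target) :=
      e.open_target.preimage hcs.continuous
    have hc0 : e x + (0 : ℝ) • w = e x := by rw [zero_smul, add_zero]
    obtain ⟨ε, hε, hball⟩ := Metric.isOpen_iff.1 hopen 0
      (by rw [mem_preimage, hc0]; exact e.map_source hx)
    rw [Real.ball_eq_Ioo, zero_sub, zero_add] at hball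
    refine Submodule.subset_span ⟨e.symm ∘ fun t : ℝ => e x + t • w, ε, hε, ?_, ?_, ?_, ?_⟩
    · simp only [Function.comp_apply, hc0, e.left_inv hx]
    · exact (contMDiffOn_symm_of_mem_maximalAtlas he.mem_atlas).comp
        (contMDiffOn_iff_contDiffOn.2 hcs.contDiffOn) hball
    · intro t ht
      have h1 := hball ht
      refine (he.mem_iff _ (e.map_target h1)).2 ?_
      rw [e.right_inv h1]
      exact add_mem ((he.mem_iff _ hx).1 hxS) (Submodule.smul_mem _ t hv)
    · have h1 := hasMFDerivAt_chart_symm_comp he.mem_atlas hcd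
        (by rw [hc0]; exact e.map_source hx)
      rw [h1.mfderiv]
      change v = (1 : ℝ) • chartVec e (e.symm (e x + (0 : ℝ) • w)) w
      have h2 : chartVec e (e.symm (e x + (0 : ℝ) • w)) w = chartVec e x w := by
        rw [hc0, e.left_inv hx]
      rw [h2, hw, chartVec_chartDeriv he.mem_atlas hx]
      exact (one_smul ℝ v).symm

end Charts

/-! ### Symplectic linear algebra -/

section SymplecticLinearAlgebra

variable {V : Type*} [AddCommGroup V] [Module ℝ V] {C : Submodule ℝ V}
  [FiniteDimensional ℝ V] {B : V →ₗ[ℝ] V →ₗ[ℝ] ℝ} {n : ℕ}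

theorem swap_eq_neg_of_alt (halt : ∀ v, B v v = 0) (u v : V) : B u v = -B v u := by
  have h := halt (u + v)
  simp only [map_add, LinearMap.add_apply, halt, zero_add, add_zero] at h
  linarith

theorem finrank_comap_subtype {U : Submodule ℝ V} (hU : U ≤ C) :
    Module.finrank ℝ (U.comap C.subtype) = Module.finrank ℝ U :=
  (Submodule.submoduleOfEquivOfLe hU).finrank_eq

theorem mem_orthogonal_comap (halt : ∀ v, B v v = 0) {U : Submodule ℝ V} {y : V}
    (hy : y ∈ C) (h : ∀ u ∈ U, B y u = 0) :
    (⟨y, hy⟩ : C) ∈ LinearMap.BilinForm.orthogonal (B.domRestrict₁₂ C C) (U.comap C.subtype) := by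
  rw [LinearMap.BilinForm.mem_orthogonal_iff]
  intro w hw
  change B w y = 0
  rw [swap_eq_neg_of_alt halt]
  exact neg_eq_zero.2 (h _ hw)

/-- A Lagrangian plane equals its own orthogonal, since it is contained in it and the dimensions
agree. -/
theorem mem_of_forall_orthogonal (hB : (B.domRestrict₁₂ C C).Nondegenerate)
    (halt : ∀ v, B v v = 0) (hC : Module.finrank ℝ C = 2 * n) {L : Submodule ℝ V} (hL : L ≤ C)
    (hLn : Module.finrank ℝ L = n) (hiso : ∀ v ∈ L, ∀ w ∈ L, B v w = 0) {y : V} (hy : y ∈ C)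
    (h : ∀ l ∈ L, B y l = 0) : y ∈ L := by
  have h1 := LinearMap.BilinForm.finrank_orthogonal hB (L.comap C.subtype)
  rw [finrank_comap_subtype hL, hC, hLn] at h1
  have h2 : L.comap C.subtype =
      LinearMap.BilinForm.orthogonal (B.domRestrict₁₂ C C) (L.comap C.subtype) := by
    refine Submodule.eq_of_le_of_finrank_eq (fun w hw => ?_) ?_
    · exact mem_orthogonal_comap halt w.2 (hiso w hw)
    · rw [h1, finrank_comap_subtype hL, hLn]; omega
  have h3 := mem_orthogonal_comap halt hy h
  rw [← h2] at h3
  exact h3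

/-- This is `D^⊥⊥ = D`, phrased inside the ambient space. -/
theorem mem_of_forall_orthogonal_orthogonal (hB : (B.domRestrict₁₂ C C).Nondegenerate)
    (halt : ∀ v, B v v = 0) {D : Submodule ℝ V} (hD : D ≤ C) {y : V} (hy : y ∈ C)
    (h : ∀ w ∈ C, (∀ u ∈ D, B w u = 0) → B y w = 0) : y ∈ D := by
  have hrefl : LinearMap.BilinForm.IsRefl (B.domRestrict₁₂ C C) := fun u v huv => by
    change B v u = 0
    rw [swap_eq_neg_of_alt halt]
    exact neg_eq_zero.2 huv
  have h1 := LinearMap.BilinForm.orthogonal_orthogonal hB hrefl (D.comap C.subtype)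
  have h2 : (⟨y, hy⟩ : C) ∈ D.comap C.subtype := by
    rw [← h1, LinearMap.BilinForm.mem_orthogonal_iff]
    intro w hw
    rw [LinearMap.BilinForm.mem_orthogonal_iff] at hw
    change B w y = 0
    rw [swap_eq_neg_of_alt halt, neg_eq_zero]
    refine h w w.2 fun u hu => ?_
    rw [swap_eq_neg_of_alt halt]
    exact neg_eq_zero.2 (hw ⟨u, hD hu⟩ hu)
  exact h2

/-- If `L` and `D` met trivially they would span `C` by dimension, and `y`, orthogonal to both,
would vanish by nondegeneracy. -/
theorem inf_ne_bot_of_orthogonal (hB : (B.domRestrict₁₂ C C).Nondegenerate)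
    (hC : Module.finrank ℝ C = 2 * n) {L D : Submodule ℝ V} (hL : L ≤ C)
    (hD : D ≤ C) (hLn : Module.finrank ℝ L = n) (hDn : Module.finrank ℝ D = n)
    (hiso : ∀ v ∈ L, ∀ w ∈ L, B v w = 0) {y : V} (hy : y ∈ L) (hy0 : y ≠ 0)
    (h : ∀ u ∈ D, B y u = 0) : L ⊓ D ≠ ⊥ := by
  intro hbot
  have h1 := Submodule.finrank_sup_add_finrank_inf_eq L D
  rw [hbot, finrank_bot, add_zero, hLn, hDn] at h1
  have h2 : L ⊔ D = C := Submodule.eq_of_le_of_finrank_eq (sup_le hL hD) (by rw [h1, hC]; ring)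
  have h3 : (⟨y, hL hy⟩ : C) = 0 := by
    refine hB.1 _ fun w => ?_
    have hw : (w : V) ∈ L ⊔ D := by rw [h2]; exact w.2
    obtain ⟨a, ha, b, hb, hab⟩ := Submodule.mem_sup.1 hw
    change B y w = 0
    rw [← hab, map_add, hiso y hy a ha, h b hb, add_zero]
  exact hy0 (congrArg Subtype.val h3)

/-- The orthogonal of `T` has dimension `2n - dim T > dim T`, so it is not contained in `T`. -/
theorem exists_orthogonal_not_mem (hB : (B.domRestrict₁₂ C C).Nondegenerate)
    (halt : ∀ v, B v v = 0) (hC : Module.finrank ℝ C = 2 * n) {T : Submodule ℝ V} (hT : T ≤ C)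
    (hTn : Module.finrank ℝ T < n) : ∃ Z ∈ C, Z ∉ T ∧ ∀ t ∈ T, B Z t = 0 := by
  by_contra! hcon
  have h1 := LinearMap.BilinForm.finrank_orthogonal hB (T.comap C.subtype)
  rw [finrank_comap_subtype hT, hC] at h1
  have h2 : LinearMap.BilinForm.orthogonal (B.domRestrict₁₂ C C) (T.comap C.subtype) ≤
      T.comap C.subtype := by
    intro w hw
    by_contra hwT
    obtain ⟨t, ht, hne⟩ := hcon w w.2 hwT
    rw [LinearMap.BilinForm.mem_orthogonal_iff] at hw
    refine hne ?_
    rw [swap_eq_neg_of_alt halt, neg_eq_zero]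
    exact hw ⟨t, hT ht⟩ ht
  have h3 := Submodule.finrank_mono h2
  rw [h1, finrank_comap_subtype hT] at h3
  omega

end SymplecticLinearAlgebra

/-! ### Coordinate subspaces -/

/-- The coordinates of a vector of a coordinate subspace. -/
def sliceSpaceEquiv (d k : ℕ) : sliceSpace d k ≃ₗ[ℝ] ({i : Fin d // (i : ℕ) < k} → ℝ) where
  toFun v i := (v : Euc d).ofLp i
  map_add' _ _ := rfl
  map_smul' _ _ := rfl
  invFun w := ⟨WithLp.toLp 2 fun i => if h : (i : ℕ) < k then w ⟨i, h⟩ else 0, fun i hi => by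
    simp [not_lt.2 hi]⟩
  left_inv v := by
    ext i
    by_cases h : (i : ℕ) < k
    · simp [h]
    · simp [h, v.2 i (not_lt.1 h)]
  right_inv w := by
    ext i
    simp [i.2]

theorem finrank_sliceSpace {d k : ℕ} (hk : k ≤ d) : Module.finrank ℝ (sliceSpace d k) = k := by
  rw [(sliceSpaceEquiv d k).finrank_eq, Module.finrank_fintype_fun_eq_card, Fintype.card_subtype]
  have : (Finset.univ.filter fun i : Fin d => (i : ℕ) < k) =
      (Finset.univ : Finset (Fin k)).map (Fin.castLEEmb hk) := by
    ext i
    simp only [Finset.mem_filter, Finset.mem_univ, true_and, Finset.mem_map]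
    exact ⟨fun h => ⟨⟨i, h⟩, Fin.ext rfl⟩, fun ⟨j, hj⟩ => hj ▸ j.2⟩
  rw [this, Finset.card_map, Finset.card_fin]

theorem sliceSpace_mono {d k l : ℕ} (h : k ≤ l) : sliceSpace d k ≤ sliceSpace d l :=
  fun _ hv i hi => hv i (h.trans hi)

theorem fderiv_apply_eq_zero_of_const {E : Type*} [NormedAddCommGroup E] [NormedSpace ℝ E]
    {u : E → ℝ} {y : E} (hu : DifferentiableAt ℝ u y) {S : Submodule ℝ E} (hyS : y ∈ S) {c : ℝ}
    (h : ∀ᶠ z in 𝓝 y, z ∈ S → u z = c) {v : E} (hv : v ∈ S) : fderiv ℝ u y v = 0 := by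
  have h2 : HasDerivAt (fun s : ℝ => y + s • v) v 0 := by
    simpa using ((hasDerivAt_id (0 : ℝ)).smul_const v).const_add y
  have h3 : HasDerivAt (fun s : ℝ => u (y + s • v)) (fderiv ℝ u y v) 0 := by
    refine HasFDerivAt.comp_hasDerivAt (0 : ℝ) (l := u) ?_ h2
    rw [zero_smul, add_zero]; exact hu.hasFDerivAt
  have h4 : Tendsto (fun s : ℝ => y + s • v) (𝓝 0) (𝓝 y) := by
    have := h2.continuousAt.tendsto
    rwa [zero_smul, add_zero] at this
  have h5 : (fun s : ℝ => u (y + s • v)) =ᶠ[𝓝 0] fun _ => c := by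
    filter_upwards [h4.eventually h] with s hs
    exact hs (S.add_mem hyS (S.smul_mem s hv))
  exact h3.unique ((hasDerivAt_const (0 : ℝ) c).congr_of_eventuallyEq h5)

/-! ### Integral submanifolds, Hamiltonian fields of composite functions and intermediate integrals
-/

section Contact

variable {n : ℕ} {M : Type*} [TopologicalSpace M]
  [ChartedSpace (EuclideanSpace ℝ (Fin (2 * n + 1))) M] [IsManifold (𝓡 (2 * n + 1)) ∞ M]

theorem finrank_tangentPlane {d k : ℕ} (hk : k ≤ d) {M : Type*} [TopologicalSpace M]
    [ChartedSpace (EuclideanSpace ℝ (Fin d)) M] [IsManifold (𝓡 d) ∞ M] {S : Set M}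
    {e : OpenPartialHomeomorph M (Euc d)} (he : IsSliceChart k S e) {x : M}
    (hx : x ∈ e.source) (hxS : x ∈ S) : Module.finrank ℝ (tangentPlane d S x) = k := by
  have h1 : (sliceSpace d k).map (chartEquiv he.mem_atlas hx).symm.toLinearMap =
      tangentPlane d S x := by
    ext v
    rw [mem_tangentPlane_iff he hx hxS v, Submodule.mem_map_equiv]
    rfl
  rw [← h1, LinearEquiv.finrank_map_eq, finrank_sliceSpace hk]

namespace ContactForm

variable (θ : ContactForm n M)

theorem extDerivForm_self (m : M) (v : TangentSpace (𝓡 (2 * n + 1)) m) :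
    extDerivForm θ.form m v v = 0 := sub_self _

theorem finrank_plane (m : M) : Module.finrank ℝ (θ.plane m) = 2 * n := by
  have h1 := LinearMap.finrank_range_add_finrank_ker (θ.form m).toLinearMap
  have h2 : Module.finrank ℝ (TangentSpace (𝓡 (2 * n + 1)) m) = 2 * n + 1 :=
    finrank_euclideanSpace_fin (𝕜 := ℝ) (n := 2 * n + 1)
  have h3 : (θ.form m).toLinearMap ≠ 0 := fun h => θ.ne_zero m (ContinuousLinearMap.coe_injective h)
  have h4 : LinearMap.range (θ.form m).toLinearMap = ⊤ := LinearMap.range_eq_top.2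
    (LinearMap.surjective h3)
  rw [h4, finrank_top, Module.finrank_self, h2] at h1
  change Module.finrank ℝ (LinearMap.ker (θ.form m).toLinearMap) = 2 * n
  omega

theorem eq_hamiltonian {f : M → ℝ} {m : M} {y : TangentSpace (𝓡 (2 * n + 1)) m}
    (hy : y ∈ θ.plane m)
    (h : ∀ v ∈ θ.plane m, extDerivForm θ.form m y v = mvfderiv (𝓡 (2 * n + 1)) f m v) :
    y = θ.hamiltonian f m := by
  have h1 : (⟨y - θ.hamiltonian f m, sub_mem hy (θ.hamiltonian_mem f m)⟩ : θ.plane m) = 0 := by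
    refine (θ.nondegenerate m).1 _ fun w => ?_
    change extDerivForm θ.form m (y - θ.hamiltonian f m) w = 0
    rw [map_sub, LinearMap.sub_apply, h _ w.2, θ.omega_hamiltonian f m _ w.2, sub_self]
  exact sub_eq_zero.1 (congrArg Subtype.val h1)

/-- `θ` pulls back to zero on `S`, hence so does `dθ`. -/
theorem isotropic_tangentPlane {k : ℕ} {S : Set M} (hS : IsIntegralSubmanifold θ k S) {x : M}
    (hx : x ∈ S) : ∀ v ∈ tangentPlane (2 * n + 1) S x, ∀ w ∈ tangentPlane (2 * n + 1) S x,
      extDerivForm θ.form x v w = 0 := by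
  obtain ⟨e, he, hxe⟩ := hS.1.exists_sliceChart hx
  intro v hv w hw
  rw [mem_tangentPlane_iff he hxe hx] at hv hw
  rw [extDerivForm_eq_dform θ.smooth he.mem_atlas hxe]
  refine dform_eq_zero_of_isotropic (S := sliceSpace (2 * n + 1) k)
    (((contDiffOn_formInChart θ.smooth he.mem_atlas).differentiableOn (by simp)).differentiableAt
      (e.open_target.mem_nhds (e.map_source hxe))) ((he.mem_iff _ hxe).1 hx) ?_ hv hw
  filter_upwards [e.open_target.mem_nhds (e.map_source hxe)] with z hz hzS u hu
  have h1 := e.map_target hz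
  have h2 : e.symm z ∈ S := (he.mem_iff _ h1).2 (by rwa [e.right_inv hz])
  have h3 : chartVec e (e.symm z) u ∈ tangentPlane (2 * n + 1) S (e.symm z) :=
    (mem_tangentPlane_iff he h1 h2 _).2 (by rwa [chartDeriv_chartVec he.mem_atlas h1])
  have h4 : θ.form _ (chartVec e (e.symm z) u) = 0 := hS.2 _ h2 h3
  rwa [← formInChart_apply θ.form he.mem_atlas h1, chartDeriv_chartVec he.mem_atlas h1,
    e.right_inv hz] at h4

end ContactForm

theorem mvfderiv_eq_zero_of_const {d k : ℕ} {M : Type*} [TopologicalSpace M]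
    [ChartedSpace (EuclideanSpace ℝ (Fin d)) M] [IsManifold (𝓡 d) ∞ M] {S : Set M}
    {e : OpenPartialHomeomorph M (Euc d)} (he : IsSliceChart k S e) {x : M} (hxe : x ∈ e.source)
    (hx : x ∈ S) {f : M → ℝ} (hf : ContMDiff (𝓡 d) 𝓘(ℝ, ℝ) ∞ f) {c : ℝ}
    (hc : ∀ᶠ y in 𝓝 x, y ∈ S → f y = c) {v : TangentSpace (𝓡 d) x}
    (hv : v ∈ tangentPlane d S x) : mvfderiv (𝓡 d) f x v = 0 := by
  rw [mem_tangentPlane_iff he hxe hx] at hv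
  rw [mvfderiv_eq_fderiv_chart he.mem_atlas (hf.mdifferentiableAt (by simp)) hxe]
  refine fderiv_apply_eq_zero_of_const (S := sliceSpace d k) (c := c)
    (((contDiffOn_comp_chart_symm he.mem_atlas hf).differentiableOn (by simp)).differentiableAt
      (e.open_target.mem_nhds (e.map_source hxe))) ((he.mem_iff _ hxe).1 hx) ?_ hv
  have h1 : Tendsto e.symm (𝓝 (e x)) (𝓝 x) := e.tendsto_symm hxe
  filter_upwards [e.open_target.mem_nhds (e.map_source hxe), h1.eventually hc] with z hz hz' hzS
  exact hz' ((he.mem_iff _ (e.map_target hz)).2 (by rwa [e.right_inv hz]))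

/-- The components of the differential of a function on `ℝ^k`. -/
def partialAt {k : ℕ} (ψ : (Fin k → ℝ) → ℝ) (y : Fin k → ℝ) (i : Fin k) : ℝ :=
  fderiv ℝ ψ y (Pi.single i 1)

theorem mvfderiv_comp {k d : ℕ} {M : Type*} [TopologicalSpace M]
    [ChartedSpace (EuclideanSpace ℝ (Fin d)) M] [IsManifold (𝓡 d) ∞ M] {f : Fin k → M → ℝ}
    (hf : ∀ i, ContMDiff (𝓡 d) 𝓘(ℝ, ℝ) ∞ (f i))
    {ψ : (Fin k → ℝ) → ℝ} (hψ : ContDiff ℝ ∞ ψ) (x : M) (v : TangentSpace (𝓡 d) x) :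
    mvfderiv (𝓡 d) (fun y => ψ fun i => f i y) x v =
      ∑ i, partialAt ψ (fun i => f i x) i * mvfderiv (𝓡 d) (f i) x v := by
  have hc : chartAt (Euc d) x ∈ IsManifold.maximalAtlas (𝓡 d) ∞ M :=
    IsManifold.chart_mem_maximalAtlas x
  have hx : x ∈ (chartAt (Euc d) x).source := mem_chart_source _ x
  have h0 : (fun i => f i ((chartAt (Euc d) x).symm (chartAt (Euc d) x x))) = fun i => f i x := by
    rw [(chartAt (Euc d) x).left_inv hx]
  have h1 : HasFDerivAt (fun y i => f i ((chartAt (Euc d) x).symm y))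
      (ContinuousLinearMap.pi fun i => fderiv ℝ (f i ∘ (chartAt (Euc d) x).symm)
        (chartAt (Euc d) x x)) (chartAt (Euc d) x x) :=
    hasFDerivAt_pi.2 fun i =>
      (((contDiffOn_comp_chart_symm hc (hf i)).differentiableOn (by simp)).differentiableAt
        ((chartAt (Euc d) x).open_target.mem_nhds (mem_chart_target _ x))).hasFDerivAt
  have h2 : HasFDerivAt ((fun y => ψ fun i => f i y) ∘ (chartAt (Euc d) x).symm) _
      (chartAt (Euc d) x x) :=
    HasFDerivAt.comp (chartAt (Euc d) x x) (g := ψ) (hψ.differentiable (by simp) _).hasFDerivAt h1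
  have h3 : ContMDiff (𝓡 d) 𝓘(ℝ, ℝ) ∞ (fun y => ψ fun i => f i y) :=
    hψ.contMDiff.comp (contMDiff_pi_space.2 hf)
  have h4 : mvfderiv (𝓡 d) (fun y => ψ fun i => f i y) x v =
      fderiv ℝ ψ (fun i => f i x) (fun i => mvfderiv (𝓡 d) (f i) x v) := by
    rw [mvfderiv_eq_fderiv_chart hc (h3.mdifferentiableAt (by simp)) hx, h2.fderiv,
      ContinuousLinearMap.comp_apply, h0]
    refine congrArg _ (funext fun i => ?_)
    rw [mvfderiv_eq_fderiv_chart hc ((hf i).mdifferentiableAt (by simp)) hx]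
    rfl
  rw [h4]
  conv_lhs => rw [← Finset.univ_sum_single (fun i => mvfderiv (𝓡 d) (f i) x v)]
  rw [map_sum]
  refine Finset.sum_congr rfl fun i _ => ?_
  have h6 : (Pi.single i (mvfderiv (𝓡 d) (f i) x v) : Fin k → ℝ) =
      mvfderiv (𝓡 d) (f i) x v • Pi.single i (1 : ℝ) := by
    rw [← Pi.single_smul, smul_eq_mul, mul_one]
  rw [h6, map_smul, smul_eq_mul, mul_comm]
  rfl

theorem contMDiff_comp {k d : ℕ} {M : Type*} [TopologicalSpace M]
    [ChartedSpace (EuclideanSpace ℝ (Fin d)) M] {f : Fin k → M → ℝ}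
    (hf : ∀ i, ContMDiff (𝓡 d) 𝓘(ℝ, ℝ) ∞ (f i))
    {ψ : (Fin k → ℝ) → ℝ} (hψ : ContDiff ℝ ∞ ψ) :
    ContMDiff (𝓡 d) 𝓘(ℝ, ℝ) ∞ (fun y => ψ fun i => f i y) :=
  hψ.contMDiff.comp (contMDiff_pi_space.2 hf)

theorem hamiltonian_comp (θ : ContactForm n M) {k : ℕ} {f : Fin k → M → ℝ}
    (hf : ∀ i, ContMDiff (𝓡 (2 * n + 1)) 𝓘(ℝ, ℝ) ∞ (f i))
    {ψ : (Fin k → ℝ) → ℝ} (hψ : ContDiff ℝ ∞ ψ) (x : M) :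
    θ.hamiltonian (fun y => ψ fun i => f i y) x =
      ∑ i, partialAt ψ (fun i => f i x) i • θ.hamiltonian (f i) x := by
  refine (θ.eq_hamiltonian ?_ fun v hv => ?_).symm
  · exact sum_mem fun i _ => Submodule.smul_mem _ _ (θ.hamiltonian_mem _ _)
  · rw [mvfderiv_comp hf hψ, map_sum, LinearMap.sum_apply]
    refine Finset.sum_congr rfl fun i _ => ?_
    rw [map_smul, LinearMap.smul_apply, θ.omega_hamiltonian _ _ _ hv, smul_eq_mul]

/-- Functions of first integrals of `D`, or of `D^⊥`, are intermediate integrals of the Goursat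
equation wherever their Hamiltonian field does not vanish. -/
theorem isIntermediateIntegralOn_comp (θ : ContactForm n M) (D : Subdistribution θ)
    {f : Fin n → M → ℝ} (hf : (∀ i, IsFirstIntegral (n := n) D.plane (f i)) ∨
      (∀ i, IsFirstIntegral (n := n) (fun m => θ.orth m (D.plane m)) (f i)))
    {ψ : (Fin n → ℝ) → ℝ} (hψ : ContDiff ℝ ∞ ψ) {W : Set M}
    (hW : ∀ x ∈ W, θ.hamiltonian (fun y => ψ fun i => f i y) x ≠ 0) :
    IsIntermediateIntegralOn θ (goursatEquation θ D) (fun y => ψ fun i => f i y) W := by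
  have hfs : ∀ i, ContMDiff (𝓡 (2 * n + 1)) 𝓘(ℝ, ℝ) ∞ (f i) := fun i => by
    rcases hf with hf | hf <;> exact (hf i).1
  intro c S hSW hS hc
  refine ⟨hS, fun x hx => ?_⟩
  obtain ⟨e, he, hxe⟩ := hS.1.exists_sliceChart hx
  set Y := θ.hamiltonian (fun y => ψ fun i => f i y) x with hY
  have hYC : Y ∈ θ.plane x := θ.hamiltonian_mem _ _
  have hLn : Module.finrank ℝ (tangentPlane (2 * n + 1) S x) = n :=
    finrank_tangentPlane (by omega) he hxe hx
  have hiso := θ.isotropic_tangentPlane hS hx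
  have hLC := hS.2 x hx
  -- `dh` vanishes on the Lagrangian plane `T_x S`, so `Y_h` is orthogonal to it and therefore
  -- belongs to it.
  have hYL : Y ∈ tangentPlane (2 * n + 1) S x := by
    refine mem_of_forall_orthogonal (θ.nondegenerate x) (θ.extDerivForm_self x)
      (θ.finrank_plane x) hLC hLn hiso hYC fun l hl => ?_
    rw [hY, θ.omega_hamiltonian _ _ _ (hLC hl)]
    exact mvfderiv_eq_zero_of_const he hxe hx (contMDiff_comp hfs hψ) (c := c)
      (Eventually.of_forall hc) hl
  refine ⟨⟨hLC, hLn, hiso⟩, ?_⟩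
  have hY0 : Y ≠ 0 := hW x (hSW hx)
  -- First integrals of `D` make `Y` orthogonal to `D`, and a dimension count produces a common
  -- vector. First integrals of `D^⊥` put `Y` itself into `D`.
  rcases hf with hf | hf
  · refine inf_ne_bot_of_orthogonal (θ.nondegenerate x)
      (θ.finrank_plane x) hLC (D.le_contact x) hLn (D.finrank_eq x) hiso hYL hY0 fun u hu => ?_
    rw [hY, θ.omega_hamiltonian _ _ _ (D.le_contact x hu), mvfderiv_comp hfs hψ]
    exact Finset.sum_eq_zero fun i _ => by rw [(hf i).2 x u hu, mul_zero]
  · have hYD : Y ∈ D.plane x := by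
      refine mem_of_forall_orthogonal_orthogonal (θ.nondegenerate x) (θ.extDerivForm_self x)
        (D.le_contact x) hYC fun w hw hwD => ?_
      rw [hY, θ.omega_hamiltonian _ _ _ hw, mvfderiv_comp hfs hψ]
      exact Finset.sum_eq_zero fun i _ => by rw [(hf i).2 x w ⟨hw, hwD⟩, mul_zero]
    exact fun hbot => hY0 ((Submodule.mem_bot ℝ).1 (hbot ▸ ⟨hYL, hYD⟩))

end Contact

/-! ### Charts straightening a vector field -/

section Straightening

/-- The coordinate functions. -/
def coord {d : ℕ} (i : Fin d) : Euc d →L[ℝ] ℝ := EuclideanSpace.proj i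

theorem coord_apply {d : ℕ} (i : Fin d) (v : Euc d) : coord i v = v.ofLp i := rfl

/-- The coordinate vectors. -/
def unitVec {d : ℕ} (i : Fin d) : Euc d := EuclideanSpace.single i 1

theorem coord_unitVec {d : ℕ} (i : Fin d) : coord i (unitVec i) = 1 := by
  simp [coord, unitVec]

theorem coord_unitVec_of_ne {d : ℕ} {i j : Fin d} (h : j ≠ i) : coord j (unitVec i) = 0 := by
  simp [coord, unitVec, h]

theorem norm_unitVec {d : ℕ} (i : Fin d) : ‖unitVec i‖ = 1 := by
  simp [unitVec]

theorem unitVec_mem_sliceSpace {d k : ℕ} {i : Fin d} (h : (i : ℕ) < k) :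
    unitVec i ∈ sliceSpace d k := fun j hj => by
  change coord j (unitVec i) = 0
  exact coord_unitVec_of_ne (by rintro rfl; omega)

/-- The linear automorphism fixing `ker ℓ` and mapping `e` to `a`. -/
theorem exists_shear {E : Type*} [NormedAddCommGroup E] [NormedSpace ℝ E]
    [FiniteDimensional ℝ E] (ℓ : E →L[ℝ] ℝ) {e a : E} (he : ℓ e = 1) (ha : ℓ a ≠ 0) :
    ∃ Λ : E ≃L[ℝ] E, Λ e = a ∧ ∀ v, Λ v = v + ℓ v • (a - e) := by
  let Λ : E ≃ₗ[ℝ] E :=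
    { toFun := fun v => v + ℓ v • (a - e)
      map_add' := fun u v => by simp only [map_add, add_smul]; abel
      map_smul' := fun c v => by simp only [map_smul, smul_eq_mul, mul_smul, smul_add,
        RingHom.id_apply]
      invFun := fun w => w - (ℓ w / ℓ a) • (a - e)
      left_inv := fun v => by
        have : (ℓ v + ℓ v * (ℓ a - 1)) / ℓ a = ℓ v := by field_simp; ring
        simp only [map_add, map_smul, map_sub, he, smul_eq_mul, this, add_sub_cancel_right]
      right_inv := fun w => by
        have : ℓ w - ℓ w / ℓ a * (ℓ a - 1) = ℓ w / ℓ a := by field_simp; ring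
        simp only [map_smul, map_sub, he, smul_eq_mul, this, sub_add_cancel] }
  refine ⟨Λ.toContinuousLinearEquiv, ?_, fun v => rfl⟩
  change e + ℓ e • (a - e) = a
  rw [he, one_smul, add_sub_cancel]

variable {d : ℕ} {M : Type*} [TopologicalSpace M]
  [ChartedSpace (EuclideanSpace ℝ (Fin d)) M] [IsManifold (𝓡 d) ∞ M]
  {e : OpenPartialHomeomorph M (Euc d)}

/-- A flow box `Φ` goes from straight coordinates to the given ones, so the straightened chart is
obtained by composing with its inverse. -/
theorem chartDeriv_trans_symm (he : e ∈ IsManifold.maximalAtlas (𝓡 d) ∞ M)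
    {Φ : OpenPartialHomeomorph (Euc d) (Euc d)} (hΦ : ContDiffOn ℝ ∞ Φ Φ.source)
    (hΦ' : ContDiffOn ℝ ∞ Φ.symm Φ.target) {Y : Euc d → Euc d} {w : Euc d}
    (hY : ∀ y ∈ Φ.source, fderiv ℝ Φ y w = Y (Φ y)) {x : M} (hx : x ∈ (e.trans Φ.symm).source)
    {v : TangentSpace (𝓡 d) x} (hv : chartDeriv e x v = Y (e x)) :
    chartDeriv (e.trans Φ.symm) x v = w := by
  have hxt : e x ∈ Φ.target := hx.2
  have hy : Φ.symm (e x) ∈ Φ.source := Φ.map_target hxt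
  rw [chartDeriv_trans he hΦ' hx, hv]
  have h1 := hY _ hy
  rw [Φ.right_inv hxt] at h1
  rw [← h1]
  have h2 : HasFDerivAt Φ (fderiv ℝ Φ (Φ.symm (e x))) (Φ.symm (e x)) :=
    ((hΦ.differentiableOn (by simp)).differentiableAt (Φ.open_source.mem_nhds hy)).hasFDerivAt
  have h3 : HasFDerivAt Φ.symm (fderiv ℝ Φ.symm (e x)) (Φ (Φ.symm (e x))) := by
    rw [Φ.right_inv hxt]
    exact ((hΦ'.differentiableOn (by simp)).differentiableAt
      (Φ.open_target.mem_nhds hxt)).hasFDerivAt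
  have h4 := h3.comp _ h2
  have h5 : Φ.symm ∘ Φ =ᶠ[𝓝 (Φ.symm (e x))] id := by
    filter_upwards [Φ.open_source.mem_nhds hy] with z hz
    exact Φ.left_inv hz
  have h6 := h4.unique ((hasFDerivAt_id _).congr_of_eventuallyEq h5)
  exact congrArg (fun A : Euc d →L[ℝ] Euc d => A w) h6

theorem IsSliceChart.trans_symm {k : ℕ} {S : Set M} (he : IsSliceChart k S e)
    {Φ : OpenPartialHomeomorph (Euc d) (Euc d)} (hΦ : ContDiffOn ℝ ∞ Φ Φ.source)
    (hΦ' : ContDiffOn ℝ ∞ Φ.symm Φ.target)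
    (h : ∀ y ∈ Φ.source, y ∈ sliceSpace d k ↔ Φ y ∈ sliceSpace d k) :
    IsSliceChart k S (e.trans Φ.symm) := by
  refine ⟨trans_mem_maximalAtlas he.mem_atlas (Φ := Φ.symm) hΦ' hΦ, fun x hx => ?_⟩
  have hxt : e x ∈ Φ.target := hx.2
  rw [he.mem_iff x hx.1]
  have h1 := h _ (Φ.map_target hxt)
  rw [Φ.right_inv hxt] at h1
  exact h1.symm

/-- A vector field transverse to a submanifold can be straightened in a chart flattening the
submanifold. -/
theorem IsSliceChart.exists_straight_of_transverse {k : ℕ} {S : Set M} (he : IsSliceChart k S e)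
    {m : M} (hm : m ∈ e.source) (hmS : m ∈ S) {Y : Euc d → Euc d}
    (hY : ContDiffOn ℝ ∞ Y e.target) (hYm : Y (e m) ∉ sliceSpace d k) (hk : k < d) :
    ∃ e' : OpenPartialHomeomorph M (Euc d), IsSliceChart k S e' ∧ m ∈ e'.source ∧
      e'.source ⊆ e.source ∧ ∀ x ∈ e'.source, ∀ v : TangentSpace (𝓡 d) x,
        chartDeriv e x v = Y (e x) → chartDeriv e' x v = unitVec (⟨k, hk⟩ : Fin d) := by
  have hp : e m ∈ e.target := e.map_source hm
  have hpS : e m ∈ sliceSpace d k := (he.mem_iff m hm).1 hmS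
  obtain ⟨i, hi, hYi⟩ : ∃ i : Fin d, k ≤ (i : ℕ) ∧ coord i (Y (e m)) ≠ 0 := by
    by_contra! hcon
    exact hYm hcon
  obtain ⟨Λ₁, hΛ₁, hΛ₁'⟩ := exists_shear (coord i) (coord_unitVec i) hYi
  -- The linear part must send the `k`-th unit vector to `Y (e m)` and fix the slice pointwise. The
  -- swap sends the `k`-th unit vector to the `i`-th, where `Y` has a nonzero normal component, and
  -- the shear sends that one to `Y (e m)`. Both fix vectors of the slice.
  let σ : Euc d ≃L[ℝ] Euc d :=
    (LinearIsometryEquiv.piLpCongrLeft 2 ℝ ℝ (Equiv.swap ⟨k, hk⟩ i)).toContinuousLinearEquiv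
  have hσ1 : σ (unitVec ⟨k, hk⟩) = unitVec i := by
    change LinearIsometryEquiv.piLpCongrLeft 2 ℝ ℝ (Equiv.swap ⟨k, hk⟩ i) _ = _
    rw [unitVec, EuclideanSpace.piLpCongrLeft_single, Equiv.swap_apply_left]; rfl
  have hσ2 : ∀ v ∈ sliceSpace d k, σ v = v := by
    intro v hv
    ext j
    change v.ofLp ((Equiv.swap ⟨k, hk⟩ i).symm j) = v.ofLp j
    rw [Equiv.symm_swap]
    rcases eq_or_ne j ⟨k, hk⟩ with rfl | h1
    · rw [Equiv.swap_apply_left, hv _ hi, hv _ le_rfl]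
    rcases eq_or_ne j i with rfl | h2
    · rw [Equiv.swap_apply_right, hv _ hi, hv _ le_rfl]
    rw [Equiv.swap_apply_of_ne_of_ne h1 h2]
  have hΛ : ∀ v ∈ sliceSpace d k, (σ.trans Λ₁) v = v := by
    intro v hv
    rw [ContinuousLinearEquiv.trans_apply, hσ2 v hv, hΛ₁', coord_apply, hv i hi, zero_smul,
      add_zero]
  obtain ⟨Φ, hpΦ, hΦp, hΦt, hΦs, hΦs', -, hΦY, hΦℓ⟩ := exists_flowBox e.open_target hp hY
    (σ.trans Λ₁) (coord ⟨k, hk⟩) (coord_unitVec _)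
    (by rw [ContinuousLinearEquiv.trans_apply, hσ1, hΛ₁])
  have hfix : ∀ y ∈ Φ.source, y ∈ sliceSpace d k → Φ y = y := by
    intro y hy hyS
    rw [hΦℓ y hy (by rw [coord_apply, coord_apply, hyS _ le_rfl, hpS _ le_rfl]),
      hΛ _ (sub_mem hyS hpS), add_sub_cancel]
  -- The flow box fixes the slice points of its source. For the converse, if `Φ y` lies in the slice
  -- and again in the source, then `Φ (Φ y) = Φ y`, and injectivity gives `Φ y = y`.
  let O : Set (Euc d) := Φ.source ∩ Φ ⁻¹' Φ.source
  have hO : IsOpen O := Φ.isOpen_inter_preimage Φ.open_source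
  have hpO : e m ∈ O := ⟨hpΦ, by rw [mem_preimage, hΦp]; exact hpΦ⟩
  let Ψ := Φ.restrOpen O hO
  have hΨsrc : Ψ.source ⊆ O := fun y hy => hy.2
  have hΨ1 : ContDiffOn ℝ ∞ Ψ Ψ.source := hΦs.mono fun y hy => hy.1
  have hΨ2 : ContDiffOn ℝ ∞ Ψ.symm Ψ.target := hΦs'.mono fun y hy => hy.1
  have hpΨ : e m ∈ Ψ.source := ⟨hpΦ, hpO⟩
  have hΨp : Ψ (e m) = e m := hΦp
  have hΨt : e m ∈ Ψ.target := by rw [← hΨp]; exact Ψ.map_source hpΨ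
  refine ⟨e.trans Ψ.symm, he.trans_symm hΨ1 hΨ2 fun y hy => ⟨fun h => ?_, fun h => ?_⟩,
    ⟨hm, hΨt⟩, fun x hx => hx.1, fun x hx v hv => ?_⟩
  · change Φ y ∈ _
    rwa [hfix y hy.1 h]
  · have h1 := hfix _ (hΨsrc hy).2 h
    have h2 : Φ y = y := Φ.injOn (hΨsrc hy).2 hy.1 h1
    rw [← h2]; exact h
  · exact chartDeriv_trans_symm he.mem_atlas hΨ1 hΨ2 (fun y hy => hΦY y hy.1) hx hv

/-- The coordinates vanishing on a coordinate subspace. -/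
def normalCoord (d k : ℕ) : Euc d →L[ℝ] ({i : Fin d // k ≤ (i : ℕ)} → ℝ) :=
  ContinuousLinearMap.pi fun i => coord i.1

/-- A right inverse of `normalCoord`. -/
def normalIncl (d k : ℕ) : ({i : Fin d // k ≤ (i : ℕ)} → ℝ) →L[ℝ] Euc d :=
  ∑ i, (ContinuousLinearMap.proj (R := ℝ) (φ := fun _ => ℝ) i).smulRight (unitVec i.1)

theorem normalCoord_normalIncl (d k : ℕ) (w : {i : Fin d // k ≤ (i : ℕ)} → ℝ) :
    normalCoord d k (normalIncl d k w) = w := by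
  ext j
  change coord j.1 (normalIncl d k w) = w j
  simp only [normalIncl, sum_apply, ContinuousLinearMap.smulRight_apply,
    map_sum, map_smul, smul_eq_mul, ContinuousLinearMap.proj_apply]
  rw [Finset.sum_eq_single j, coord_unitVec, mul_one]
  · intro i _ hij
    rw [coord_unitVec_of_ne (fun h => hij (Subtype.ext h.symm)), mul_zero]
  · simp

theorem mem_sliceSpace_iff_normalCoord {d k : ℕ} {v : Euc d} :
    v ∈ sliceSpace d k ↔ normalCoord d k v = 0 :=
  ⟨fun h => funext fun i => h i.1 i.2, fun h i hi => congrFun h ⟨i, hi⟩⟩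

/-- A vector field tangent to a submanifold can be straightened in a chart flattening the
submanifold. -/
theorem IsSliceChart.exists_straight_of_tangent {k : ℕ} {S : Set M} (he : IsSliceChart k S e)
    {m : M} (hm : m ∈ e.source) (hmS : m ∈ S) {Y : Euc d → Euc d}
    (hY : ContDiffOn ℝ ∞ Y e.target) (hYm : Y (e m) ≠ 0)
    (htan : ∀ᶠ y in 𝓝 (e m), y ∈ sliceSpace d k → Y y ∈ sliceSpace d k) :
    ∃ e' : OpenPartialHomeomorph M (Euc d), IsSliceChart k S e' ∧ m ∈ e'.source ∧
      e'.source ⊆ e.source ∧ ∃ j : Fin d, (j : ℕ) < k ∧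
      ∀ x ∈ e'.source, ∀ v : TangentSpace (𝓡 d) x,
        chartDeriv e x v = Y (e x) → chartDeriv e' x v = unitVec j := by
  have hp : e m ∈ e.target := e.map_source hm
  set p := e m with hpdef
  have hpS : p ∈ sliceSpace d k := (he.mem_iff m hm).1 hmS
  have hYpS : Y p ∈ sliceSpace d k := htan.self_of_nhds hpS
  obtain ⟨j, hYj⟩ : ∃ j : Fin d, coord j (Y p) ≠ 0 := by
    by_contra! hcon
    exact hYm (by ext j; exact hcon j)
  have hjk : (j : ℕ) < k := by
    by_contra! hcon
    exact hYj (hYpS j hcon)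
  have huS : unitVec j ∈ sliceSpace d k := unitVec_mem_sliceSpace hjk
  obtain ⟨Λ, hΛ, hΛ'⟩ := exists_shear (coord j) (coord_unitVec j) hYj
  have hΛS : ∀ v, Λ v ∈ sliceSpace d k ↔ v ∈ sliceSpace d k := fun v => by
    rw [hΛ' v]
    exact Submodule.add_mem_iff_left _ (Submodule.smul_mem _ _ (sub_mem hYpS huS))
  obtain ⟨Φ, hpΦ, hΦp, hΦt, hΦs, hΦs', -, hΦY, hΦℓ⟩ := exists_flowBox e.open_target hp hY
    Λ (coord j) (coord_unitVec _) hΛ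
  obtain ⟨K, T, hT, hYT⟩ := ((hY.contDiffAt (e.open_target.mem_nhds hp)).of_le
    (by simp : (1 : WithTop ℕ∞) ≤ ∞)).exists_lipschitzOnWith
  have hπp : normalCoord d k p = 0 := mem_sliceSpace_iff_normalCoord.1 hpS
  -- Projection to the slice. The comparison in `integralCurve_stays` needs both a point and its
  -- projection in the region where `Y` is Lipschitz and tangent to the slice.
  let κ : Euc d → Euc d := fun z => z - normalIncl d k (normalCoord d k z)
  have hκ : Continuous κ := by fun_prop
  have hκp : κ p = p := by simp only [κ, hπp, map_zero, sub_zero]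
  let T' : Set (Euc d) := T ∩ {y | y ∈ sliceSpace d k → Y y ∈ sliceSpace d k}
  have hT' : T' ∈ 𝓝 p := inter_mem hT htan
  have hev : ∀ᶠ z in 𝓝 p, z ∈ T' ∧ κ z ∈ T' := by
    refine Filter.Eventually.and hT' ?_
    have h1 : Tendsto κ (𝓝 p) (𝓝 p) := by
      have := hκ.tendsto p
      rwa [hκp] at this
    exact h1 hT'
  have hev2 : ∀ᶠ y in 𝓝 p, y ∈ Φ.source ∧ Φ y ∈ T' ∧ κ (Φ y) ∈ T' := by
    refine Filter.Eventually.and (Φ.open_source.mem_nhds hpΦ) ?_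
    have h1 : Tendsto Φ (𝓝 p) (𝓝 p) := by
      have := (Φ.continuousAt hpΦ).tendsto
      rwa [hΦp] at this
    exact h1.eventually hev
  obtain ⟨r, hr, hball⟩ := Metric.eventually_nhds_iff_ball.1 hev2
  -- Lines in direction `unitVec j` are mapped by `Φ` to integral curves of `Y`, which cannot leave
  -- the slice since `Y` is tangent to it.
  have hstay : ∀ y ∈ Metric.ball p r, ∀ s : ℝ, y + s • unitVec j ∈ Metric.ball p r →
      Φ y ∈ sliceSpace d k → Φ (y + s • unitVec j) ∈ sliceSpace d k := by
    intro y hy s hys hΦyS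
    have hseg : ∀ t ∈ Icc (0 : ℝ) 1, y + t • s • unitVec j ∈ Metric.ball p r := fun t ht =>
      (convex_ball p r).add_smul_mem hy hys ht
    have h1 := integralCurve_stays (Y := Y) (K := K) (T := T') (s := s)
      (hYT.mono inter_subset_left) (normalCoord d k)
      (normalIncl d k) (normalCoord_normalIncl d k)
      (fun z hz hz0 => mem_sliceSpace_iff_normalCoord.1
        (hz.2 (mem_sliceSpace_iff_normalCoord.2 hz0)))
      (c := fun t => Φ (y + t • s • unitVec j)) ?_ ?_ ?_
    · have h2 := mem_sliceSpace_iff_normalCoord.2 h1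
      rwa [one_smul] at h2
    · intro t ht
      have h2 := (hball _ (hseg t ht)).1
      have h3 := hasDerivAt_comp_line Φ.open_source hΦs h2
      rw [map_smul, hΦY _ h2] at h3
      exact h3
    · intro t ht
      exact (hball _ (hseg t ht)).2
    · have h2 := mem_sliceSpace_iff_normalCoord.1 hΦyS
      simpa using h2
  have hproj : ∀ y ∈ Metric.ball p r, y + (coord j (p - y)) • unitVec j ∈ Metric.ball p r := by
    intro y hy
    rw [mem_ball_iff_norm] at hy ⊢
    refine lt_of_le_of_lt ?_ hy
    rw [EuclideanSpace.norm_eq, EuclideanSpace.norm_eq]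
    refine Real.sqrt_le_sqrt (Finset.sum_le_sum fun i _ => ?_)
    rcases eq_or_ne i j with rfl | hij
    · have : (y + (coord i (p - y)) • unitVec i - p).ofLp i = 0 := by
        change coord i (y + (coord i (p - y)) • unitVec i - p) = 0
        simp only [map_sub, map_add, map_smul, smul_eq_mul, coord_unitVec]
        ring
      rw [this, norm_zero, zero_pow two_ne_zero]
      exact sq_nonneg _
    · have : (y + (coord j (p - y)) • unitVec j - p).ofLp i = (y - p).ofLp i := by
        change coord i (y + (coord j (p - y)) • unitVec j - p) = coord i (y - p)
        simp only [map_sub, map_add, map_smul, smul_eq_mul, coord_unitVec_of_ne hij]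
        ring
      rw [this]
  let Ψ := Φ.restrOpen (Metric.ball p r) Metric.isOpen_ball
  have hΨ1 : ContDiffOn ℝ ∞ Ψ Ψ.source := hΦs.mono fun y hy => hy.1
  have hΨ2 : ContDiffOn ℝ ∞ Ψ.symm Ψ.target := hΦs'.mono fun y hy => hy.1
  have hpΨ : p ∈ Ψ.source := ⟨hpΦ, Metric.mem_ball_self hr⟩
  have hΨp : Ψ p = p := hΦp
  have hΨt : p ∈ Ψ.target := by rw [← hΨp]; exact Ψ.map_source hpΨ
  refine ⟨e.trans Ψ.symm, he.trans_symm hΨ1 hΨ2 fun y hy => ?_,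
    ⟨hm, hΨt⟩, fun x hx => hx.1, j, hjk, fun x hx v hv => ?_⟩
  -- Slide `y` along `unitVec j`, a slice direction, to the hyperplane through `p`. There `Φ` is
  -- affine with a linear part preserving the slice, and `hstay` in both directions brings the
  -- result back to `y`.
  · change _ ↔ Φ y ∈ _
    have hyB : y ∈ Metric.ball p r := hy.2
    have hy0B := hproj y hyB
    have h0 : y + coord j (p - y) • unitVec j ∈ sliceSpace d k ↔ y ∈ sliceSpace d k :=
      Submodule.add_mem_iff_left _ (Submodule.smul_mem _ _ huS)
    have h1 : Φ (y + coord j (p - y) • unitVec j) ∈ sliceSpace d k ↔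
        y + coord j (p - y) • unitVec j ∈ sliceSpace d k := by
      rw [hΦℓ _ (hball _ hy0B).1 (by
          simp only [map_sub, map_add, map_smul, smul_eq_mul, coord_unitVec]; ring),
        Submodule.add_mem_iff_right _ hpS, hΛS, Submodule.sub_mem_iff_left _ hpS]
    rw [← h0, ← h1]
    constructor
    · intro h
      have h2 := hstay _ hy0B (-coord j (p - y)) (by rwa [neg_smul, add_neg_cancel_right]) h
      rwa [neg_smul, add_neg_cancel_right] at h2
    · exact hstay y hyB _ hy0B
  · exact chartDeriv_trans_symm he.mem_atlas hΨ1 hΨ2 (fun y hy => hΦY y hy.1) hx hv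

end Straightening

/-! ### Hamiltonian fields in charts -/

section HamiltonianCharts

variable {n : ℕ} {M : Type*} [TopologicalSpace M]
  [ChartedSpace (EuclideanSpace ℝ (Fin (2 * n + 1))) M] [IsManifold (𝓡 (2 * n + 1)) ∞ M]
  {e : OpenPartialHomeomorph M (Euc (2 * n + 1))}

namespace ContactForm

variable (θ : ContactForm n M)

theorem formInChart_hamiltonian (he : e ∈ IsManifold.maximalAtlas (𝓡 (2 * n + 1)) ∞ M)
    (f : M → ℝ) {x : M} (hx : x ∈ e.source) :
    formInChart θ.form e (e x) (chartDeriv e x (θ.hamiltonian f x)) = 0 := by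
  rw [formInChart_apply θ.form he hx]
  exact θ.hamiltonian_mem f x

theorem dform_hamiltonian (he : e ∈ IsManifold.maximalAtlas (𝓡 (2 * n + 1)) ∞ M)
    {f : M → ℝ} {x : M} (hx : x ∈ e.source)
    (hf : MDifferentiableAt (𝓡 (2 * n + 1)) 𝓘(ℝ, ℝ) f x) {v : Euc (2 * n + 1)}
    (hv : formInChart θ.form e (e x) v = 0) :
    dform (formInChart θ.form e) (e x) (chartDeriv e x (θ.hamiltonian f x)) v =
      fderiv ℝ (f ∘ e.symm) (e x) v := by
  have h1 := chartDeriv_chartVec he hx v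
  rw [← h1] at hv ⊢
  rw [formInChart_apply θ.form he hx] at hv
  rw [← extDerivForm_eq_dform θ.smooth he hx, θ.omega_hamiltonian f x _ hv,
    mvfderiv_eq_fderiv_chart he hf hx]

theorem formInChart_ne_zero (he : e ∈ IsManifold.maximalAtlas (𝓡 (2 * n + 1)) ∞ M)
    {y : Euc (2 * n + 1)} (hy : y ∈ e.target) : formInChart θ.form e y ≠ 0 := by
  intro h
  refine θ.ne_zero (e.symm y) (ContinuousLinearMap.ext fun v => ?_)
  rw [← formInChart_apply θ.form he (e.map_target hy), e.right_inv hy, h]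
  rfl

theorem formInChart_nondegenerate (he : e ∈ IsManifold.maximalAtlas (𝓡 (2 * n + 1)) ∞ M)
    {y : Euc (2 * n + 1)} (hy : y ∈ e.target) (u : Euc (2 * n + 1))
    (hu : formInChart θ.form e y u = 0)
    (h : ∀ v, formInChart θ.form e y v = 0 → dform (formInChart θ.form e) y u v = 0) : u = 0 := by
  have hx := e.map_target hy
  have hxy : e (e.symm y) = y := e.right_inv hy
  have h1 := chartDeriv_chartVec he hx u
  have h2 : θ.form (e.symm y) (chartVec e (e.symm y) u) = 0 := by
    rw [← formInChart_apply θ.form he hx, h1, hxy]; exact hu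
  have h3 : (⟨chartVec e (e.symm y) u, h2⟩ : θ.plane (e.symm y)) = 0 := by
    refine (θ.nondegenerate _).1 _ fun w => ?_
    change extDerivForm θ.form (e.symm y) (chartVec e (e.symm y) u) w = 0
    rw [extDerivForm_eq_dform θ.smooth he hx, h1, hxy]
    refine h _ ?_
    have h4 : θ.form (e.symm y) w = 0 := w.2
    rwa [← formInChart_apply θ.form he hx, hxy] at h4
  have h5 : chartVec e (e.symm y) u = 0 := congrArg Subtype.val h3
  rw [← h1, h5, map_zero]

/-- Hamiltonian fields have smooth coordinate expressions. -/
theorem exists_hamiltonian_chart (he : e ∈ IsManifold.maximalAtlas (𝓡 (2 * n + 1)) ∞ M)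
    {f : M → ℝ} (hf : ContMDiff (𝓡 (2 * n + 1)) 𝓘(ℝ, ℝ) ∞ f) :
    ∃ Y : Euc (2 * n + 1) → Euc (2 * n + 1), ContDiffOn ℝ ∞ Y e.target ∧
      ∀ x ∈ e.source, chartDeriv e x (θ.hamiltonian f x) = Y (e x) := by
  obtain ⟨Y, hY, hYα⟩ := exists_hamiltonian_field e.open_target
    (contDiffOn_formInChart θ.smooth he) (fun y hy => θ.formInChart_ne_zero he hy)
    (fun y hy => θ.formInChart_nondegenerate he hy) (contDiffOn_comp_chart_symm he hf)
  refine ⟨Y, hY, fun x hx => ?_⟩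
  have hy := e.map_source hx
  obtain ⟨h1, h2⟩ := hYα _ hy
  refine sub_eq_zero.1 (θ.formInChart_nondegenerate he hy _ ?_ fun v hv => ?_)
  · rw [map_sub, h1, θ.formInChart_hamiltonian he f hx, sub_zero]
  · have h3 := θ.dform_hamiltonian he hx (hf.mdifferentiableAt (by simp)) hv
    have h4 := h2 v hv
    simp only [dform, map_sub, sub_apply] at h3 h4 ⊢
    linarith

theorem contMDiff_hamiltonian {f : M → ℝ} (hf : ContMDiff (𝓡 (2 * n + 1)) 𝓘(ℝ, ℝ) ∞ f) :
    ContMDiff (𝓡 (2 * n + 1)) (𝓡 (2 * n + 1)).tangent ∞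
      (fun x => (⟨x, θ.hamiltonian f x⟩ : TangentBundle (𝓡 (2 * n + 1)) M)) := by
  refine contMDiff_section_of_charts fun x => ?_
  have he : chartAt (Euc (2 * n + 1)) x ∈ IsManifold.maximalAtlas (𝓡 (2 * n + 1)) ∞ M :=
    IsManifold.chart_mem_maximalAtlas x
  exact ⟨_, he, mem_chart_source _ x, θ.exists_hamiltonian_chart he hf⟩

end ContactForm

end HamiltonianCharts

/-! ### Global extension of germs of functions -/

/-- The coordinate expression is cut off by a bump function supported in the chart domain. The
Hausdorff property makes the extension by zero smooth. -/
theorem exists_contMDiff_eventuallyEq {d : ℕ} {M : Type*} [TopologicalSpace M] [T2Space M]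
    [ChartedSpace (EuclideanSpace ℝ (Fin d)) M] [IsManifold (𝓡 d) ∞ M] {f : M → ℝ} {O : Set M}
    (hO : IsOpen O) {m : M} (hm : m ∈ O) (hf : ContMDiffOn (𝓡 d) 𝓘(ℝ, ℝ) ∞ f O) :
    ∃ g : M → ℝ, ContMDiff (𝓡 d) 𝓘(ℝ, ℝ) ∞ g ∧ g =ᶠ[𝓝 m] f := by
  let c := chartAt (Euc d) m
  have hc : c ∈ IsManifold.maximalAtlas (𝓡 d) ∞ M := IsManifold.chart_mem_maximalAtlas m
  have hmc : m ∈ c.source := mem_chart_source _ m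
  have h1 : ContDiffOn ℝ ∞ (f ∘ c.symm) (c.target ∩ c.symm ⁻¹' O) :=
    contMDiffOn_iff_contDiffOn.1 (hf.comp
      ((contMDiffOn_symm_of_mem_maximalAtlas hc).mono inter_subset_left) fun z hz => hz.2)
  obtain ⟨G, hG, hGf⟩ := exists_contDiff_eventuallyEq (c.symm.isOpen_inter_preimage hO)
    (p := c m) ⟨c.map_source hmc, by rw [mem_preimage, c.left_inv hmc]; exact hm⟩ h1
  let b : SmoothBumpFunction (𝓡 d) m := Classical.arbitrary _
  refine ⟨fun x => b x • G (c x), b.contMDiff_smul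
    (hG.contMDiff.comp_contMDiffOn (contMDiffOn_of_mem_maximalAtlas hc)), ?_⟩
  filter_upwards [b.eventuallyEq_one, (c.continuousAt hmc).tendsto.eventually hGf,
    c.open_source.mem_nhds hmc] with x hx1 hx2 hx3
  rw [hx1, hx2, Function.comp_apply, c.left_inv hx3, Pi.one_apply, one_smul]

/-! ### Boxed charts -/

section Box

/-- The neighbourhoods of the form ball times interval of a point with vanishing `i`-th
coordinate. -/
def box {d : ℕ} (p : Euc d) (i : Fin d) (δ ε : ℝ) : Set (Euc d) :=
  {y | y - coord i y • unitVec i ∈ Metric.ball p δ ∧ |coord i y| < ε}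

theorem isOpen_box {d : ℕ} (p : Euc d) (i : Fin d) (δ ε : ℝ) : IsOpen (box p i δ ε) := by
  have h1 : Continuous fun y : Euc d => y - coord i y • unitVec i := by fun_prop
  have h2 : Continuous fun y : Euc d => |coord i y| := by fun_prop
  have h3 : box p i δ ε = (fun y => y - coord i y • unitVec i) ⁻¹' Metric.ball p δ ∩
      (fun y => |coord i y|) ⁻¹' Iio ε := rfl
  rw [h3]
  exact (Metric.isOpen_ball.preimage h1).inter (isOpen_Iio.preimage h2)

theorem exists_box_subset {d : ℕ} {p : Euc d} {i : Fin d} {U : Set (Euc d)}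
    (hU : U ∈ 𝓝 p) : ∃ δ > 0, box p i δ δ ⊆ U := by
  obtain ⟨r, hr, hball⟩ := Metric.mem_nhds_iff.1 hU
  refine ⟨r / 2, half_pos hr, fun y hy => hball ?_⟩
  obtain ⟨h1, h2⟩ := hy
  rw [mem_ball_iff_norm] at h1 ⊢
  calc ‖y - p‖ = ‖(y - coord i y • unitVec i - p) + coord i y • unitVec i‖ := by congr 1; abel
    _ ≤ ‖y - coord i y • unitVec i - p‖ + ‖coord i y • unitVec i‖ := norm_add_le _ _
    _ = ‖y - coord i y • unitVec i - p‖ + |coord i y| := by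
      rw [norm_smul, norm_unitVec, mul_one, Real.norm_eq_abs]
    _ < r := by linarith

theorem add_smul_mem_box {d : ℕ} {p : Euc d} {i : Fin d} {δ ε : ℝ} {y : Euc d}
    (hy : y ∈ box p i δ ε) (hyi : coord i y = 0) {t : ℝ} (ht : |t| < ε) :
    y + t • unitVec i ∈ box p i δ ε := by
  have h1 : coord i (y + t • unitVec i) = t := by
    rw [map_add, map_smul, coord_unitVec, hyi, smul_eq_mul, mul_one, zero_add]
  refine ⟨?_, by rwa [h1]⟩
  rw [h1, add_sub_cancel_right]
  simpa only [hyi, zero_smul, sub_zero] using hy.1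

variable {d : ℕ} {M : Type*} [TopologicalSpace M]
  [ChartedSpace (EuclideanSpace ℝ (Fin d)) M] [IsManifold (𝓡 d) ∞ M]
  {e : OpenPartialHomeomorph M (Euc d)}

theorem IsSliceChart.exists_restr {k : ℕ} {S : Set M} (he : IsSliceChart k S e)
    {O : Set (Euc d)} (hO : IsOpen O) (hOe : O ⊆ e.target) :
    ∃ e' : OpenPartialHomeomorph M (Euc d), IsSliceChart k S e' ∧ e'.target = O ∧
      e'.source = e.source ∩ e ⁻¹' O ∧ (∀ x, e' x = e x) ∧
      ∀ x ∈ e'.source, chartDeriv e' x = chartDeriv e x := by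
  let Φ : OpenPartialHomeomorph (Euc d) (Euc d) := OpenPartialHomeomorph.ofSet O hO
  have hΦ : ContDiffOn ℝ ∞ Φ Φ.source := contDiff_id.contDiffOn
  have hΦ' : ContDiffOn ℝ ∞ Φ.symm Φ.target := contDiff_id.contDiffOn
  refine ⟨e.trans Φ, ⟨trans_mem_maximalAtlas he.mem_atlas hΦ hΦ', fun x hx => he.mem_iff x hx.1⟩,
    ?_, rfl, fun x => rfl, fun x hx => ContinuousLinearMap.ext fun v => ?_⟩
  · exact Subset.antisymm (fun y hy => hy.1) fun y hy => ⟨hy, hOe hy⟩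
  · rw [chartDeriv_trans he.mem_atlas hΦ hx]
    change fderiv ℝ id (e x) _ = _
    rw [fderiv_id]; rfl

/-- A product-shaped target guarantees that coordinate lines in direction `i`, starting where the
`i`-th coordinate is zero, stay in the chart for the common time `δ`. -/
theorem IsSliceChart.exists_box {k : ℕ} {S : Set M} (he : IsSliceChart k S e) {m : M}
    (hm : m ∈ e.source) {i : Fin d} (hmi : coord i (e m) = 0) {O : Set M} (hO : O ∈ 𝓝 m) :
    ∃ e' : OpenPartialHomeomorph M (Euc d), IsSliceChart k S e' ∧ m ∈ e'.source ∧
      e'.source ⊆ e.source ∩ O ∧ (∀ x ∈ e'.source, chartDeriv e' x = chartDeriv e x) ∧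
      ∃ δ > 0, e'.target = box (e m) i δ δ := by
  have h1 : e.target ∩ e.symm ⁻¹' O ∈ 𝓝 (e m) :=
    inter_mem (e.open_target.mem_nhds (e.map_source hm)) ((e.tendsto_symm hm) hO)
  obtain ⟨δ, hδ, hbox⟩ := exists_box_subset (i := i) h1
  obtain ⟨e', he', ht, hs, -, hd⟩ := he.exists_restr (isOpen_box (e m) i δ δ)
    (hbox.trans inter_subset_left)
  refine ⟨e', he', ?_, ?_, hd, δ, hδ, ht⟩
  · rw [hs]
    refine ⟨hm, ?_, by rw [hmi, abs_zero]; exact hδ⟩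
    rw [hmi, zero_smul, sub_zero]
    exact Metric.mem_ball_self hδ
  · rw [hs]
    rintro x ⟨hx1, hx2⟩
    have h2 := (hbox hx2).2
    rw [mem_preimage, e.left_inv hx1] at h2
    exact ⟨hx1, h2⟩

theorem sub_mem_sliceSpace {d k : ℕ} (hk : k < d) {y : Euc d} (hy : y ∈ sliceSpace d (k + 1)) :
    y - coord ⟨k, hk⟩ y • unitVec (⟨k, hk⟩ : Fin d) ∈ sliceSpace d k := by
  intro i hi
  change coord i (y - coord ⟨k, hk⟩ y • unitVec (⟨k, hk⟩ : Fin d)) = 0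
  rcases eq_or_ne i ⟨k, hk⟩ with rfl | h
  · rw [map_sub, map_smul, coord_unitVec, smul_eq_mul, mul_one, sub_self]
  · have h1 : (i : ℕ) ≠ k := fun h2 => h (Fin.ext h2)
    rw [map_sub, map_smul, coord_unitVec_of_ne h, smul_zero, sub_zero]
    exact hy i (by omega)

end Box

/-! ### Flowing a Cauchy datum along a Hamiltonian field -/

section Flow

variable {n : ℕ} {M : Type*} [TopologicalSpace M]
  [ChartedSpace (EuclideanSpace ℝ (Fin (2 * n + 1))) M] [IsManifold (𝓡 (2 * n + 1)) ∞ M]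
  {e : OpenPartialHomeomorph M (Euc (2 * n + 1))}

/-- The part of a chart domain lying over the coordinate subspace of dimension `k`. -/
def chartSlice {d : ℕ} {M : Type*} [TopologicalSpace M] (k : ℕ)
    (e : OpenPartialHomeomorph M (Euc d)) : Set M :=
  {x | x ∈ e.source ∧ e x ∈ sliceSpace d k}

theorem isSliceChart_chartSlice {d : ℕ} {M : Type*} [TopologicalSpace M]
    [ChartedSpace (EuclideanSpace ℝ (Fin d)) M] [IsManifold (𝓡 d) ∞ M]
    {e : OpenPartialHomeomorph M (Euc d)} (k : ℕ)
    (he : e ∈ IsManifold.maximalAtlas (𝓡 d) ∞ M) : IsSliceChart k (chartSlice k e) e :=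
  ⟨he, fun _ hx => ⟨fun h => h.2, fun h => ⟨hx, h⟩⟩⟩

theorem inter_subset_chartSlice {d : ℕ} {M : Type*} [TopologicalSpace M]
    [ChartedSpace (EuclideanSpace ℝ (Fin d)) M] [IsManifold (𝓡 d) ∞ M]
    {e : OpenPartialHomeomorph M (Euc d)} {k : ℕ} {N : Set M} (he : IsSliceChart k N e) :
    N ∩ e.source ⊆ chartSlice (k + 1) e := fun x hx =>
  ⟨hx.2, sliceSpace_mono k.le_succ ((he.mem_iff x hx.2).1 hx.1)⟩

/-- In a boxed chart, a point of the coordinate subspace of dimension `k + 1` is joined to the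
coordinate subspace of dimension `k` by a coordinate line. -/
theorem exists_base_point {d k : ℕ} (hk : k < d) {p y : Euc d} {δ : ℝ}
    (hy : y ∈ box p ⟨k, hk⟩ δ δ) (hyS : y ∈ sliceSpace d (k + 1)) :
    ∃ y₀ ∈ box p ⟨k, hk⟩ δ δ, ∃ t : ℝ, |t| < δ ∧ y₀ ∈ sliceSpace d k ∧
      coord ⟨k, hk⟩ y₀ = 0 ∧ y = y₀ + t • unitVec ⟨k, hk⟩ := by
  have hS := sub_mem_sliceSpace hk hyS
  have h0 := hS ⟨k, hk⟩ le_rfl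
  change coord ⟨k, hk⟩ (y - coord ⟨k, hk⟩ y • unitVec (⟨k, hk⟩ : Fin d)) = 0 at h0
  refine ⟨_, ⟨?_, ?_⟩, coord ⟨k, hk⟩ y, hy.2, hS, h0, (sub_add_cancel _ _).symm⟩
  · rw [h0, zero_smul, sub_zero]
    exact hy.1
  · rw [h0, abs_zero]
    exact (abs_nonneg _).trans_lt hy.2

theorem segment_mem_box {d : ℕ} {p y : Euc d} {i : Fin d} {δ t : ℝ} (hy : y ∈ box p i δ δ)
    (hy0 : coord i y = 0) (ht : |t| < δ) :
    ∀ s ∈ Icc (0 : ℝ) 1, y + s • t • unitVec i ∈ box p i δ δ := by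
  intro s hs
  rw [smul_smul]
  refine add_smul_mem_box hy hy0 (lt_of_le_of_lt ?_ ht)
  rw [abs_mul, abs_of_nonneg hs.1]
  exact mul_le_of_le_one_left (abs_nonneg _) hs.2

variable (θ : ContactForm n M)

/-- A tangent vector splits into a multiple of `Y_h`, which lies in `C`, and a constant vector
tangent to `N` at the base of its flow line. At the base the latter is annihilated by `θ`, as `N` is
integral, and by `dh`, as `h = 0` on `N`. `isotropic_transport` carries this along the line. -/
theorem isIntegralSubmanifold_chartSlice {k : ℕ} (hk : k < 2 * n + 1) {N : Set M}
    (hN : IsIntegralSubmanifold θ k N) (he : IsSliceChart k N e) {h : M → ℝ}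
    (hh : ContMDiff (𝓡 (2 * n + 1)) 𝓘(ℝ, ℝ) ∞ h) (hh0 : ∀ x ∈ N ∩ e.source, h x = 0)
    (hham : ∀ x ∈ e.source,
      chartDeriv e x (θ.hamiltonian h x) = unitVec (⟨k, hk⟩ : Fin (2 * n + 1)))
    {p : Euc (2 * n + 1)} {δ : ℝ} (htarget : e.target = box p ⟨k, hk⟩ δ δ)
    {R : Euc (2 * n + 1)} (hR : ∀ y ∈ e.target, formInChart θ.form e y R ≠ 0) :
    IsIntegralSubmanifold θ (k + 1) (chartSlice (k + 1) e) := by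
  have heS := isSliceChart_chartSlice (k + 1) he.mem_atlas
  refine ⟨fun m hm => ⟨e, he.mem_atlas, hm.1, heS.mem_iff⟩, fun x hx v hv => ?_⟩
  rw [mem_tangentPlane_iff heS hx.1 hx] at hv
  change θ.form x v = 0
  rw [← formInChart_apply θ.form he.mem_atlas hx.1]
  set y := e x with hy
  have hyt : y ∈ e.target := e.map_source hx.1
  have hα := contDiffOn_formInChart θ.smooth he.mem_atlas
  have hhe := contDiffOn_comp_chart_symm he.mem_atlas hh
  have hw : ∀ z ∈ e.target, formInChart θ.form e z (unitVec ⟨k, hk⟩) = 0 ∧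
      ∀ u, formInChart θ.form e z u = 0 →
        dform (formInChart θ.form e) z (unitVec ⟨k, hk⟩) u = fderiv ℝ (h ∘ e.symm) z u := by
    intro z hz
    have hzs := e.map_target hz
    have h1 := θ.formInChart_hamiltonian he.mem_atlas h hzs
    rw [hham _ hzs, e.right_inv hz] at h1
    refine ⟨h1, fun u hu => ?_⟩
    rw [← e.right_inv hz] at hu ⊢
    rw [← θ.dform_hamiltonian he.mem_atlas hzs (hh.mdifferentiableAt (by simp)) hu, hham _ hzs]
  have hybox : y ∈ box p ⟨k, hk⟩ δ δ := htarget ▸ hyt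
  obtain ⟨y₀, hy₀, t, ht, hy₀S, hy₀k, hyy₀⟩ := exists_base_point hk hybox hx.2
  have hy₀t : y₀ ∈ e.target := htarget ▸ hy₀
  set u₀ := chartDeriv e x v - coord ⟨k, hk⟩ (chartDeriv e x v) • unitVec ⟨k, hk⟩ with hu₀
  have hu₀S : u₀ ∈ sliceSpace (2 * n + 1) k := sub_mem_sliceSpace hk hv
  have hv' : chartDeriv e x v = u₀ + coord ⟨k, hk⟩ (chartDeriv e x v) • unitVec ⟨k, hk⟩ :=
    (sub_add_cancel _ _).symm
  have hx₀ := e.map_target hy₀t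
  have hx₀N : e.symm y₀ ∈ N := (he.mem_iff _ hx₀).2 (by rwa [e.right_inv hy₀t])
  have hbase : formInChart θ.form e y₀ u₀ = 0 := by
    have h1 : chartVec e (e.symm y₀) u₀ ∈ tangentPlane (2 * n + 1) N (e.symm y₀) :=
      (mem_tangentPlane_iff he hx₀ hx₀N _).2 (by rwa [chartDeriv_chartVec he.mem_atlas hx₀])
    have h2 : θ.form _ (chartVec e (e.symm y₀) u₀) = 0 := hN.2 _ hx₀N h1
    rwa [← formInChart_apply θ.form he.mem_atlas hx₀, chartDeriv_chartVec he.mem_atlas hx₀,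
      e.right_inv hy₀t] at h2
  have hdh : fderiv ℝ (h ∘ e.symm) y₀ u₀ = 0 := by
    refine fderiv_apply_eq_zero_of_const (S := sliceSpace (2 * n + 1) k) (c := 0)
      ((hhe.differentiableOn (by simp)).differentiableAt (e.open_target.mem_nhds hy₀t)) hy₀S ?_
      hu₀S
    filter_upwards [e.open_target.mem_nhds hy₀t] with z hz hzS
    have hzs := e.map_target hz
    exact hh0 _ ⟨(he.mem_iff _ hzs).2 (by rwa [e.right_inv hz]), hzs⟩
  -- The transport lemma moves for time one, so the field and the Hamiltonian are both multiplied by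
  -- the time `t`.
  have hmain := isotropic_transport e.open_target hα (h := fun z => t * (h ∘ e.symm) z)
    (contDiffOn_const.mul hhe)
    (e := t • unitVec ⟨k, hk⟩) (R := R) (y := y₀) (v := u₀)
    (fun z hz => by rw [map_smul, (hw z hz).1, smul_zero])
    (fun z hz u hu => by
      rw [dform_smul_left, (hw z hz).2 u hu, fderiv_const_mul
        ((hhe.differentiableOn (by simp)).differentiableAt (e.open_target.mem_nhds hz))]
      rfl)
    hR (fun s hs => htarget ▸ segment_mem_box hy₀ hy₀k ht s hs) hbase (by
      rw [fderiv_const_mul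
        ((hhe.differentiableOn (by simp)).differentiableAt (e.open_target.mem_nhds hy₀t))]
      change t * fderiv ℝ (h ∘ e.symm) y₀ u₀ = 0
      rw [hdh, mul_zero])
  rw [← hyy₀] at hmain
  rw [hv', map_add, hmain, map_smul, (hw y hyt).1, smul_zero, add_zero]

/-- `u` is constant along the lines of `Y_h`, each of which starts on `N`. -/
theorem eq_zero_on_chartSlice {k : ℕ} (hk : k < 2 * n + 1) {N : Set M}
    (he : IsSliceChart k N e) {u h : M → ℝ}
    (hu : ContMDiff (𝓡 (2 * n + 1)) 𝓘(ℝ, ℝ) ∞ u) (hu0 : ∀ x ∈ N ∩ e.source, u x = 0)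
    (hham : ∀ x ∈ e.source,
      chartDeriv e x (θ.hamiltonian h x) = unitVec (⟨k, hk⟩ : Fin (2 * n + 1)))
    (huh : ∀ x ∈ e.source, mvfderiv (𝓡 (2 * n + 1)) u x (θ.hamiltonian h x) = 0)
    {p : Euc (2 * n + 1)} {δ : ℝ} (htarget : e.target = box p ⟨k, hk⟩ δ δ) :
    ∀ x ∈ chartSlice (k + 1) e, u x = 0 := by
  intro x hx
  have hyt : e x ∈ e.target := e.map_source hx.1
  obtain ⟨y₀, hy₀, t, ht, hy₀S, hy₀k, hyy₀⟩ := exists_base_point hk (htarget ▸ hyt) hx.2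
  have hy₀t : y₀ ∈ e.target := htarget ▸ hy₀
  have hx₀ := e.map_target hy₀t
  have h1 := eq_of_fderiv_apply_eq_zero e.open_target (contDiffOn_comp_chart_symm he.mem_atlas hu)
    (y := y₀) (e := t • unitVec ⟨k, hk⟩)
    (fun s hs => htarget ▸ segment_mem_box hy₀ hy₀k ht s hs) (fun z hz => by
      have hzs := e.map_target hz
      have h2 := huh _ hzs
      rw [mvfderiv_eq_fderiv_chart he.mem_atlas (hu.mdifferentiableAt (by simp)) hzs,
        hham _ hzs, e.right_inv hz] at h2
      rw [map_smul, h2, smul_zero])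
  rw [← hyy₀, Function.comp_apply, e.left_inv hx.1] at h1
  rw [h1]
  exact hu0 _ ⟨(he.mem_iff _ hx₀).2 (by rwa [e.right_inv hy₀t]), hx₀⟩

/-- An integral submanifold on which `h` vanishes, and to which `Y_h` is transverse, extends to an
integral submanifold of one dimension more, made of integral curves of `Y_h`. -/
theorem exists_boxed_chart {k : ℕ} (hk : k < 2 * n + 1) {N : Set M}
    (hN : IsIntegralSubmanifold θ k N) {m : M} (hm : m ∈ N) {h : M → ℝ}
    (hh : ContMDiff (𝓡 (2 * n + 1)) 𝓘(ℝ, ℝ) ∞ h) (hh0 : ∀ᶠ x in 𝓝 m, x ∈ N → h x = 0)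
    (ht : θ.hamiltonian h m ∉ tangentPlane (2 * n + 1) N m) {O : Set M} (hO : O ∈ 𝓝 m) :
    ∃ e : OpenPartialHomeomorph M (Euc (2 * n + 1)), IsSliceChart k N e ∧ m ∈ e.source ∧
      e.source ⊆ O ∧ (∀ x ∈ e.source,
        chartDeriv e x (θ.hamiltonian h x) = unitVec (⟨k, hk⟩ : Fin (2 * n + 1))) ∧
      (∃ (p : Euc (2 * n + 1)) (δ : ℝ), 0 < δ ∧ e.target = box p ⟨k, hk⟩ δ δ) ∧
      IsIntegralSubmanifold θ (k + 1) (chartSlice (k + 1) e) := by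
  obtain ⟨e₀, he₀, hm₀⟩ := hN.1.exists_sliceChart hm
  obtain ⟨Y, hY, hYh⟩ := θ.exists_hamiltonian_chart he₀.mem_atlas hh
  rw [mem_tangentPlane_iff he₀ hm₀ hm, hYh m hm₀] at ht
  obtain ⟨e₁, he₁, hm₁, h₁₀, hY₁⟩ := he₀.exists_straight_of_transverse hm₀ hm hY ht hk
  have hmt := e₁.map_source hm₁
  -- A constant vector transverse to the contact hyperplanes near `m`, as `isotropic_transport`
  -- requires.
  obtain ⟨R, hR⟩ : ∃ R, formInChart θ.form e₁ (e₁ m) R ≠ 0 := by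
    by_contra! hcon
    exact θ.formInChart_ne_zero he₁.mem_atlas hmt (ContinuousLinearMap.ext hcon)
  have hO1 : ∀ᶠ x in 𝓝 m, x ∈ e₁.source ∧ formInChart θ.form e₁ (e₁ x) R ≠ 0 ∧
      (x ∈ N → h x = 0) ∧ x ∈ O := by
    have h1 : ContinuousAt (fun y => formInChart θ.form e₁ y R) (e₁ m) :=
      ((contDiffOn_formInChart θ.smooth he₁.mem_atlas).continuousOn.clm_apply
        continuousOn_const).continuousAt (e₁.open_target.mem_nhds hmt)
    filter_upwards [e₁.open_source.mem_nhds hm₁,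
      (e₁.continuousAt hm₁).tendsto.eventually (h1.eventually_ne hR), hh0, hO] with x a b c d
    exact ⟨a, b, c, d⟩
  obtain ⟨e, he, hme, hes, hd, δ, hδ, htarget⟩ := he₁.exists_box hm₁ (i := ⟨k, hk⟩)
    ((he₁.mem_iff m hm₁).1 hm ⟨k, hk⟩ le_rfl) hO1
  have hham : ∀ x ∈ e.source,
      chartDeriv e x (θ.hamiltonian h x) = unitVec (⟨k, hk⟩ : Fin (2 * n + 1)) := fun x hx => by
    rw [hd x hx]
    exact hY₁ x (hes hx).1 _ (hYh x (h₁₀ (hes hx).1))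
  refine ⟨e, he, hme, fun x hx => (hes hx).2.2.2.2, hham, ⟨_, δ, hδ, htarget⟩,
    isIntegralSubmanifold_chartSlice θ hk hN he hh (fun x hx => (hes hx.2).2.2.2.1 hx.1) hham
      htarget (R := R) fun y hy => ?_⟩
  have hx := e.map_target hy
  have h1 := chartDeriv_chartVec he.mem_atlas hx R
  have h2 := formInChart_apply θ.form he.mem_atlas hx (chartVec e (e.symm y) R)
  have h3 := formInChart_apply θ.form he₁.mem_atlas (hes hx).1 (chartVec e (e.symm y) R)
  rw [← hd _ hx, h1] at h3
  rw [h1, e.right_inv hy] at h2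
  rw [h2, ← h3]
  exact (hes hx).2.2.1

/-- The flow-out of a submanifold in a boxed chart straightening the vector field. -/
theorem flowOut_eq_chartSlice [T2Space M] {k : ℕ} (hk : k < 2 * n + 1) {N : Set M}
    (he : IsSliceChart k N e) {X : ∀ x : M, TangentSpace (𝓡 (2 * n + 1)) x}
    (hX : ContMDiff (𝓡 (2 * n + 1)) (𝓡 (2 * n + 1)).tangent ∞
      (fun x => (⟨x, X x⟩ : TangentBundle (𝓡 (2 * n + 1)) M)))
    (hXe : ∀ x ∈ e.source, chartDeriv e x (X x) = unitVec (⟨k, hk⟩ : Fin (2 * n + 1)))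
    {p : Euc (2 * n + 1)} {δ : ℝ} (hδ : 0 < δ) (htarget : e.target = box p ⟨k, hk⟩ δ δ) :
    flowOut (n := n) X (N ∩ e.source) δ = chartSlice (k + 1) e := by
  have hcurve : ∀ y ∈ e.target, coord ⟨k, hk⟩ y = 0 →
      IsMIntegralCurveOn (I := 𝓡 (2 * n + 1)) (e.symm ∘ fun t : ℝ => y + t • unitVec ⟨k, hk⟩) X
        (Ioo (-δ) δ) := by
    intro y hy hy0 t ht
    have h1 : HasDerivAt (fun t : ℝ => y + t • unitVec (⟨k, hk⟩ : Fin (2 * n + 1)))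
        (unitVec ⟨k, hk⟩) t := by
      simpa using ((hasDerivAt_id t).smul_const
        (unitVec (⟨k, hk⟩ : Fin (2 * n + 1)))).const_add y
    have h2 : y + t • unitVec ⟨k, hk⟩ ∈ e.target :=
      htarget ▸ add_smul_mem_box (htarget ▸ hy) hy0 (abs_lt.2 ht)
    have h3 := hasMFDerivAt_chart_symm_comp he.mem_atlas h1 h2
    have hs := e.map_target h2
    have h4 := chartVec_chartDeriv he.mem_atlas hs (X _)
    rw [hXe _ hs] at h4
    exact (h3.congr_mfderiv
      (congrArg (ContinuousLinearMap.smulRight (1 : ℝ →L[ℝ] ℝ)) h4)).hasMFDerivWithinAt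
  have hline : ∀ y ∈ e.target, y ∈ sliceSpace (2 * n + 1) k → ∀ t : ℝ, |t| < δ →
      e.symm (y + t • unitVec ⟨k, hk⟩) ∈ chartSlice (k + 1) e := by
    intro y hy hyS t ht
    have h2 : y + t • unitVec ⟨k, hk⟩ ∈ e.target :=
      htarget ▸ add_smul_mem_box (htarget ▸ hy) (hyS _ le_rfl) ht
    refine ⟨e.map_target h2, ?_⟩
    rw [e.right_inv h2]
    exact add_mem (sliceSpace_mono k.le_succ hyS)
      (Submodule.smul_mem _ _ (unitVec_mem_sliceSpace k.lt_succ_self))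
  refine Subset.antisymm ?_ ?_
  · rintro x ⟨γ, hγ, hγ0, t, ht, rfl⟩
    have hy := e.map_source hγ0.2
    have hyS := (he.mem_iff _ hγ0.2).1 hγ0.1
    -- Uniqueness of integral curves, where the Hausdorff property enters: every curve counted in
    -- `flowOut` is a coordinate line.
    have h1 := isMIntegralCurveOn_Ioo_eqOn_of_contMDiff_boundaryless
      (t₀ := 0) ⟨by linarith, hδ⟩ (hX.of_le (by simp)) hγ (hcurve _ hy (hyS _ le_rfl)) (by
        simp only [Function.comp_apply, zero_smul, add_zero, e.left_inv hγ0.2])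
    rw [h1 ht]
    exact hline _ hy hyS t (abs_lt.2 ht)
  · intro x hx
    have hyt : e x ∈ e.target := e.map_source hx.1
    obtain ⟨y₀, hy₀, t, ht, hy₀S, hy₀k, hyy₀⟩ := exists_base_point hk (htarget ▸ hyt) hx.2
    have hy₀t : y₀ ∈ e.target := htarget ▸ hy₀
    have hx₀ := e.map_target hy₀t
    refine ⟨_, hcurve y₀ hy₀t hy₀k, ?_, t, abs_lt.1 ht, ?_⟩
    · simp only [Function.comp_apply, zero_smul, add_zero]
      exact ⟨(he.mem_iff _ hx₀).2 (by rwa [e.right_inv hy₀t]), hx₀⟩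
    · rw [Function.comp_apply, ← hyy₀, e.left_inv hx.1]

end Flow

/-! ### Restriction of functions to a submanifold -/

section RestrictedRank

/-- The restrictions of functions to a submanifold, in a chart flattening it. -/
def restrictedMap {d j : ℕ} {M : Type*} [TopologicalSpace M] (k : ℕ) (f : Fin j → M → ℝ)
    (e : OpenPartialHomeomorph M (Euc d)) (y : sliceSpace d k) : Fin j → ℝ :=
  fun i => f i (e.symm (y : Euc d))

theorem eventually_nhdsWithin_iff_sliceSpace {d k : ℕ} {M : Type*} [TopologicalSpace M]
    [ChartedSpace (EuclideanSpace ℝ (Fin d)) M] [IsManifold (𝓡 d) ∞ M]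
    {e : OpenPartialHomeomorph M (Euc d)} {N : Set M} (he : IsSliceChart k N e) {m : M}
    (hm : m ∈ e.source) (hmS : e m ∈ sliceSpace d k) {P : M → Prop} :
    (∀ᶠ x in 𝓝[N] m, P x) ↔
      ∀ᶠ y : sliceSpace d k in 𝓝 ⟨e m, hmS⟩, P (e.symm (y : Euc d)) := by
  have hval : Tendsto (fun y : sliceSpace d k => (y : Euc d)) (𝓝 ⟨e m, hmS⟩) (𝓝 (e m)) :=
    continuous_subtype_val.tendsto _
  constructor
  · intro h
    have h1 : Tendsto (fun y : sliceSpace d k => e.symm (y : Euc d)) (𝓝 ⟨e m, hmS⟩)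
        (𝓝[N] m) := by
      refine tendsto_nhdsWithin_iff.2 ⟨(e.tendsto_symm hm).comp hval, ?_⟩
      filter_upwards [hval (e.open_target.mem_nhds (e.map_source hm))] with y hy
      exact (he.mem_iff _ (e.map_target hy)).2 (by rw [e.right_inv hy]; exact y.2)
    exact h1.eventually h
  · intro h
    rw [nhds_subtype_eq_comap, eventually_comap] at h
    rw [eventually_nhdsWithin_iff]
    filter_upwards [(e.continuousAt hm).tendsto.eventually h, e.open_source.mem_nhds hm]
      with x hx hxs hxN
    have := hx ⟨e x, (he.mem_iff x hxs).1 hxN⟩ rfl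
    rwa [e.left_inv hxs] at this

variable {n : ℕ} {M : Type*} [TopologicalSpace M]
  [ChartedSpace (EuclideanSpace ℝ (Fin (2 * n + 1))) M] [IsManifold (𝓡 (2 * n + 1)) ∞ M]
  {e : OpenPartialHomeomorph M (Euc (2 * n + 1))} {j k : ℕ} {f : Fin j → M → ℝ} {N : Set M}

theorem isOpen_sliceSpace_preimage (k : ℕ) (e : OpenPartialHomeomorph M (Euc (2 * n + 1))) :
    IsOpen {y : sliceSpace (2 * n + 1) k | (y : Euc (2 * n + 1)) ∈ e.target} :=
  e.open_target.preimage continuous_subtype_val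

theorem contDiffOn_restrictedMap (he : e ∈ IsManifold.maximalAtlas (𝓡 (2 * n + 1)) ∞ M)
    (hf : ∀ i, ContMDiff (𝓡 (2 * n + 1)) 𝓘(ℝ, ℝ) ∞ (f i)) :
    ContDiffOn ℝ ∞ (restrictedMap k f e) {y | (y : Euc (2 * n + 1)) ∈ e.target} :=
  contDiffOn_pi.2 fun i => (contDiffOn_comp_chart_symm he (hf i)).comp
    (sliceSpace (2 * n + 1) k).subtypeL.contDiff.contDiffOn fun _ hy => hy

theorem fderiv_restrictedMap (he : e ∈ IsManifold.maximalAtlas (𝓡 (2 * n + 1)) ∞ M)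
    (hf : ∀ i, ContMDiff (𝓡 (2 * n + 1)) 𝓘(ℝ, ℝ) ∞ (f i)) {x : M} (hx : x ∈ e.source)
    (hxS : e x ∈ sliceSpace (2 * n + 1) k) {v : TangentSpace (𝓡 (2 * n + 1)) x}
    (hv : chartDeriv e x v ∈ sliceSpace (2 * n + 1) k) :
    fderiv ℝ (restrictedMap k f e) ⟨e x, hxS⟩ ⟨chartDeriv e x v, hv⟩ =
      fun i => mvfderiv (𝓡 (2 * n + 1)) (f i) x v := by
  have h1 : HasFDerivAt (restrictedMap k f e) (ContinuousLinearMap.pi fun i =>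
      (fderiv ℝ (f i ∘ e.symm) (e x)).comp (sliceSpace (2 * n + 1) k).subtypeL)
      (⟨e x, hxS⟩ : sliceSpace (2 * n + 1) k) := by
    refine hasFDerivAt_pi.2 fun i => ?_
    have h2 : HasFDerivAt (f i ∘ e.symm) (fderiv ℝ (f i ∘ e.symm) (e x))
        ((sliceSpace (2 * n + 1) k).subtypeL ⟨e x, hxS⟩) :=
      (((contDiffOn_comp_chart_symm he (hf i)).differentiableOn (by simp)).differentiableAt
        (e.open_target.mem_nhds (e.map_source hx))).hasFDerivAt
    exact h2.comp _ (sliceSpace (2 * n + 1) k).subtypeL.hasFDerivAt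
  rw [h1.fderiv]
  funext i
  rw [mvfderiv_eq_fderiv_chart he ((hf i).mdifferentiableAt (by simp)) hx]
  rfl

theorem range_fderiv_restrictedMap (he : IsSliceChart k N e)
    (hf : ∀ i, ContMDiff (𝓡 (2 * n + 1)) 𝓘(ℝ, ℝ) ∞ (f i)) {x : M} (hx : x ∈ e.source)
    (hxN : x ∈ N) (hxS : e x ∈ sliceSpace (2 * n + 1) k) :
    LinearMap.range (fderiv ℝ (restrictedMap k f e) ⟨e x, hxS⟩ :
      sliceSpace (2 * n + 1) k →ₗ[ℝ] Fin j → ℝ) =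
      (tangentPlane (2 * n + 1) N x).map
        (LinearMap.pi fun i => (mvfderiv (𝓡 (2 * n + 1)) (f i) x).toLinearMap) := by
  ext w
  constructor
  · rintro ⟨⟨v, hv⟩, rfl⟩
    have h1 := chartDeriv_chartVec he.mem_atlas hx v
    have hv' : chartDeriv e x (chartVec e x v) ∈ sliceSpace (2 * n + 1) k := by rwa [h1]
    refine ⟨chartVec e x v, (mem_tangentPlane_iff he hx hxN _).2 hv', ?_⟩
    have h2 := fderiv_restrictedMap he.mem_atlas hf hx hxS hv'
    have h3 : (⟨chartDeriv e x (chartVec e x v), hv'⟩ : sliceSpace (2 * n + 1) k) = ⟨v, hv⟩ :=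
      Subtype.ext h1
    rw [h3] at h2
    exact h2.symm
  · rintro ⟨v, hv, rfl⟩
    exact ⟨_, fderiv_restrictedMap he.mem_atlas hf hx hxS ((mem_tangentPlane_iff he hx hxN v).1 hv)⟩

theorem finrank_range_fderiv_restrictedMap (he : IsSliceChart k N e)
    (hf : ∀ i, ContMDiff (𝓡 (2 * n + 1)) 𝓘(ℝ, ℝ) ∞ (f i)) {y : sliceSpace (2 * n + 1) k}
    (hy : (y : Euc (2 * n + 1)) ∈ e.target) :
    Module.finrank ℝ (LinearMap.range (fderiv ℝ (restrictedMap k f e) y :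
      sliceSpace (2 * n + 1) k →ₗ[ℝ] Fin j → ℝ)) =
      restrictedRank (n := n) f N (e.symm (y : Euc (2 * n + 1))) := by
  have hx := e.map_target hy
  have hxy : e (e.symm (y : Euc (2 * n + 1))) = y := e.right_inv hy
  have hxS : e (e.symm (y : Euc (2 * n + 1))) ∈ sliceSpace (2 * n + 1) k := by
    rw [hxy]; exact y.2
  have h1 := range_fderiv_restrictedMap he hf hx ((he.mem_iff _ hx).2 hxS) hxS
  have h2 : (⟨e (e.symm (y : Euc (2 * n + 1))), hxS⟩ : sliceSpace (2 * n + 1) k) = y :=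
    Subtype.ext hxy
  rw [h2] at h1
  rw [h1]
  rfl

/-- The rank of the restrictions is lower semicontinuous. -/
theorem eventually_restrictedRank_le (hN : IsSubmanifold (2 * n + 1) k N)
    (hf : ∀ i, ContMDiff (𝓡 (2 * n + 1)) 𝓘(ℝ, ℝ) ∞ (f i)) {m : M} (hm : m ∈ N) :
    ∀ᶠ x in 𝓝[N] m, restrictedRank (n := n) f N m ≤ restrictedRank (n := n) f N x := by
  obtain ⟨e, he, hme⟩ := hN.exists_sliceChart hm
  have hmS := (he.mem_iff m hme).1 hm
  rw [eventually_nhdsWithin_iff_sliceSpace he hme hmS]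
  set q : sliceSpace (2 * n + 1) k := ⟨e m, hmS⟩ with hq
  have hqt : (q : Euc (2 * n + 1)) ∈ e.target := e.map_source hme
  have hopen := isOpen_sliceSpace_preimage k e
  have hcont : ContinuousAt (fderiv ℝ (restrictedMap k f e)) q :=
    (((contDiffOn_restrictedMap (k := k) he.mem_atlas hf).fderiv_of_isOpen hopen
      (m := ∞) (by simp)).continuousOn).continuousAt (hopen.mem_nhds hqt)
  have hr := finrank_range_fderiv_restrictedMap he hf hqt
  rw [show e.symm (q : Euc (2 * n + 1)) = m from e.left_inv hme] at hr
  have h1 := hcont.tendsto.eventually ((isOpen_setOfPred_nat_le_rank (𝕜 := ℝ)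
    (E := sliceSpace (2 * n + 1) k) (F := Fin j → ℝ) (restrictedRank (n := n) f N m)).mem_nhds (by
      change (restrictedRank (n := n) f N m : Cardinal) ≤
        Module.rank ℝ (LinearMap.range (fderiv ℝ (restrictedMap k f e) q :
          sliceSpace (2 * n + 1) k →ₗ[ℝ] Fin j → ℝ))
      rw [← Module.finrank_eq_rank, hr]))
  filter_upwards [h1, hopen.mem_nhds hqt] with y hy hyt
  rw [← finrank_range_fderiv_restrictedMap he hf hyt]
  change (restrictedRank (n := n) f N m : Cardinal) ≤
    Module.rank ℝ (LinearMap.range (fderiv ℝ (restrictedMap k f e) y :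
      sliceSpace (2 * n + 1) k →ₗ[ℝ] Fin j → ℝ)) at hy
  rw [← Module.finrank_eq_rank] at hy
  exact_mod_cast hy

theorem restrictedRank_le (f : Fin j → M → ℝ) (N : Set M) (x : M) :
    restrictedRank (n := n) f N x ≤ j := by
  refine (Submodule.finrank_le _).trans ?_
  rw [Module.finrank_fin_fun]

/-- If the restrictions of the `f_i` to `N` have constant rank, then every linear relation between
their differentials at a point is the differential of a relation between the functions. -/
theorem exists_relation (hN : IsSubmanifold (2 * n + 1) k N)
    (hf : ∀ i, ContMDiff (𝓡 (2 * n + 1)) 𝓘(ℝ, ℝ) ∞ (f i)) {m : M} (hm : m ∈ N) {r : ℕ}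
    (hr : ∀ᶠ x in 𝓝[N] m, restrictedRank (n := n) f N x = r) {c : Fin j → ℝ}
    (hc : ∀ v ∈ tangentPlane (2 * n + 1) N m,
      ∑ i, c i * mvfderiv (𝓡 (2 * n + 1)) (f i) m v = 0) :
    ∃ ψ : (Fin j → ℝ) → ℝ, ContDiff ℝ ∞ ψ ∧ (∀ᶠ x in 𝓝 m, x ∈ N → ψ (fun i => f i x) = 0) ∧
      ∀ i, partialAt ψ (fun i => f i m) i = c i := by
  obtain ⟨e, he, hme⟩ := hN.exists_sliceChart hm
  have hmS := (he.mem_iff m hme).1 hm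
  rw [eventually_nhdsWithin_iff_sliceSpace he hme hmS] at hr
  set q : sliceSpace (2 * n + 1) k := ⟨e m, hmS⟩ with hq
  have hqt : (q : Euc (2 * n + 1)) ∈ e.target := e.map_source hme
  have hopen := isOpen_sliceSpace_preimage k e
  obtain ⟨U, hU, hUo, hqU⟩ := eventually_nhds_iff.1 (hr.and (hopen.eventually_mem hqt))
  let ℓ : (Fin j → ℝ) →L[ℝ] ℝ := ∑ i, c i • ContinuousLinearMap.proj (R := ℝ) i
  have hℓ : ∀ w, ℓ w = ∑ i, c i * w i := fun w => by simp [ℓ]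
  obtain ⟨ψ, hψ, hψ0, hψc⟩ := exists_equation_of_constant_rank hUo hqU
    ((contDiffOn_restrictedMap he.mem_atlas hf).mono fun y hy => (hU y hy).2) (r := r)
    (fun y hy => by
      rw [finrank_range_fderiv_restrictedMap he hf (hU y hy).2, (hU y hy).1]) ℓ (by
      rintro ⟨v, hv⟩
      have h1 := chartDeriv_chartVec he.mem_atlas hme v
      have hv' : chartDeriv e m (chartVec e m v) ∈ sliceSpace (2 * n + 1) k := by rwa [h1]
      have h2 := fderiv_restrictedMap he.mem_atlas hf hme hmS hv'
      have h3 : (⟨chartDeriv e m (chartVec e m v), hv'⟩ : sliceSpace (2 * n + 1) k) = ⟨v, hv⟩ :=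
        Subtype.ext h1
      rw [h3] at h2
      rw [hq, h2, hℓ]
      exact hc _ ((mem_tangentPlane_iff he hme hm _).2 hv'))
  have hqm : restrictedMap k f e q = fun i => f i m := by
    funext i
    change f i (e.symm (e m)) = f i m
    rw [e.left_inv hme]
  refine ⟨ψ, hψ, ?_, fun i => ?_⟩
  · rw [← eventually_nhdsWithin_iff, eventually_nhdsWithin_iff_sliceSpace he hme hmS]
    exact hψ0
  · rw [partialAt, ← hqm, hψc, hℓ]
    simp [Pi.single_apply]

/-- The regular points of a Cauchy datum are dense. -/
theorem subset_closure_regular (θ : ContactForm n M) (hN : IsSubmanifold (2 * n + 1) k N)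
    (hf : ∀ i, ContMDiff (𝓡 (2 * n + 1)) 𝓘(ℝ, ℝ) ∞ (f i)) :
    N ⊆ closure {m ∈ N | IsRegularPoint θ f N m} := by
  intro m hm
  rw [mem_closure_iff]
  intro o ho hmo
  -- At a point of `N ∩ o` where the bounded integer-valued rank is maximal, lower semicontinuity
  -- makes it constant nearby.
  let A : Set ℕ := restrictedRank (n := n) f N '' (N ∩ o)
  have hA : BddAbove A := ⟨j, by rintro _ ⟨x, -, rfl⟩; exact restrictedRank_le f N x⟩
  obtain ⟨x₀, ⟨hx₀N, hx₀o⟩, hx₀⟩ : sSup A ∈ A := Nat.sSup_mem ⟨_, m, ⟨hm, hmo⟩, rfl⟩ hA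
  have hconst : ∀ᶠ x in 𝓝[N] x₀, restrictedRank (n := n) f N x = sSup A := by
    filter_upwards [eventually_restrictedRank_le hN hf hx₀N, self_mem_nhdsWithin,
      mem_nhdsWithin_of_mem_nhds (ho.mem_nhds hx₀o)] with x h1 h2 h3
    exact le_antisymm (le_csSup hA ⟨x, ⟨h2, h3⟩, rfl⟩) (hx₀ ▸ h1)
  by_cases hchar : ∀ᶠ x in 𝓝[N] x₀, ¬ NonCharacteristicAt θ f N x
  · exact ⟨x₀, hx₀o, hx₀N, ⟨_, hconst⟩, Or.inr hchar⟩
  -- Non-characteristic points accumulate at `x₀`; one close enough still lies in `o` and has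
  -- constant rank around it.
  · have h1 : ∃ᶠ x in 𝓝[N] x₀, NonCharacteristicAt θ f N x := hchar
    obtain ⟨x, hx, h2, h3, h4⟩ := (h1.and_eventually
      ((eventually_eventually_nhdsWithin.2 hconst).and (Filter.Eventually.and self_mem_nhdsWithin
        (mem_nhdsWithin_of_mem_nhds (ho.mem_nhds hx₀o))))).exists
    exact ⟨x, h4, h3, ⟨_, h2⟩, Or.inl hx⟩

end RestrictedRank

/-! ### Construction of solutions -/

section Solutions

variable {n : ℕ} {M : Type*} [TopologicalSpace M]
  [ChartedSpace (EuclideanSpace ℝ (Fin (2 * n + 1))) M] [IsManifold (𝓡 (2 * n + 1)) ∞ M]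

/-- Linear combinations of independent Hamiltonian fields do not vanish. -/
theorem sum_hamiltonian_ne_zero {θ : ContactForm n M} {k : ℕ} {f : Fin k → M → ℝ}
    (hind : IndependentFunctions θ f) {m : M} {c : Fin k → ℝ} (hc : c ≠ 0) :
    ∑ i, c i • θ.hamiltonian (f i) m ≠ 0 := by
  intro h
  obtain ⟨R, hR⟩ : ∃ R, θ.form m R ≠ 0 := by
    by_contra! hcon
    exact θ.ne_zero m (ContinuousLinearMap.ext hcon)
  have h1 : ∀ v ∈ θ.plane m, ∑ i, c i * mvfderiv (𝓡 (2 * n + 1)) (f i) m v = 0 := by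
    intro v hv
    have h2 : extDerivForm θ.form m (∑ i, c i • θ.hamiltonian (f i) m) v = 0 := by
      rw [h, map_zero, LinearMap.zero_apply]
    rw [map_sum, LinearMap.sum_apply] at h2
    rw [← h2]
    refine Finset.sum_congr rfl fun i _ => ?_
    rw [map_smul, LinearMap.smul_apply, θ.omega_hamiltonian _ _ _ hv, smul_eq_mul]
  -- `∑ c_i df_i` vanishes on `ker θ`, hence equals `a θ`, with `a` read off on `R`. This
  -- contradicts the independence of `θ, df_1, …, df_k`.
  set a : ℝ := (∑ i, c i * mvfderiv (𝓡 (2 * n + 1)) (f i) m R) / θ.form m R with ha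
  have h3 := Fintype.linearIndependent_iff.1 (hind m) (Fin.cons (-a) c) (by
    rw [Fin.sum_univ_succ]
    simp only [Fin.cons_zero, Fin.cons_succ]
    refine ContinuousLinearMap.ext fun v => ?_
    have h4 := h1 (v - (θ.form m v / θ.form m R) • R) (by
      change θ.form m _ = 0
      rw [map_sub, map_smul, smul_eq_mul, div_mul_cancel₀ _ hR, sub_self])
    simp only [map_sub, map_smul, smul_eq_mul, mul_sub, Finset.sum_sub_distrib] at h4
    have h5 : ∑ i, c i * (θ.form m v / θ.form m R * mvfderiv (𝓡 (2 * n + 1)) (f i) m R) =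
        a * θ.form m v := by
      rw [ha, div_mul_eq_mul_div, Finset.sum_mul, Finset.sum_div]
      exact Finset.sum_congr rfl fun i _ => by ring
    rw [h5] at h4
    have h6 : (∑ i, c i • mvfderiv (𝓡 (2 * n + 1)) (f i) m) v =
        ∑ i, c i * mvfderiv (𝓡 (2 * n + 1)) (f i) m v := by
      rw [sum_apply]; rfl
    change -a * θ.form m v + (∑ i, c i • mvfderiv (𝓡 (2 * n + 1)) (f i) m) v = 0
    rw [h6]
    linarith)
  exact hc (funext fun i => by simpa using h3 i.succ)

theorem eventually_hamiltonian_ne_zero (θ : ContactForm n M) {h : M → ℝ}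
    (hh : ContMDiff (𝓡 (2 * n + 1)) 𝓘(ℝ, ℝ) ∞ h) {m : M} (hm : θ.hamiltonian h m ≠ 0) :
    ∀ᶠ x in 𝓝 m, θ.hamiltonian h x ≠ 0 := by
  have he : chartAt (Euc (2 * n + 1)) m ∈ IsManifold.maximalAtlas (𝓡 (2 * n + 1)) ∞ M :=
    IsManifold.chart_mem_maximalAtlas m
  have hme : m ∈ (chartAt (Euc (2 * n + 1)) m).source := mem_chart_source _ m
  obtain ⟨Y, hY, hYh⟩ := θ.exists_hamiltonian_chart he hh
  have h1 : Y (chartAt (Euc (2 * n + 1)) m m) ≠ 0 := by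
    rw [← hYh m hme]
    exact fun h0 => hm ((chartEquiv he hme).map_eq_zero_iff.1 h0)
  have h2 := hY.continuousOn.continuousAt
    ((chartAt (Euc (2 * n + 1)) m).open_target.mem_nhds (mem_chart_target _ m))
  filter_upwards [(chartAt (Euc (2 * n + 1)) m).open_source.mem_nhds hme,
    ((chartAt (Euc (2 * n + 1)) m).continuousAt hme).tendsto.eventually (h2.eventually_ne h1)]
    with x hx hx' h0
  rw [← hYh x hx, h0, map_zero] at hx'
  exact hx' rfl

/-- Antisymmetry of `ω(Y_h, Y_g)`. Involution can thus be checked by differentiating `g` along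
`Y_h`. -/
theorem mvfderiv_hamiltonian_swap (θ : ContactForm n M) (g h : M → ℝ) (x : M) :
    mvfderiv (𝓡 (2 * n + 1)) h x (θ.hamiltonian g x) =
      -mvfderiv (𝓡 (2 * n + 1)) g x (θ.hamiltonian h x) := by
  rw [← θ.omega_hamiltonian h x _ (θ.hamiltonian_mem g x),
    ← θ.omega_hamiltonian g x _ (θ.hamiltonian_mem h x),
    swap_eq_neg_of_alt (θ.extDerivForm_self x)]

variable {θ : ContactForm n M} {D : Subdistribution θ} {f : Fin n → M → ℝ} {N : Set M}

theorem IsIntegralSubmanifold.finrank_tangentPlane {k : ℕ} (hk : k ≤ 2 * n + 1)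
    (hN : IsIntegralSubmanifold θ k N) {m : M} (hm : m ∈ N) :
    Module.finrank ℝ (tangentPlane (2 * n + 1) N m) = k := by
  obtain ⟨e, he, hme⟩ := hN.1.exists_sliceChart hm
  exact MongeAmpere.finrank_tangentPlane hk he hme hm

/-- If a function `g` in involution with the intermediate integral `h = ψ(f_1, …, f_n)` vanishes
on the datum and `Y_g` is transverse to it, flowing along `Y_g` gives a solution. -/
theorem exists_solution (hn : 1 ≤ n) (D : Subdistribution θ)
    (hf : (∀ i, IsFirstIntegral (n := n) D.plane (f i)) ∨
      (∀ i, IsFirstIntegral (n := n) (fun m => θ.orth m (D.plane m)) (f i)))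
    (hN : IsIntegralSubmanifold θ (n - 1) N) {m : M} (hm : m ∈ N)
    {ψ : (Fin n → ℝ) → ℝ} (hψ : ContDiff ℝ ∞ ψ)
    (hψ0 : ∀ᶠ x in 𝓝 m, x ∈ N → ψ (fun i => f i x) = 0)
    (hne : θ.hamiltonian (fun y => ψ fun i => f i y) m ≠ 0)
    {g : M → ℝ} (hg : ContMDiff (𝓡 (2 * n + 1)) 𝓘(ℝ, ℝ) ∞ g)
    (hg0 : ∀ᶠ x in 𝓝 m, x ∈ N → g x = 0)
    (hgt : θ.hamiltonian g m ∉ tangentPlane (2 * n + 1) N m)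
    (hgh : ∀ᶠ x in 𝓝 m,
      mvfderiv (𝓡 (2 * n + 1)) (fun y => ψ fun i => f i y) x (θ.hamiltonian g x) = 0) :
    ∃ e : OpenPartialHomeomorph M (Euc (2 * n + 1)), IsSliceChart (n - 1) N e ∧ m ∈ e.source ∧
      (∃ hk : n - 1 < 2 * n + 1, (∀ x ∈ e.source,
        chartDeriv e x (θ.hamiltonian g x) = unitVec (⟨n - 1, hk⟩ : Fin (2 * n + 1))) ∧
        ∃ (p : Euc (2 * n + 1)) (δ : ℝ), 0 < δ ∧ e.target = box p ⟨n - 1, hk⟩ δ δ) ∧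
      (∀ x ∈ e.source, θ.hamiltonian (fun y => ψ fun i => f i y) x ≠ 0) ∧
      (∀ x ∈ N ∩ e.source, ψ (fun i => f i x) = 0) ∧
      IsSolution θ (goursatEquation θ D) (chartSlice n e) ∧
      N ∩ e.source ⊆ chartSlice n e ∧ ∀ x ∈ chartSlice n e, ψ (fun i => f i x) = 0 := by
  have hfs : ∀ i, ContMDiff (𝓡 (2 * n + 1)) 𝓘(ℝ, ℝ) ∞ (f i) := fun i => by
    rcases hf with hf | hf <;> exact (hf i).1
  have hh := contMDiff_comp hfs hψ
  have hk : n - 1 < 2 * n + 1 := by omega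
  obtain ⟨e, he, hme, heO, hham, ⟨p, δ, hδ, htarget⟩, hint⟩ := exists_boxed_chart θ hk hN hm hg hg0
    hgt ((eventually_hamiltonian_ne_zero θ hh hne).and (hψ0.and hgh))
  have hsub := inter_subset_chartSlice he
  have hN0 : ∀ x ∈ N ∩ e.source, ψ (fun i => f i x) = 0 := fun x hx => (heO hx.2).2.1 hx.1
  have hS0 := eq_zero_on_chartSlice θ hk he (h := g) hh hN0 hham
    (fun x hx => (heO hx).2.2) htarget
  -- The flowed-out slice has dimension `n - 1 + 1`; this equals `n` because `1 ≤ n`.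
  rw [Nat.sub_add_cancel hn] at hsub hint hS0
  have hW : ∀ x ∈ e.source, θ.hamiltonian (fun y => ψ fun i => f i y) x ≠ 0 :=
    fun x hx => (heO hx).1
  exact ⟨e, he, hme, ⟨hk, hham, p, δ, hδ, htarget⟩, hW, hN0,
    isIntermediateIntegralOn_comp θ D hf hψ hW 0 _ (fun x hx => hx.1) hint hS0, hsub, hS0⟩

/-- Near a characteristic point there is a function in involution with `h`, vanishing on the datum,
whose Hamiltonian field is transverse to the datum. -/
theorem exists_transverse_involution [T2Space M] {k : ℕ} (hk : k < n)
    (hN : IsIntegralSubmanifold θ k N) {m : M} (hm : m ∈ N) {h : M → ℝ}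
    (hh : ContMDiff (𝓡 (2 * n + 1)) 𝓘(ℝ, ℝ) ∞ h) (hne : θ.hamiltonian h m ≠ 0)
    (htan : ∀ᶠ x in 𝓝[N] m, θ.hamiltonian h x ∈ tangentPlane (2 * n + 1) N x) :
    ∃ g : M → ℝ, ContMDiff (𝓡 (2 * n + 1)) 𝓘(ℝ, ℝ) ∞ g ∧ (∀ᶠ x in 𝓝 m, x ∈ N → g x = 0) ∧
      θ.hamiltonian g m ∉ tangentPlane (2 * n + 1) N m ∧
      ∀ᶠ x in 𝓝 m, mvfderiv (𝓡 (2 * n + 1)) h x (θ.hamiltonian g x) = 0 := by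
  obtain ⟨e₀, he₀, hm₀⟩ := hN.1.exists_sliceChart hm
  obtain ⟨Y, hY, hYh⟩ := θ.exists_hamiltonian_chart he₀.mem_atlas hh
  have hYm : Y (e₀ m) ≠ 0 := by
    rw [← hYh m hm₀]
    exact fun h0 => hne ((chartEquiv he₀.mem_atlas hm₀).map_eq_zero_iff.1 h0)
  have htan' : ∀ᶠ y in 𝓝 (e₀ m), y ∈ sliceSpace (2 * n + 1) k → Y y ∈ sliceSpace (2 * n + 1) k := by
    filter_upwards [(e₀.tendsto_symm hm₀).eventually (eventually_nhdsWithin_iff.1 htan),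
      e₀.open_target.mem_nhds (e₀.map_source hm₀)] with y hy hyt hyS
    have hx := e₀.map_target hyt
    have hxN : e₀.symm y ∈ N := (he₀.mem_iff _ hx).2 (by rwa [e₀.right_inv hyt])
    have h1 := (mem_tangentPlane_iff he₀ hx hxN _).1 (hy hxN)
    rwa [hYh _ hx, e₀.right_inv hyt] at h1
  obtain ⟨e, he, hme, hes, j, hjk, hej⟩ :=
    he₀.exists_straight_of_tangent hm₀ hm hY hYm htan'
  -- `Z` is the prescribed value of `Y_g` at `m`: orthogonality to `T_m N` is forced by `g = 0` on
  -- `N`.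
  obtain ⟨Z, hZC, hZT, hZ⟩ := exists_orthogonal_not_mem (θ.nondegenerate m)
    (θ.extDerivForm_self m) (θ.finrank_plane m) (hN.2 m hm)
    (by rwa [hN.finrank_tangentPlane (by omega) hm])
  -- The covector `dθ(Z, ·)` at `m`, read as a linear function of the coordinates. It vanishes on
  -- the slice, so `g` vanishes on `N` near `m`. The straightened `Y_h` is a constant slice vector,
  -- so `Y_h g = 0` near `m` and not only on `N`.
  let η : Euc (2 * n + 1) →L[ℝ] ℝ := LinearMap.toContinuousLinearMap
    ((extDerivForm θ.form m Z).comp (chartVec e m).toLinearMap)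
  have hη : ∀ v, η v = extDerivForm θ.form m Z (chartVec e m v) := fun v => rfl
  have hηS : ∀ v ∈ sliceSpace (2 * n + 1) k, η v = 0 := fun v hv => by
    rw [hη]
    exact hZ _ ((mem_tangentPlane_iff he hme hm _).2 (by rwa [chartDeriv_chartVec he.mem_atlas hme]))
  obtain ⟨g, hg, hgη⟩ := exists_contMDiff_eventuallyEq e.open_source hme
    (f := fun x => η (e x))
    (η.contDiff.contMDiff.comp_contMDiffOn (contMDiffOn_of_mem_maximalAtlas he.mem_atlas))
  have hdg : ∀ᶠ x in 𝓝 m, x ∈ e.source ∧ ∀ v,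
      mvfderiv (𝓡 (2 * n + 1)) g x v = η (chartDeriv e x v) := by
    filter_upwards [hgη.eventually_nhds, e.open_source.mem_nhds hme] with x hx hxs
    refine ⟨hxs, fun v => ?_⟩
    rw [mvfderiv_eq_fderiv_chart he.mem_atlas (hg.mdifferentiableAt (by simp)) hxs]
    have h1 : g ∘ e.symm =ᶠ[𝓝 (e x)] η := by
      filter_upwards [(e.tendsto_symm hxs).eventually hx,
        e.open_target.mem_nhds (e.map_source hxs)] with y hy hyt
      rw [Function.comp_apply, hy, e.right_inv hyt]
    rw [h1.fderiv_eq, ContinuousLinearMap.fderiv]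
  refine ⟨g, hg, ?_, ?_, ?_⟩
  · filter_upwards [hgη, e.open_source.mem_nhds hme] with x hx hxs hxN
    rw [hx]
    exact hηS _ ((he.mem_iff x hxs).1 hxN)
  · have h1 : Z = θ.hamiltonian g m := θ.eq_hamiltonian hZC fun v _ => by
      rw [hdg.self_of_nhds.2 v, hη, chartVec_chartDeriv he.mem_atlas hme]
    rwa [← h1]
  · filter_upwards [hdg] with x hx
    rw [mvfderiv_hamiltonian_swap, hx.2, hej x hx.1 _ (hYh x (hes hx.1)),
      hηS _ (unitVec_mem_sliceSpace hjk), neg_zero]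

/-- The differentials of `k` functions restricted to a space of dimension less than `k` are
linearly dependent. -/
theorem exists_linear_relation {k : ℕ} (F : Fin k → M → ℝ) {m : M}
    {T : Submodule ℝ (TangentSpace (𝓡 (2 * n + 1)) m)} (hT : Module.finrank ℝ T < k) :
    ∃ c : Fin k → ℝ, c ≠ 0 ∧ ∀ v ∈ T, ∑ i, c i * mvfderiv (𝓡 (2 * n + 1)) (F i) m v = 0 := by
  let A : (Fin k → ℝ) →ₗ[ℝ] Module.Dual ℝ T := Fintype.linearCombination ℝ
    fun i => (mvfderiv (𝓡 (2 * n + 1)) (F i) m).toLinearMap.domRestrict T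
  have h1 : LinearMap.ker A ≠ ⊥ := LinearMap.ker_ne_bot_of_finrank_lt (by
    rw [Subspace.dual_finrank_eq, Module.finrank_fin_fun]; exact hT)
  obtain ⟨c, hc, hc0⟩ := Submodule.exists_mem_ne_zero_of_ne_bot h1
  refine ⟨c, hc0, fun v hv => ?_⟩
  have h2 : A c ⟨v, hv⟩ = 0 := by rw [LinearMap.mem_ker.1 hc]; rfl
  rw [Fintype.linearCombination_apply, LinearMap.sum_apply] at h2
  exact h2

theorem hamiltonian_comp_eq {ψ : (Fin n → ℝ) → ℝ}
    (hfs : ∀ i, ContMDiff (𝓡 (2 * n + 1)) 𝓘(ℝ, ℝ) ∞ (f i)) (hψ : ContDiff ℝ ∞ ψ) {m : M}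
    {c : Fin n → ℝ} (hc : ∀ i, partialAt ψ (fun i => f i m) i = c i) :
    θ.hamiltonian (fun y => ψ fun i => f i y) m = ∑ i, c i • θ.hamiltonian (f i) m := by
  rw [hamiltonian_comp θ hfs hψ]
  exact Finset.sum_congr rfl fun i _ => by rw [hc i]

/-- If `ψ(f_1, …, f_n)` vanishes on a datum which is characteristic at `x`, its Hamiltonian field is
tangent to the datum at `x`. -/
theorem hamiltonian_mem_of_characteristic {k : ℕ} (hN : IsIntegralSubmanifold θ k N)
    (hfs : ∀ i, ContMDiff (𝓡 (2 * n + 1)) 𝓘(ℝ, ℝ) ∞ (f i)) {ψ : (Fin n → ℝ) → ℝ}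
    (hψ : ContDiff ℝ ∞ ψ) {x : M} (hx : x ∈ N)
    (hψ0 : ∀ᶠ y in 𝓝 x, y ∈ N → ψ (fun i => f i y) = 0) (hchar : ¬ NonCharacteristicAt θ f N x) :
    θ.hamiltonian (fun y => ψ fun i => f i y) x ∈ tangentPlane (2 * n + 1) N x := by
  obtain ⟨e, he, hxe⟩ := hN.1.exists_sliceChart hx
  rw [hamiltonian_comp θ hfs hψ]
  by_contra hcon
  -- The partial derivatives of `ψ` at `x` would be coefficients exhibiting `x` as
  -- non-characteristic.
  refine hchar ⟨_, fun v hv => ?_, hcon⟩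
  rw [← mvfderiv_comp hfs hψ]
  exact mvfderiv_eq_zero_of_const he hxe hx (contMDiff_comp hfs hψ) hψ0 hv

end Solutions

end MongeAmpere

end

/-! ### The main theorem -/

theorem mainTheorem10 {n : ℕ} (hn : 1 ≤ n)
    {M : Type*} [TopologicalSpace M] [T2Space M]
    [ChartedSpace (EuclideanSpace ℝ (Fin (2 * n + 1))) M] [IsManifold (𝓡 (2 * n + 1)) ∞ M]
    (θ : MongeAmpere.ContactForm n M) (D : MongeAmpere.Subdistribution θ)
    (f : Fin n → M → ℝ)
    (hf : (∀ i, MongeAmpere.IsFirstIntegral (n := n) D.plane (f i)) ∨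
      (∀ i, MongeAmpere.IsFirstIntegral (n := n) (fun m => θ.orth m (D.plane m)) (f i)))
    (hind : MongeAmpere.IndependentFunctions θ f)
    (N : Set M) (hN : MongeAmpere.IsIntegralSubmanifold θ (n - 1) N) :
    -- almost all points of the Cauchy datum are regular
    N ⊆ closure {m ∈ N | MongeAmpere.IsRegularPoint θ f N m} ∧
    -- near each regular point the datum extends to a solution, on which an intermediate integral
    -- of the form `ψ(f_1, …, f_n)` vanishes
    (∀ m ∈ N, MongeAmpere.IsRegularPoint θ f N m →
      ∃ W : Set M, IsOpen W ∧ m ∈ W ∧ ∃ ψ : (Fin n → ℝ) → ℝ, ContDiff ℝ ∞ ψ ∧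
        (∀ x ∈ W, θ.hamiltonian (fun y => ψ (fun i => f i y)) x ≠ 0) ∧
        MongeAmpere.IsIntermediateIntegralOn θ (MongeAmpere.goursatEquation θ D)
          (fun y => ψ (fun i => f i y)) W ∧
        (∀ x ∈ N ∩ W, ψ (fun i => f i x) = 0) ∧
        ∃ S ⊆ W, MongeAmpere.IsSolution θ (MongeAmpere.goursatEquation θ D) S ∧
          N ∩ W ⊆ S ∧ ∀ x ∈ S, ψ (fun i => f i x) = 0) ∧
    -- near each regular non-characteristic point the solution is the flow-out of the datum along
    -- the Hamiltonian field of such an intermediate integral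
    (∀ m ∈ N, MongeAmpere.IsRegularPoint θ f N m → MongeAmpere.NonCharacteristicAt θ f N m →
      ∃ W : Set M, IsOpen W ∧ m ∈ W ∧ ∃ ψ : (Fin n → ℝ) → ℝ, ContDiff ℝ ∞ ψ ∧
        (∀ x ∈ W, θ.hamiltonian (fun y => ψ (fun i => f i y)) x ≠ 0) ∧
        MongeAmpere.IsIntermediateIntegralOn θ (MongeAmpere.goursatEquation θ D)
          (fun y => ψ (fun i => f i y)) W ∧
        (∀ x ∈ N ∩ W, ψ (fun i => f i x) = 0) ∧
        θ.hamiltonian (fun y => ψ (fun i => f i y)) m ∉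
          MongeAmpere.tangentPlane (2 * n + 1) N m ∧
        ∃ V : Set M, IsOpen V ∧ m ∈ V ∧ V ⊆ W ∧ ∃ ε : ℝ, 0 < ε ∧
          N ∩ V ⊆ MongeAmpere.flowOut (n := n)
            (θ.hamiltonian (fun y => ψ (fun i => f i y))) (N ∩ V) ε ∧
          MongeAmpere.flowOut (n := n)
            (θ.hamiltonian (fun y => ψ (fun i => f i y))) (N ∩ V) ε ⊆ W ∧
          MongeAmpere.IsSolution θ (MongeAmpere.goursatEquation θ D)
            (MongeAmpere.flowOut (n := n)
              (θ.hamiltonian (fun y => ψ (fun i => f i y))) (N ∩ V) ε)) := by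
  have hfs : ∀ i, ContMDiff (𝓡 (2 * n + 1)) 𝓘(ℝ, ℝ) ∞ (f i) := fun i => by
    rcases hf with hf | hf <;> exact (hf i).1
  -- The coefficients witnessing non-characteristicity are realised as the differential of a
  -- relation `ψ`, whose Hamiltonian field at `m` is then the given transverse vector.
  have htransverse : ∀ m ∈ N, MongeAmpere.IsRegularPoint θ f N m →
      MongeAmpere.NonCharacteristicAt θ f N m → ∃ ψ : (Fin n → ℝ) → ℝ, ContDiff ℝ ∞ ψ ∧
        (∀ᶠ x in 𝓝 m, x ∈ N → ψ (fun i => f i x) = 0) ∧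
        θ.hamiltonian (fun y => ψ (fun i => f i y)) m ∉
          MongeAmpere.tangentPlane (2 * n + 1) N m := by
    rintro m hm ⟨⟨r, hr⟩, -⟩ ⟨c, hc, hcN⟩
    obtain ⟨ψ, hψ, hψ0, hψc⟩ := MongeAmpere.exists_relation hN.1 hfs hm hr hc
    exact ⟨ψ, hψ, hψ0, by rwa [MongeAmpere.hamiltonian_comp_eq hfs hψ hψc]⟩
  have hne : ∀ (h : M → ℝ) (m : M), θ.hamiltonian h m ∉
      MongeAmpere.tangentPlane (2 * n + 1) N m → θ.hamiltonian h m ≠ 0 := fun h m h1 h0 =>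
    h1 (h0 ▸ zero_mem _)
  have hself : ∀ (h : M → ℝ) (x : M), mvfderiv (𝓡 (2 * n + 1)) h x (θ.hamiltonian h x) = 0 :=
    fun h x => by
      rw [← θ.omega_hamiltonian h x _ (θ.hamiltonian_mem h x), θ.extDerivForm_self]
  refine ⟨MongeAmpere.subset_closure_regular θ hN.1 hfs, fun m hm hreg => ?_,
    fun m hm hreg hnc => ?_⟩
  · obtain ⟨ψ, hψ, hψ0, hψne, g, hg, hg0, hgt, hgh⟩ : ∃ ψ : (Fin n → ℝ) → ℝ, ContDiff ℝ ∞ ψ ∧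
        (∀ᶠ x in 𝓝 m, x ∈ N → ψ (fun i => f i x) = 0) ∧
        θ.hamiltonian (fun y => ψ (fun i => f i y)) m ≠ 0 ∧
        ∃ g : M → ℝ, ContMDiff (𝓡 (2 * n + 1)) 𝓘(ℝ, ℝ) ∞ g ∧ (∀ᶠ x in 𝓝 m, x ∈ N → g x = 0) ∧
          θ.hamiltonian g m ∉ MongeAmpere.tangentPlane (2 * n + 1) N m ∧
          ∀ᶠ x in 𝓝 m, mvfderiv (𝓡 (2 * n + 1)) (fun y => ψ fun i => f i y) x
            (θ.hamiltonian g x) = 0 := by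
      by_cases hnc : MongeAmpere.NonCharacteristicAt θ f N m
      -- Here `g = h` works, since `Y_h h = ω(Y_h, Y_h) = 0`.
      · obtain ⟨ψ, hψ, hψ0, hψt⟩ := htransverse m hm hreg hnc
        exact ⟨ψ, hψ, hψ0, hne _ _ hψt, _, MongeAmpere.contMDiff_comp hfs hψ, hψ0, hψt,
          Eventually.of_forall (hself _)⟩
      -- By regularity the datum is characteristic at all nearby points. A nonzero relation exists
      -- because `n` covectors on a space of dimension `n - 1` are dependent.
      · obtain ⟨⟨r, hr⟩, hchar⟩ := hreg
        have hchar := hchar.resolve_left hnc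
        have hT := hN.finrank_tangentPlane (by omega) hm
        obtain ⟨c, hc0, hc⟩ := MongeAmpere.exists_linear_relation f
          (T := MongeAmpere.tangentPlane (2 * n + 1) N m) (by rw [hT]; omega)
        obtain ⟨ψ, hψ, hψ0, hψc⟩ := MongeAmpere.exists_relation hN.1 hfs hm hr hc
        have hψne : θ.hamiltonian (fun y => ψ (fun i => f i y)) m ≠ 0 := by
          rw [MongeAmpere.hamiltonian_comp_eq hfs hψ hψc]
          exact MongeAmpere.sum_hamiltonian_ne_zero hind hc0
        refine ⟨ψ, hψ, hψ0, hψne, MongeAmpere.exists_transverse_involution (by omega) hN hm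
          (MongeAmpere.contMDiff_comp hfs hψ) hψne ?_⟩
        -- Tangency of `Y_h` is needed on a neighbourhood in `N`, so that it can be straightened
        -- inside a slice chart; hence the second half of the definition of a regular point.
        filter_upwards [hchar, self_mem_nhdsWithin,
          mem_nhdsWithin_of_mem_nhds hψ0.eventually_nhds] with x hx hxN hx0
        exact MongeAmpere.hamiltonian_mem_of_characteristic hN hfs hψ hxN hx0 hx
    obtain ⟨e, -, hme, -, hW, hN0, hS, hNS, hS0⟩ :=
      MongeAmpere.exists_solution hn D hf hN hm hψ hψ0 hψne hg hg0 hgt hgh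
    exact ⟨e.source, e.open_source, hme, ψ, hψ, hW,
      MongeAmpere.isIntermediateIntegralOn_comp θ D hf hψ hW, hN0, _, fun x hx => hx.1, hS, hNS,
      hS0⟩
  · obtain ⟨ψ, hψ, hψ0, hψt⟩ := htransverse m hm hreg hnc
    have hh := MongeAmpere.contMDiff_comp hfs hψ
    obtain ⟨e, he, hme, ⟨hk, hham, p, δ, hδ, htarget⟩, hW, hN0, hS, hNS, hS0⟩ :=
      MongeAmpere.exists_solution hn D hf hN hm hψ hψ0 (hne _ _ hψt) hh hψ0 hψt
        (Eventually.of_forall (hself _))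
    have hflow := MongeAmpere.flowOut_eq_chartSlice hk he (θ.contMDiff_hamiltonian hh) hham hδ
      htarget
    rw [Nat.sub_add_cancel hn] at hflow
    -- Both `W` and `V` are the domain of the boxed chart, and `ε` is its half-width `δ`; the
    -- flow-out is then exactly the chart slice.
    refine ⟨e.source, e.open_source, hme, ψ, hψ, hW,
      MongeAmpere.isIntermediateIntegralOn_comp θ D hf hψ hW, hN0, hψt, e.source, e.open_source,
      hme, Subset.rfl, δ, hδ, ?_⟩
    rw [hflow]
    exact ⟨hNS, fun x hx => hx.1, hS⟩
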